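/- Work over $\mathbb{C}$. The weighted proximity graph $G_\varphi$ of a plane Cremona map $\varphi\colon\mathbb{P}^2\dashrightarrow\mathbb{P}^2$ (a birational map) is the weighted digraph whose vertices are the base points of $\varphi$, proper and infinitely near, with an arrow $p\to q$ if and only if $p$ is proximate to $q$ (that is, $p$ is infinitely near $q$ and lies on the strict transform of the exceptional curve of the blow-up of $q$), and in which each vertex has as its weight the multiplicity of $\varphi$ at that point. A plane Cremona map is cubic if it is given by three forms of degree $3$ without common factor. Theorem. Each weighted proximity graph of a cubic plane Cremona map has exactly five vertices, one of weight $2$ and four of weight $1$. Up to isomorphism of weighted digraphs, there are exactly $21$ weighted proximity graphs of cubic plane Cremona maps, namely the following pairwise non-isomorphic graphs on vertices $v_0,v_1,v_2,v_3,v_4$, where $v_0$ has weight $2$ and $v_1,\dots,v_4$ have weight $1$, and where $ij$ stands for an arrow $v_i\to v_j$: 1. $43,\,32,\,21,\,10,\,20$; 2. $43,\,21,\,10,\,20$; 3. $32,\,21,\,10,\,20$; 4. $43,\,30,\,21,\,10$; 5. $43,\,32,\,10,\,20$; 6. $43,\,32,\,21,\,10$; 7. $21,\,10,\,20$; 8.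 $32,\,10,\,20$; 9. $43,\,10,\,20$; 10. $32,\,21,\,10$; 11. $43,\,21,\,10$; 12. $43,\,32,\,10$; 13. $43,\,32,\,21$; 14. $10,\,20$; 15. $21,\,10$; 16. $43,\,10$; 17. $43,\,21$; 18. $43,\,32$; 19. $10$; 20. $43$; 21. no arrows. Each of these 21 graphs is the weighted proximity graph of some cubic plane Cremona map. -/

import Mathlib

open scoped LinearAlgebra.Projectivization

namespace Cremona

noncomputable section

/-! ### Plane Cremona maps -/

/-- `f` and `g` are triples of ternary forms.  `CompIsId g f` says that the rational map
`[g 0 : g 1 : g 2] ∘ [f 0 : f 1 : f 2]` is the identity of the projective plane: substituting the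
`f j` into the `g i` gives the coordinates `X i`, up to a common nonzero factor. -/
def CompIsId (g f : Fin 3 → MvPolynomial (Fin 3) ℂ) : Prop :=
  ∃ h : MvPolynomial (Fin 3) ℂ, h ≠ 0 ∧
    ∀ i, MvPolynomial.bind₁ f (g i) = h * MvPolynomial.X i

/-- A plane Cremona map over `ℂ`: a birational map `[x : y : z] ↦ [f 0 : f 1 : f 2]` of the
projective plane to itself, given by forms of the same degree without common factor.
That degree is the degree of the map. -/
structure PlaneCremonaMap where
  /-- the degree of the map -/
  degree : ℕ
  /-- the three forms that define the map -/
  form : Fin 3 → MvPolynomial (Fin 3) ℂ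
  isHomogeneous : ∀ i, (form i).IsHomogeneous degree
  no_common_factor : ∀ q : MvPolynomial (Fin 3) ℂ, (∀ i, q ∣ form i) → IsUnit q
  /-- there is a rational map of the plane which is a two-sided inverse -/
  birational : ∃ (e : ℕ) (g : Fin 3 → MvPolynomial (Fin 3) ℂ),
    (∀ i, (g i).IsHomogeneous e) ∧ CompIsId g form ∧ CompIsId form g

/-! ### Points of the bubble space

An infinitely near point is reached from a proper point of the plane by blowing up finitely many
points, each on the exceptional curve of the previous blow-up.  The points of each exceptional
curve are labelled by `ℂ ∪ {∞}` as follows.  The point `p` to be blown up is the origin of an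
affine chart with coordinates `(x, y)`, in which the previous exceptional curve, if there is one,
is `x = 0`.  The blow-up of the origin is covered by two charts,
`(u, v) ↦ (u, u * v)` and `(u', v') ↦ (u' * v', v')`, in which the new exceptional curve is `u = 0`
and `v' = 0`, respectively.  The label `t : ℂ` is the point `(u, v) = (0, t)`, and `∞` is the
origin of the second chart.  New coordinates in which that point is the origin and the new
exceptional curve is `x = 0` are `(u, v - t)`, and `(v', u')`, respectively. -/

/-- A point of the bubble space of the projective plane over `ℂ`: a proper point `base` of the
plane, and the labels in `ℂ ∪ {∞}` of the successive points on the exceptional curves. -/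
@[ext]
structure BubblePoint where
  /-- the proper point below -/
  base : ℙ ℂ (Fin 3 → ℂ)
  /-- the labels of the points of the first, second, ... neighbourhood leading to the point -/
  labels : List (OnePoint ℂ)

/-- Polynomials in the two coordinates of a chart. -/
abbrev LocalPoly := MvPolynomial (Fin 2) ℂ

open Classical in
/-- Affine coordinates of the plane centred at the proper point `p = [a : b : c]`: the homogeneous
coordinates of the plane as polynomials in the coordinates `(x, y)` of a chart in which `p` is the
origin. -/
def affineChart (p : ℙ ℂ (Fin 3 → ℂ)) : Fin 3 → LocalPoly :=
  let a := p.rep 0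
  let b := p.rep 1
  let c := p.rep 2
  if c ≠ 0 then
    ![MvPolynomial.X 0 + MvPolynomial.C (a / c), MvPolynomial.X 1 + MvPolynomial.C (b / c), 1]
  else if b ≠ 0 then
    ![MvPolynomial.X 0 + MvPolynomial.C (a / b), 1, MvPolynomial.X 1]
  else
    ![1, MvPolynomial.X 0, MvPolynomial.X 1]

/-- The coordinates `(x, y)` around the blown-up point as polynomials in the coordinates around
the point with label `t` of the exceptional curve. -/
def blowUpChart (t : OnePoint ℂ) : Fin 2 → LocalPoly :=
  t.elim ![MvPolynomial.X 0 * MvPolynomial.X 1, MvPolynomial.X 0]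
    (fun s => ![MvPolynomial.X 0,
      MvPolynomial.X 0 * (MvPolynomial.X 1 + MvPolynomial.C s)])

/-! ### Linear systems of curves in a chart, multiplicities and strict transforms

A family `g : ι → LocalPoly` stands for the linear system spanned by the curves `g i = 0`; a
one-member family is a single curve. -/

/-- The multiplicity at the origin of the linear system spanned by the `g i`: the minimum of the
multiplicities of its members, which is attained by a general member and by one of the `g i`.
The multiplicity of a curve is the lowest degree of a monomial in its equation. -/
def mult {ι : Type} (g : ι → LocalPoly) : ℕ :=
  (⨅ i, MvPowerSeries.order (g i : MvPowerSeries (Fin 2) ℂ)).toNat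

/-- The strict transform, around the point with label `t` of the exceptional curve `x = 0`, of the
linear system spanned by the `g i`: pull back, and remove the exceptional curve as often as the
multiplicity of the linear system at the blown-up point says. -/
def strictTransform {ι : Type} (t : OnePoint ℂ) (g : ι → LocalPoly) : ι → LocalPoly := fun i =>
  (MvPolynomial.bind₁ (blowUpChart t) (g i)).divMonomial (Finsupp.single 0 (mult g))

/-- The iterated strict transform along the successive points with the labels in the list. -/
def iterStrictTransform {ι : Type} (l : List (OnePoint ℂ)) (g : ι → LocalPoly) : ι → LocalPoly :=
  l.foldl (fun g t => strictTransform t g) g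

/-! ### Proximity -/

/-- `q` is proximate to `p`: `q` is infinitely near `p`, and it lies on the strict transform of the
exceptional curve of the blow-up of `p`.  Here `t` is the label of the point of the first
neighbourhood of `p` which is equal to `q` or below `q`; around it the exceptional curve is
`x = 0`. -/
def Proximate (q p : BubblePoint) : Prop :=
  q.base = p.base ∧ ∃ (t : OnePoint ℂ) (l : List (OnePoint ℂ)), q.labels = p.labels ++ t :: l ∧
    0 < mult (iterStrictTransform l (fun _ : Unit => (MvPolynomial.X 0 : LocalPoly)))

/-! ### Base points of a plane Cremona map -/

/-- The strict transform around `p` of the homaloidal net of `φ`, the linear system spanned by the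
forms defining `φ`. -/
def PlaneCremonaMap.netAt (φ : PlaneCremonaMap) (p : BubblePoint) : Fin 3 → LocalPoly :=
  iterStrictTransform p.labels
    (fun i => MvPolynomial.bind₁ (affineChart p.base) (φ.form i))

/-- The multiplicity of `φ` at the proper or infinitely near point `p`. -/
def PlaneCremonaMap.multAt (φ : PlaneCremonaMap) (p : BubblePoint) : ℕ :=
  mult (φ.netAt p)

/-- `p` is a base point of `φ`. -/
def PlaneCremonaMap.IsBasePoint (φ : PlaneCremonaMap) (p : BubblePoint) : Prop :=
  0 < φ.multAt p

/-! ### Weighted digraphs -/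

/-- A digraph with natural numbers as weights of its vertices. -/
structure WeightedDigraph where
  /-- the vertices -/
  Vertex : Type
  /-- the arrows -/
  graph : Digraph Vertex
  /-- the weights -/
  weight : Vertex → ℕ

/-- Isomorphism of weighted digraphs: a bijection of the vertices that preserves and reflects
arrows and preserves weights. -/
def WeightedDigraph.Isomorphic (G H : WeightedDigraph) : Prop :=
  ∃ e : G.Vertex ≃ H.Vertex,
    (∀ u v, G.graph.Adj u v ↔ H.graph.Adj (e u) (e v)) ∧ ∀ v, G.weight v = H.weight (e v)

/-- Isomorphism as an equivalence relation on weighted digraphs. -/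
instance WeightedDigraph.setoid : Setoid WeightedDigraph where
  r := WeightedDigraph.Isomorphic
  iseqv :=
    { refl := fun _ => ⟨Equiv.refl _, fun _ _ => Iff.rfl, fun _ => rfl⟩
      symm := fun {G H} ⟨e, ha, hw⟩ =>
        ⟨e.symm, fun u v => by simpa using (ha (e.symm u) (e.symm v)).symm,
          fun v => by simpa using (hw (e.symm v)).symm⟩
      trans := fun {G H K} ⟨e, ha, hw⟩ ⟨e', ha', hw'⟩ =>
        ⟨e.trans e', fun u v => (ha u v).trans (ha' (e u) (e v)),
          fun v => (hw v).trans (hw' (e v))⟩ }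

/-- The weighted proximity graph of a plane Cremona map: its vertices are the base points, proper
and infinitely near, there is an arrow `p → q` when `p` is proximate to `q`, and the weight of `p`
is the multiplicity of the map at `p`. -/
def PlaneCremonaMap.proximityGraph (φ : PlaneCremonaMap) : WeightedDigraph where
  Vertex := {p : BubblePoint // φ.IsBasePoint p}
  graph := { Adj := fun p q => Proximate p.1 q.1 }
  weight := fun p => φ.multAt p.1

/-- The arrows of the 21 graphs of the list, on the vertices `0, 1, 2, 3, 4`. -/
def cubicArrows : Fin 21 → List (Fin 5 × Fin 5) :=
  ![[(4, 3), (3, 2), (2, 1), (1, 0), (2, 0)],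
    [(4, 3), (2, 1), (1, 0), (2, 0)],
    [(3, 2), (2, 1), (1, 0), (2, 0)],
    [(4, 3), (3, 0), (2, 1), (1, 0)],
    [(4, 3), (3, 2), (1, 0), (2, 0)],
    [(4, 3), (3, 2), (2, 1), (1, 0)],
    [(2, 1), (1, 0), (2, 0)],
    [(3, 2), (1, 0), (2, 0)],
    [(4, 3), (1, 0), (2, 0)],
    [(3, 2), (2, 1), (1, 0)],
    [(4, 3), (2, 1), (1, 0)],
    [(4, 3), (3, 2), (1, 0)],
    [(4, 3), (3, 2), (2, 1)],
    [(1, 0), (2, 0)],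
    [(2, 1), (1, 0)],
    [(4, 3), (1, 0)],
    [(4, 3), (2, 1)],
    [(4, 3), (3, 2)],
    [(1, 0)],
    [(4, 3)],
    []]

/-- The 21 graphs of the list: the vertex `0` has weight 2, the other four have weight 1. -/
def cubicGraph (n : Fin 21) : WeightedDigraph where
  Vertex := Fin 5
  graph := { Adj := fun u v => (u, v) ∈ cubicArrows n }
  weight := fun v => if v = 0 then 2 else 1

/-- The isomorphism classes of the weighted proximity graphs of cubic plane Cremona maps. -/
def cubicGraphClasses : Set (Quotient WeightedDigraph.setoid) :=
  {c | ∃ φ : PlaneCremonaMap, φ.degree = 3 ∧ c = ⟦φ.proximityGraph⟧}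

end

end Cremona

/-!
The proof puts the net of cubics of a cubic plane Cremona map `φ` into a normal form in which the
base points can be read off from four binary forms.

*The double point.*  The forms `f` of `φ` have a common singular point
(`exists_double_point`).  Let `g` define the inverse, `f (g) = h • X`.  The degree of `h` exceeds
that of the Jacobian determinant of `g`, so some prime `k` divides `h` more often than this
determinant.  The curve `k = 0` is then contracted by `g` to a point, and the chain rule shows that
all partial derivatives of the `f i` vanish there.

*The normal form.*  Let the double point be `[1 : 0 : 0]` in coordinates `(w, x, y)`.  The map sends
the lines through it to lines of a pencil, so the net is spanned by `x C`, `y C` and `D`, where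
`C = w b₁ + b₂` and `D = w a₂ + a₃` with binary forms `b₁`, `b₂`, `a₂`, `a₃` in `(x, y)`
(`exists_cubicData`, `exists_isNormalFrame`).  The quartic `Δ = b₁ a₃ - b₂ a₂` is not zero.
Conversely, such binary forms define a Cremona map when they have no common root and `Δ ≠ 0`
(`CubicData.toMap`).

*The base points.*  Each point other than the double point `P` lies in one direction `t` from `P`.
Let `m` be the multiplicity of `t` as a root of `Δ`, and `k` the minimum of its multiplicities in
`b₁` and `a₂`.  The base points in direction `t` are the first `m` points of a smooth formal arc,
which solves `C = 0` or `D = 0` for varying directions near `t`.  They are simple, because a member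
of the system is smooth along the arc and each blow-up lowers the order of the others along the arc
by one (`mult_chain`).  If `k = 0` the arc starts at a point of the line in direction `t` other than
`P`; otherwise it starts at the point infinitely near `P` in this direction.  Each point of the arc
is proximate to its predecessor, and those proximate to `P` are the first `min k m`, since `k` is,
up to `m`, the order of contact of the arc with the exceptional curve
(`IsNormalFrame.exists_chain`).

*The list.*  Hence the proximity graph is determined by the pairs `(m, min k m)`.  The numbers `m`
have the sum `deg Δ = 4`, and the numbers `k` have a sum of at most `2`, since `b₁` is linear and
`a₂` is quadratic, and not both are zero.  There are 21 multisets of such pairs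
(`exists_perm_cubicChains`), and each occurs (`exists_cubicData_of_multiset`).  The graphs are told
apart by the numbers of certain small subgraphs (`cubicGraph_injective`).
-/

namespace Cremona

open MvPolynomial

/-! ### Homogeneous polynomials and the chain rule -/

theorem order_le_totalDegree {σ : Type*} {p : MvPolynomial σ ℂ} (hp : p ≠ 0) :
    (p : MvPowerSeries σ ℂ).order ≤ p.totalDegree := by
  obtain ⟨m, hm⟩ := MvPolynomial.ne_zero_iff.mp hp
  refine (MvPowerSeries.order_le (d := m) (by simpa using hm)).trans ?_
  have := MvPolynomial.le_totalDegree (MvPolynomial.mem_support_iff.mpr hm)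
  exact_mod_cast this

theorem isHomogeneous_of_le_order {σ : Type*} {p : MvPolynomial σ ℂ}
    (h : (p.totalDegree : ℕ∞) ≤ (p : MvPowerSeries σ ℂ).order) :
    p.IsHomogeneous p.totalDegree := by
  rw [MvPolynomial.IsHomogeneous, MvPolynomial.IsWeightedHomogeneous]
  intro d hd
  have h1 := MvPolynomial.le_totalDegree (MvPolynomial.mem_support_iff.mpr hd)
  have h2 := h.trans (MvPowerSeries.order_le (d := d) (by simpa using hd))
  have h3 : Finsupp.weight (1 : σ → ℕ) d = d.degree := by
    rw [Finsupp.degree_eq_weight_one]; rfl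
  rw [h3]
  have h4 : p.totalDegree ≤ d.degree := by exact_mod_cast h2
  exact le_antisymm h1 h4

/-- A factor of a nonzero homogeneous polynomial is homogeneous: order and total degree are
both additive, and a polynomial is homogeneous when they agree. -/
theorem isHomogeneous_of_mul {σ : Type*} {p q : MvPolynomial σ ℂ} {n : ℕ}
    (h : (p * q).IsHomogeneous n) (h0 : p * q ≠ 0) : p.IsHomogeneous p.totalDegree := by
  have hp := left_ne_zero_of_mul h0
  have hq := right_ne_zero_of_mul h0
  apply isHomogeneous_of_le_order
  have h1 := MvPolynomial.totalDegree_mul_of_isDomain hp hq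
  rw [h.totalDegree h0] at h1
  have h2 : (n : ℕ∞) ≤ ((p * q : MvPolynomial σ ℂ) : MvPowerSeries σ ℂ).order := by
    apply MvPowerSeries.nat_le_order
    intro d hd
    rw [MvPolynomial.coeff_coe]
    exact h.coeff_eq_zero hd.ne
  rw [MvPolynomial.coe_mul, MvPowerSeries.order_mul] at h2
  have hp' := order_le_totalDegree hp
  have hq' := order_le_totalDegree hq
  generalize (p : MvPowerSeries σ ℂ).order = a at *
  generalize (q : MvPowerSeries σ ℂ).order = b at *
  lift a to ℕ using (ne_top_of_le_ne_top (by simp) hp')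
  lift b to ℕ using (ne_top_of_le_ne_top (by simp) hq')
  norm_cast at *
  omega

theorem IsHomogeneous.factor {σ : Type*} {p q : MvPolynomial σ ℂ} {n : ℕ}
    (h : (p * q).IsHomogeneous n) (h0 : p * q ≠ 0) :
    ∃ a b, a + b = n ∧ p.IsHomogeneous a ∧ q.IsHomogeneous b :=
  ⟨_, _, by
    rw [← MvPolynomial.totalDegree_mul_of_isDomain (left_ne_zero_of_mul h0)
      (right_ne_zero_of_mul h0), h.totalDegree h0],
    isHomogeneous_of_mul h h0, isHomogeneous_of_mul (mul_comm p q ▸ h) (mul_comm p q ▸ h0)⟩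

/-- If `q` is homogeneous of degree `b` and `q * p` of degree `b + a`, then `p` is homogeneous of
degree `a`. -/
theorem IsHomogeneous.of_mul_left {σ : Type*} {p q : MvPolynomial σ ℂ} {a b : ℕ}
    (hq : q.IsHomogeneous b) (hq0 : q ≠ 0) (h : (q * p).IsHomogeneous (b + a)) :
    p.IsHomogeneous a := by
  by_cases hp : p = 0
  · rw [hp]; exact isHomogeneous_zero _ _ _
  obtain ⟨b', a', h1, h2, h3⟩ := IsHomogeneous.factor h (mul_ne_zero hq0 hp)
  have := h2.inj_right hq hq0
  have : a' = a := by omega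
  exact this ▸ h3

/-- A value of a form at a scaled point. -/
theorem IsHomogeneous.aeval_smul {σ R : Type*} [CommRing R] [Algebra ℂ R] {p : MvPolynomial σ ℂ}
    {n : ℕ} (h : p.IsHomogeneous n) (c : R) (v : σ → R) :
    aeval (fun i => c * v i) p = c ^ n * aeval v p := by
  rw [aeval_def, aeval_def, eval₂_eq, eval₂_eq, Finset.mul_sum]
  refine Finset.sum_congr rfl fun d hd => ?_
  have : c ^ n = ∏ i ∈ d.support, c ^ d i := by
    rw [Finset.prod_pow_eq_pow_sum, h.degree_eq_sum_deg_support hd]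
  rw [this]
  simp only [mul_pow, Finset.prod_mul_distrib]
  ring

/-- The chain rule. -/
theorem pderiv_bind₁ {n m : ℕ} (g : Fin n → MvPolynomial (Fin m) ℂ) (p : MvPolynomial (Fin n) ℂ)
    (j : Fin m) :
    pderiv j (bind₁ g p) = ∑ k, bind₁ g (pderiv k p) * pderiv j (g k) := by
  induction p using MvPolynomial.induction_on with
  | C a => simp
  | add p q hp hq => simp [hp, hq, add_mul, Finset.sum_add_distrib]
  | mul_X p i hp =>
    simp only [map_mul, Derivation.leibniz, hp, bind₁_X_right, smul_eq_mul, pderiv_X, map_add,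
      add_mul, Finset.sum_add_distrib]
    rw [Finset.sum_eq_single (s := Finset.univ) (f := fun x => (bind₁ g) p *
      (bind₁ g) (Pi.single (M := fun _ => MvPolynomial (Fin n) ℂ) x 1 i) * (pderiv j) (g x)) i]
    · simp only [Pi.single_eq_same, map_one, mul_one, Finset.mul_sum, mul_assoc]
    · intro b _ hb
      simp [hb.symm]
    · simp

/-- A triple of ternary forms. -/
abbrev Triple := Fin 3 → MvPolynomial (Fin 3) ℂ

/-- The Jacobian matrix of a triple of ternary forms. -/
noncomputable def jac (g : Triple) : Matrix (Fin 3) (Fin 3) (MvPolynomial (Fin 3) ℂ) :=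
  Matrix.of fun i j => pderiv j (g i)

theorem jac_comp {f g : Triple} {h : MvPolynomial (Fin 3) ℂ}
    (hfg : ∀ i, bind₁ g (f i) = h * X i) :
    (jac f).map (bind₁ g) * jac g =
      h • (1 : Matrix (Fin 3) (Fin 3) _) + Matrix.of fun i j => X i * pderiv j h := by
  ext1 i j
  have := congrArg (pderiv j) (hfg i)
  rw [pderiv_bind₁] at this
  simp only [Matrix.mul_apply, Matrix.map_apply, jac, Matrix.of_apply, Matrix.add_apply,
    Matrix.smul_apply, this, Derivation.leibniz, smul_eq_mul, pderiv_X, Matrix.one_apply,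
    Pi.single_apply]

theorem isHomogeneous_factor_of_comp {f g : Triple} {d e : ℕ} {h : MvPolynomial (Fin 3) ℂ}
    (hf : ∀ i, (f i).IsHomogeneous d) (hg : ∀ i, (g i).IsHomogeneous e) (h0 : h ≠ 0)
    (hfg : ∀ i, bind₁ g (f i) = h * X i) :
    ∃ n, n + 1 = d * e ∧ h.IsHomogeneous n := by
  have h1 : (h * X 0).IsHomogeneous (e * d) := by
    rw [← hfg 0]
    exact (hf 0).aeval _ hg
  obtain ⟨a, b, hab, ha, hb⟩ := IsHomogeneous.factor h1 (mul_ne_zero h0 (X_ne_zero 0))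
  have := hb.inj_right (isHomogeneous_X ℂ (0 : Fin 3)) (X_ne_zero 0)
  exact ⟨a, by rw [mul_comm d e, ← hab, this], ha⟩

/-- The Jacobian determinant of a birational triple does not vanish: by the chain rule, its
product with another determinant is `h ^ 2 * (h + ∑ X i * ∂ᵢ h) = (n + 1) * h ^ 3`. -/
theorem det_jac_ne_zero {f g : Triple} {d e : ℕ} {h : MvPolynomial (Fin 3) ℂ}
    (hf : ∀ i, (f i).IsHomogeneous d) (hg : ∀ i, (g i).IsHomogeneous e) (h0 : h ≠ 0)
    (hfg : ∀ i, bind₁ g (f i) = h * X i) : (jac g).det ≠ 0 := by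
  obtain ⟨n, -, hn⟩ := isHomogeneous_factor_of_comp hf hg h0 hfg
  have h1 := congrArg Matrix.det (jac_comp hfg)
  rw [Matrix.det_mul] at h1
  have h2 := hn.sum_X_mul_pderiv
  rw [Fin.sum_univ_three, nsmul_eq_mul] at h2
  have h3 : (h • (1 : Matrix (Fin 3) (Fin 3) (MvPolynomial (Fin 3) ℂ)) +
      Matrix.of fun i j => X i * pderiv j h).det = ((n : MvPolynomial (Fin 3) ℂ) + 1) * h ^ 3 := by
    rw [Matrix.det_fin_three]
    simp [Matrix.add_apply, Matrix.smul_apply]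
    linear_combination h ^ 2 * h2
  rw [h3] at h1
  intro hz
  rw [hz, mul_zero] at h1
  have h4 : ((n : MvPolynomial (Fin 3) ℂ) + 1) ≠ 0 := by exact_mod_cast Nat.succ_ne_zero n
  exact mul_ne_zero h4 (pow_ne_zero 3 h0) h1.symm

/-! ### Elimination -/

attribute [local instance] Polynomial.isLocalization Polynomial.algebra in
/-- Polynomials in one variable over a unique factorization domain without a common factor
generate an ideal which contains a nonzero constant. -/
theorem exists_C_mem_span {A ι : Type*} [CommRing A] [IsDomain A] [UniqueFactorizationMonoid A]
    (p : ι → Polynomial A) (hp : ∀ q, (∀ i, q ∣ p i) → IsUnit q) :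
    ∃ r : A, r ≠ 0 ∧ Polynomial.C r ∈ Ideal.span (Set.range p) := by
  classical
  let _ : NormalizedGCDMonoid A :=
    Classical.choice (inferInstance : Nonempty (NormalizedGCDMonoid A))
  let K := FractionRing A
  let I : Ideal (Polynomial K) := (Ideal.span (Set.range p)).map
    (algebraMap (Polynomial A) (Polynomial K))
  have halg : ∀ q : Polynomial A, algebraMap (Polynomial A) (Polynomial K) q =
    q.map (algebraMap A K) := fun q => rfl
  obtain ⟨d, hd⟩ := IsPrincipalIdealRing.principal I
  have hdI : d ∈ I := by rw [hd]; exact Submodule.mem_span_singleton_self d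
  have hdvd : ∀ i, d ∣ (p i).map (algebraMap A K) := by
    intro i
    have : (p i).map (algebraMap A K) ∈ I :=
      Ideal.mem_map_of_mem _ (Ideal.subset_span ⟨i, rfl⟩)
    rw [hd] at this
    exact Ideal.mem_span_singleton.mp this
  have hu : IsUnit d := by
    by_cases hd0 : d = 0
    · exfalso
      have h0 : ∀ i, p i = 0 := by
        intro i
        have := hdvd i
        rw [hd0, zero_dvd_iff] at this
        exact (Polynomial.map_eq_zero_iff (IsFractionRing.injective A K)).mp this
      exact not_isUnit_zero (hp 0 fun i => by rw [h0 i])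
    · set d' := IsLocalization.integerNormalization (nonZeroDivisors A) d with hd'
      obtain ⟨c, hc0, hc⟩ := IsLocalization.integerNormalization_spec (nonZeroDivisors A) d
      rw [← hd', Algebra.smul_def, Polynomial.algebraMap_apply] at hc
      have hcu : IsUnit (Polynomial.C (algebraMap A K c)) := by
        rw [Polynomial.isUnit_C, isUnit_iff_ne_zero]
        exact (map_ne_zero_iff _ (IsFractionRing.injective A K)).mpr
          (mem_nonZeroDivisors_iff_ne_zero.mp hc0)
      have hprim : d'.primPart.map (algebraMap A K) ∣ d := by
        have h1 : d'.primPart.map (algebraMap A K) ∣ d'.map (algebraMap A K) :=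
          Polynomial.map_dvd _ (Polynomial.primPart_dvd d')
        rw [hc] at h1
        exact (hcu.dvd_mul_left).mp h1
      refine Polynomial.isUnit_or_eq_zero_of_isUnit_integerNormalization_primPart hd0
        (hp _ fun i => ?_)
      exact (Polynomial.isPrimitive_primPart d').dvd_of_fraction_map_dvd_fraction_map
        (K := K) (hprim.trans (hdvd i))
  have h1 : algebraMap (Polynomial A) (Polynomial K) 1 ∈ I := by
    rw [I.eq_top_of_isUnit_mem hdI hu]; trivial
  rw [IsLocalization.algebraMap_mem_map_algebraMap_iff
    (Submonoid.map Polynomial.C (nonZeroDivisors A))] at h1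
  obtain ⟨_, ⟨r, hr, rfl⟩, h⟩ := h1
  rw [mul_one] at h
  exact ⟨r, mem_nonZeroDivisors_iff_ne_zero.mp hr, h⟩

/-- A binary form which vanishes at all points `(s, 1)` is zero. -/
theorem eq_zero_of_eval_one_right {r : MvPolynomial (Fin 2) ℂ} {n : ℕ} (hr : r.IsHomogeneous n)
    (h : ∀ s : ℂ, eval ![s, 1] r = 0) : r = 0 := by
  have h1 : r * X 1 = 0 := by
    apply MvPolynomial.funext
    intro v
    rw [map_mul, eval_X, map_zero]
    by_cases hv : v 1 = 0
    · rw [hv, mul_zero]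
    · have h2 := IsHomogeneous.aeval_smul hr (v 1) ![v 0 / v 1, 1]
      have h3 : (fun i => v 1 * ![v 0 / v 1, 1] i) = v := by
        ext i
        fin_cases i
        · simp; field_simp
        · simp
      simp only [h3, aeval_eq_eval, h, mul_zero] at h2
      rw [h2, zero_mul]
  exact (mul_eq_zero.mp h1).resolve_right (X_ne_zero 1)

/-- A binary form which vanishes at all points `(1, s)` is zero. -/
theorem eq_zero_of_eval_one_left {r : MvPolynomial (Fin 2) ℂ} {n : ℕ} (hr : r.IsHomogeneous n)
    (h : ∀ s : ℂ, eval ![1, s] r = 0) : r = 0 := by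
  have h1 : r * X 0 = 0 := by
    apply MvPolynomial.funext
    intro v
    rw [map_mul, eval_X, map_zero]
    by_cases hv : v 0 = 0
    · rw [hv, mul_zero]
    · have h2 := IsHomogeneous.aeval_smul hr (v 0) ![1, v 1 / v 0]
      have h3 : (fun i => v 0 * ![1, v 1 / v 0] i) = v := by
        ext i
        fin_cases i
        · simp
        · simp; field_simp
      simp only [h3, aeval_eq_eval, h, mul_zero] at h2
      rw [h2, zero_mul]
  exact (mul_eq_zero.mp h1).resolve_right (X_ne_zero 0)

attribute [local instance] MvPolynomial.gradedAlgebra in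
/-- Ternary forms without a common factor: their ideal contains a nonzero form in the last two
variables alone. -/
theorem exists_rename_mem_span {ι : Type*} {f : ι → MvPolynomial (Fin 3) ℂ} {d : ℕ}
    (hf : ∀ i, (f i).IsHomogeneous d) (hc : ∀ q, (∀ i, q ∣ f i) → IsUnit q) :
    ∃ (n : ℕ) (r : MvPolynomial (Fin 2) ℂ), r ≠ 0 ∧ r.IsHomogeneous n ∧
      rename Fin.succ r ∈ Ideal.span (Set.range f) := by
  let E := finSuccEquiv ℂ 2
  obtain ⟨r, hr0, hr⟩ := exists_C_mem_span (fun i => E (f i)) (fun q hq => by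
    have := hc (E.symm q) fun i => by
      have := map_dvd E.symm (hq i)
      simpa using this
    simpa using this.map E)
  have hr' : rename Fin.succ r ∈ Ideal.span (Set.range f) := by
    have h1 : E (rename Fin.succ r) = Polynomial.C r := by
      have : (AlgHomClass.toAlgHom E).comp (rename (Fin.succ : Fin 2 → Fin 3)) =
          IsScalarTower.toAlgHom ℂ (MvPolynomial (Fin 2) ℂ) _ := by
        apply MvPolynomial.algHom_ext
        intro i
        simpa [E] using finSuccEquiv_X_succ
      exact DFunLike.congr_fun this r
    rw [← h1] at hr
    have h2 := Ideal.mem_map_of_mem (E.symm : _ →+* MvPolynomial (Fin 3) ℂ) hr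
    rw [Ideal.map_span, ← Set.range_comp] at h2
    simpa [Function.comp_def] using h2
  obtain ⟨n, hn⟩ : ∃ n, homogeneousComponent n r ≠ 0 := by
    by_contra! h
    exact hr0 (by rw [← sum_homogeneousComponent r]; exact Finset.sum_eq_zero fun i _ => h i)
  refine ⟨n, _, hn, homogeneousComponent_isHomogeneous n r, ?_⟩
  rw [rename_homogeneousComponent]
  refine homogeneousComponent_mem_of_mem (Ideal.homogeneous_span _ _ ?_) hr' n
  rintro _ ⟨i, rfl⟩
  exact ⟨d, hf i⟩

/-- In a domain over `ℂ`, a common zero of ternary forms without a common factor has constant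
coordinate ratios: eliminate the other coordinate, and use that `ℂ` is algebraically closed. -/
theorem ratio_of_common_zero_aux {R ι : Type*} [CommRing R] [IsDomain R] [Algebra ℂ R]
    {f : ι → MvPolynomial (Fin 3) ℂ} {d : ℕ}
    (hf : ∀ i, (f i).IsHomogeneous d) (hc : ∀ q, (∀ i, q ∣ f i) → IsUnit q)
    (v : Fin 3 → R) (hv : ∀ i, aeval v (f i) = 0) (h2 : v 2 ≠ 0) :
    ∃ c : ℂ, v 1 = algebraMap ℂ R c * v 2 := by
  obtain ⟨n, r, hr0, hrn, hr⟩ := exists_rename_mem_span hf hc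
  have h1 : aeval (fun i : Fin 2 => v i.succ) r = 0 := by
    have : Ideal.span (Set.range f) ≤ RingHom.ker (aeval (R := ℂ) v) := by
      rw [Ideal.span_le]
      rintro _ ⟨i, rfl⟩
      exact hv i
    have := this hr
    rw [RingHom.mem_ker, aeval_rename] at this
    exact this
  let K := FractionRing R
  let φ := algebraMap R K
  have hinj : Function.Injective φ := IsFractionRing.injective R K
  have h20 : φ (v 2) ≠ 0 := (map_ne_zero_iff φ hinj).mpr h2
  have h3 : aeval (R := ℂ) ![φ (v 1) / φ (v 2), 1] r = 0 := by
    have h4 := IsHomogeneous.aeval_smul hrn (φ (v 2)) ![φ (v 1) / φ (v 2), 1]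
    have h5 : (fun i => φ (v 2) * ![φ (v 1) / φ (v 2), 1] i) = fun i : Fin 2 => φ (v i.succ) := by
      ext i
      fin_cases i
      · simpa using mul_div_cancel₀ _ h20
      · simp
    have h6 : aeval (fun i : Fin 2 => φ (v i.succ)) r = 0 := by
      have := aeval_algebraMap_apply K (fun i : Fin 2 => v i.succ) r
      rw [h1, map_zero] at this
      exact this
    rw [h5, h6] at h4
    exact (mul_eq_zero.mp h4.symm).resolve_left (pow_ne_zero n h20)
  have h7 : IsAlgebraic ℂ (φ (v 1) / φ (v 2)) := by
    refine ⟨aeval ![Polynomial.X, 1] r, fun h =>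
      hr0 (eq_zero_of_eval_one_right hrn fun s => ?_), ?_⟩
    · have := congrArg (Polynomial.aeval s) h
      rw [map_zero, comp_aeval_apply] at this
      rw [← aeval_eq_eval, ← this]
      congr 2
      ext i; fin_cases i <;> simp
    · rw [comp_aeval_apply, ← h3]
      congr 2
      ext i; fin_cases i <;> simp
  have h8 := minpoly.mem_range_of_degree_eq_one ℂ _
    (IsAlgClosed.degree_eq_one_of_irreducible ℂ (minpoly.irreducible h7.isIntegral))
  obtain ⟨c, hc⟩ := h8
  refine ⟨c, hinj ?_⟩
  rw [map_mul, ← IsScalarTower.algebraMap_apply, hc, div_mul_cancel₀ _ h20]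

theorem ratio_of_common_zero {R ι : Type*} [CommRing R] [IsDomain R] [Algebra ℂ R]
    {f : ι → MvPolynomial (Fin 3) ℂ} {d : ℕ}
    (hf : ∀ i, (f i).IsHomogeneous d) (hc : ∀ q, (∀ i, q ∣ f i) → IsUnit q)
    (v : Fin 3 → R) (hv : ∀ i, aeval v (f i) = 0) {j : Fin 3} (hj : v j ≠ 0) (i : Fin 3) :
    ∃ c : ℂ, v i = algebraMap ℂ R c * v j := by
  by_cases hij : i = j
  · exact ⟨1, by rw [hij]; simp⟩
  obtain ⟨σ, hσ1, hσ2⟩ : ∃ σ : Equiv.Perm (Fin 3), σ 1 = i ∧ σ 2 = j := by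
    clear hj; revert hij; revert i j; decide
  have := ratio_of_common_zero_aux (f := fun i => rename σ.symm (f i)) (d := d)
    (fun i => (hf i).rename_isHomogeneous)
    (fun q hq => by
      have := hc (rename σ q) fun i => by
        have := map_dvd (rename (R := ℂ) σ) (hq i)
        simpa [rename_rename] using this
      exact (MulEquiv.isUnit_map (renameEquiv ℂ σ)).mp this)
    (fun k => v (σ k)) (fun i => by
      rw [aeval_rename, ← hv i]
      congr 2
      ext k; simp) (by simpa [hσ2] using hj)
  simpa only [hσ1, hσ2] using this

/-! ### The double point of a cubic plane Cremona map -/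

/-- A polynomial of larger degree than `D` has a prime factor of larger multiplicity than in `D`. -/
theorem exists_irreducible_excess {h D : MvPolynomial (Fin 3) ℂ} (hh : h ≠ 0) (hD : D ≠ 0)
    (hdeg : D.totalDegree < h.totalDegree) :
    ∃ (k : MvPolynomial (Fin 3) ℂ) (v : ℕ) (h' D' : MvPolynomial (Fin 3) ℂ), Irreducible k ∧
      h = k ^ (v + 1) * h' ∧ D = k ^ v * D' ∧ ¬ k ∣ D' := by
  obtain ⟨a, b, c, hrel, rfl, rfl⟩ := UniqueFactorizationMonoid.exists_reduced_factors h hh D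
  have ha0 : a ≠ 0 := right_ne_zero_of_mul hh
  have hc0 : c ≠ 0 := left_ne_zero_of_mul hh
  have hau : ¬ IsUnit a := by
    intro hu
    have h1 : c * a ∣ c * b := mul_dvd_mul_left c hu.dvd
    obtain ⟨q, hq⟩ := h1
    rw [hq] at hD hdeg
    rw [totalDegree_mul_of_isDomain hh (right_ne_zero_of_mul hD)] at hdeg
    omega
  obtain ⟨k, hk, hka⟩ := WfDvdMonoid.exists_irreducible_factor hau ha0
  have hkb : ¬ k ∣ b := fun hkb => hk.not_isUnit (hrel hka hkb)
  obtain ⟨c', hc', hkc⟩ :=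
    (FiniteMultiplicity.of_not_isUnit hk.not_isUnit hc0).exists_eq_pow_mul_and_not_dvd
  obtain ⟨a', ha'⟩ := hka
  generalize multiplicity k c = v at hc'
  refine ⟨k, v, c' * a', c' * b, hk, ?_, ?_, fun hd => ?_⟩
  · rw [hc', ha']; ring
  · rw [hc']; ring
  · rcases hk.prime.dvd_or_dvd hd with h | h
    exacts [hkc h, hkb h]

theorem not_dvd_X_of_dvd_X {k : MvPolynomial (Fin 3) ℂ} (hk : Irreducible k) {i j : Fin 3}
    (hij : i ≠ j) (hi : k ∣ X i) : ¬ k ∣ X j := by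
  intro hj
  have h1 := (hk.associated_of_dvd (X_prime (R := ℂ) (i := i)).irreducible hi).symm.dvd
  exact hij (X_dvd_X.mp (h1.trans hj))

theorem totalDegree_det_jac_le {g : Triple} {e : ℕ} (hg : ∀ i, (g i).IsHomogeneous e) :
    (jac g).det.totalDegree ≤ (e - 1) + (e - 1) + (e - 1) := by
  have h : ∀ i j, (jac g i j).IsHomogeneous (e - 1) := fun i j => (hg i).pderiv
  apply IsHomogeneous.totalDegree_le
  rw [Matrix.det_fin_three]
  have h3 : ∀ i j i' j' i'' j'', (jac g i j * jac g i' j' * jac g i'' j'').IsHomogeneous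
    ((e - 1) + (e - 1) + (e - 1)) := fun i j i' j' i'' j'' =>
      ((h i j).mul (h i' j')).mul (h i'' j'')
  exact (((((h3 _ _ _ _ _ _).sub (h3 _ _ _ _ _ _)).sub (h3 _ _ _ _ _ _)).add
    (h3 _ _ _ _ _ _)).add (h3 _ _ _ _ _ _)).sub (h3 _ _ _ _ _ _)

/-- A common factor can be removed from a rational right inverse. -/
theorem exists_reduce {f g : Triple} {e : ℕ} {h k : MvPolynomial (Fin 3) ℂ}
    (hf : ∀ i, (f i).IsHomogeneous 3) (hg : ∀ i, (g i).IsHomogeneous e) (h0 : h ≠ 0)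
    (hfg : ∀ i, bind₁ g (f i) = h * X i) (hk : Irreducible k) (hdvd : ∀ i, k ∣ g i) :
    ∃ (g' : Triple) (e' : ℕ) (h' : MvPolynomial (Fin 3) ℂ), e' < e ∧
      (∀ i, (g' i).IsHomogeneous e') ∧ h' ≠ 0 ∧ ∀ i, bind₁ g' (f i) = h' * X i := by
  choose g' hg' using hdvd
  have hbind : ∀ i, bind₁ g (f i) = k ^ 3 * bind₁ g' (f i) := by
    intro i
    rw [funext hg']
    exact IsHomogeneous.aeval_smul (hf i) k g'
  obtain ⟨i, hi⟩ : ∃ i, g' i ≠ 0 := by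
    by_contra! hz
    have : bind₁ g' (f 0) = 0 := by
      have h1 := IsHomogeneous.aeval_smul (hf 0) 0 g'
      have h2 : (fun i => 0 * g' i) = g' := by ext1 i; rw [hz, mul_zero]
      rw [h2] at h1
      rw [bind₁, h1]; ring
    have h1 := hbind 0
    rw [this, mul_zero, hfg] at h1
    exact mul_ne_zero h0 (X_ne_zero 0) h1
  obtain ⟨a, b, hab, ha, -⟩ := IsHomogeneous.factor (hg' i ▸ hg i) (mul_ne_zero hk.ne_zero hi)
  have ha0 : a ≠ 0 := by
    rintro rfl
    rw [← totalDegree_zero_iff_isHomogeneous, totalDegree_eq_zero_iff_eq_C] at ha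
    apply hk.not_isUnit
    have h1 := hk.ne_zero
    rw [ha] at h1 ⊢
    exact (isUnit_iff_ne_zero.mpr fun h => h1 (by rw [h, C_0])).map C
  have h3 : k ^ 3 ∣ h := by
    have h4 : ∀ i, k ^ 3 ∣ h * X i := fun i => by rw [← hfg, hbind]; exact dvd_mul_right _ _
    by_cases hX : k ∣ X 0
    · exact hk.prime.pow_dvd_of_dvd_mul_right 3
        (not_dvd_X_of_dvd_X hk (by decide : (0 : Fin 3) ≠ 1) hX) (h4 1)
    · exact hk.prime.pow_dvd_of_dvd_mul_right 3 hX (h4 0)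
  obtain ⟨h', rfl⟩ := h3
  refine ⟨g', b, h', by omega, fun i => ?_, right_ne_zero_of_mul h0, fun i => ?_⟩
  · refine IsHomogeneous.of_mul_left ha hk.ne_zero ?_
    rw [hab, ← hg' i]
    exact hg i
  · refine mul_left_cancel₀ (pow_ne_zero 3 hk.ne_zero) ?_
    rw [← hbind, hfg]; ring

/-- A prime divisor of a nonzero linear form is proportional to it. -/
theorem exists_eq_C_mul_of_dvd_linear {k L : MvPolynomial (Fin 3) ℂ} (hk : Irreducible k)
    (hL : L.IsHomogeneous 1) (hL0 : L ≠ 0) (hd : k ∣ L) : ∃ c : ℂ, L = C c * k := by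
  obtain ⟨q, rfl⟩ := hd
  obtain ⟨a, b, hab, ha, hb⟩ := IsHomogeneous.factor hL hL0
  have ha0 : a ≠ 0 := by
    rintro rfl
    rw [← totalDegree_zero_iff_isHomogeneous, totalDegree_eq_zero_iff_eq_C] at ha
    apply hk.not_isUnit
    have h1 := hk.ne_zero
    rw [ha] at h1 ⊢
    exact (isUnit_iff_ne_zero.mpr fun h => h1 (by rw [h, C_0])).map C
  obtain rfl : b = 0 := by omega
  rw [← totalDegree_zero_iff_isHomogeneous, totalDegree_eq_zero_iff_eq_C] at hb
  exact ⟨coeff 0 q, by rw [← hb, mul_comm]⟩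

/-- Three cubic forms without common factor which have a rational right inverse have a common
singular point.  Some prime `k` divides the factor `h` more often than the Jacobian determinant
of the inverse `g`, as `h` has larger degree.  By the chain rule the Jacobian matrix of the cubics
at `g` is, modulo `k` and up to a nonzero factor, of the form `X i * W j`.  The curve `k = 0` is
mapped by `g` to common zeros of the cubics, hence to a single point `P`, so that a constant matrix
is proportional to `X i * W j` on that curve; so it is zero. -/
theorem exists_double_point {f : Triple} (hf : ∀ i, (f i).IsHomogeneous 3)
    (hc : ∀ q, (∀ i, q ∣ f i) → IsUnit q) (e : ℕ) :
    ∀ (g : Triple) (h : MvPolynomial (Fin 3) ℂ), (∀ i, (g i).IsHomogeneous e) → h ≠ 0 →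
      (∀ i, bind₁ g (f i) = h * X i) →
      ∃ P : Fin 3 → ℂ, P ≠ 0 ∧ ∀ i j, eval P (pderiv j (f i)) = 0 := by
  induction e using Nat.strong_induction_on with
  | _ e ih =>
  intro g h hg h0 hfg
  have hdet := det_jac_ne_zero hf hg h0 hfg
  obtain ⟨n, hn, hhn⟩ := isHomogeneous_factor_of_comp hf hg h0 hfg
  have hdeg : (jac g).det.totalDegree < h.totalDegree := by
    have := totalDegree_det_jac_le hg
    rw [hhn.totalDegree h0]
    omega
  obtain ⟨k, v, h', D', hk, rfl, hD, hkD⟩ := exists_irreducible_excess h0 hdet hdeg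
  by_cases hdvd : ∀ i, k ∣ g i
  · obtain ⟨g', e', h'', he', hg', h0', hfg'⟩ := exists_reduce hf hg h0 hfg hk hdvd
    exact ih e' he' g' h'' hg' h0' hfg'
  push Not at hdvd
  obtain ⟨i₀, hi₀⟩ := hdvd
  -- the Jacobian matrix of the cubics at `g`, modulo `k`
  obtain ⟨W, Z, hW⟩ : ∃ (W : Fin 3 → MvPolynomial (Fin 3) ℂ)
      (Z : Matrix (Fin 3) (Fin 3) (MvPolynomial (Fin 3) ℂ)),
      ∀ i j, D' * bind₁ g (pderiv j (f i)) = k * Z i j + X i * W j := by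
    have h1 := congrArg (· * (jac g).adjugate) (jac_comp hfg)
    simp only [Matrix.mul_assoc, Matrix.mul_adjugate] at h1
    rw [Matrix.add_mul, Matrix.smul_mul, Matrix.one_mul, Matrix.mul_smul, Matrix.mul_one] at h1
    have hder : ∀ j, pderiv j (k ^ (v + 1) * h') =
        k ^ v * ((v + 1 : ℕ) * h' * pderiv j k + k * pderiv j h') := by
      intro j
      rw [Derivation.leibniz, Derivation.leibniz_pow, Nat.add_sub_cancel]
      simp only [smul_eq_mul, nsmul_eq_mul]
      ring
    refine ⟨fun j => ∑ l, ((v + 1 : ℕ) * h' * pderiv l k + k * pderiv l h') *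
      (jac g).adjugate l j, h' • (jac g).adjugate, fun i j => ?_⟩
    have h2 := congrFun (congrFun h1 i) j
    rw [hD] at h2
    refine mul_left_cancel₀ (pow_ne_zero v hk.ne_zero) ?_
    simp only [Matrix.smul_apply, Matrix.add_apply, Matrix.mul_apply, Matrix.of_apply, smul_eq_mul,
      hder, Matrix.map_apply, Fin.sum_univ_three] at h2 ⊢
    simp only [jac, Matrix.of_apply] at h2 ⊢
    linear_combination h2
  -- the curve `k = 0` is contracted by `g`
  let I : Ideal (MvPolynomial (Fin 3) ℂ) := Ideal.span {k}
  have hIp : I.IsPrime := (Ideal.span_singleton_prime hk.ne_zero).mpr hk.prime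
  let R := MvPolynomial (Fin 3) ℂ ⧸ I
  let π : MvPolynomial (Fin 3) ℂ →ₐ[ℂ] R := Ideal.Quotient.mkₐ ℂ I
  have hπ : ∀ p, π p = 0 ↔ k ∣ p := fun p => by
    rw [Ideal.Quotient.mkₐ_eq_mk, Ideal.Quotient.eq_zero_iff_mem, Ideal.mem_span_singleton]
  have hbindπ : ∀ p, π (bind₁ g p) = aeval (fun i => π (g i)) p := fun p => comp_aeval_apply ..
  have hzero : ∀ i, aeval (fun i => π (g i)) (f i) = 0 := by
    intro i
    rw [← hbindπ, hfg, hπ, pow_succ']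
    exact ⟨k ^ v * h' * X i, by ring⟩
  have hi₀' : π (g i₀) ≠ 0 := fun h => hi₀ ((hπ _).mp h)
  choose P hP using fun i => ratio_of_common_zero hf hc (fun i => π (g i)) hzero hi₀' i
  refine ⟨P, fun hP0 => ?_, fun i j => ?_⟩
  · apply hi₀'
    rw [hP i₀, hP0]; simp
  by_contra hM
  -- the constant matrix is proportional to `X i * W j`
  have key : ∀ i', D' * (g i₀) ^ 2 * C (eval P (pderiv j (f i'))) - X i' * W j ∈ I := by
    intro i'
    rw [← Ideal.Quotient.eq_zero_iff_mem, ← Ideal.Quotient.mkₐ_eq_mk ℂ]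
    change π _ = 0
    have h1 := congrArg π (hW i' j)
    have h2 : π k = 0 := (hπ k).mpr dvd_rfl
    rw [map_mul, hbindπ, map_add, map_mul, h2, zero_mul, zero_add, map_mul] at h1
    have h3 : (fun i => π (g i)) = fun i => π (g i₀) * algebraMap ℂ R (P i) := by
      ext1 i; rw [hP i, mul_comm]
    rw [h3, IsHomogeneous.aeval_smul (hf i').pderiv] at h1
    have h4 : aeval (fun i => algebraMap ℂ R (P i)) (pderiv j (f i')) =
        algebraMap ℂ R (eval P (pderiv j (f i'))) := aeval_algebraMap_apply ..
    have h5 : π (C (eval P (pderiv j (f i')))) = algebraMap ℂ R (eval P (pderiv j (f i'))) :=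
      π.commutes _
    rw [h4] at h1
    rw [map_sub, map_mul, map_mul, map_mul, map_pow, h5, ← h1]
    ring
  have hWj : ¬ k ∣ W j := by
    intro hd
    have h1 := Ideal.mem_span_singleton.mp (key i)
    have h2 : k ∣ D' * (g i₀) ^ 2 * C (eval P (pderiv j (f i))) := by
      have := dvd_add h1 (dvd_mul_of_dvd_right hd (X i))
      simpa using this
    have h3 : IsUnit (C (eval P (pderiv j (f i))) : MvPolynomial (Fin 3) ℂ) :=
      (isUnit_iff_ne_zero.mpr hM).map C
    rw [h3.dvd_mul_right] at h2
    rcases hk.prime.dvd_or_dvd h2 with h | h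
    · exact hkD h
    · exact hi₀ (hk.prime.dvd_of_dvd_pow h)
  -- so `k` divides two coprime linear forms
  have hlin : ∀ i', k ∣
      C (eval P (pderiv j (f i'))) * X i - C (eval P (pderiv j (f i))) * X i' := by
    intro i'
    have h1 := I.sub_mem (I.mul_mem_left (C (eval P (pderiv j (f i)))) (key i'))
      (I.mul_mem_left (C (eval P (pderiv j (f i')))) (key i))
    have h2 := Ideal.mem_span_singleton.mp h1
    have h3 : k ∣ (C (eval P (pderiv j (f i'))) * X i - C (eval P (pderiv j (f i))) * X i') *
        W j := by
      convert! h2 using 1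
      ring
    exact (hk.prime.dvd_or_dvd h3).resolve_right hWj
  obtain ⟨a, b, hai, hbi, hab⟩ : ∃ a b : Fin 3, a ≠ i ∧ b ≠ i ∧ a ≠ b := by
    clear * -; revert i; decide
  have hL : ∀ i', i' ≠ i → ∃ c : ℂ, c ≠ 0 ∧
      C (eval P (pderiv j (f i'))) * X i - C (eval P (pderiv j (f i))) * X i' = C c * k := by
    intro i' hi'
    have hne : C (eval P (pderiv j (f i'))) * X i - C (eval P (pderiv j (f i))) * X i' ≠
        (0 : MvPolynomial (Fin 3) ℂ) := by
      intro hz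
      have := congrArg (eval (Pi.single i' 1)) hz
      simp [hi'.symm, hM] at this
    obtain ⟨c, hc⟩ := exists_eq_C_mul_of_dvd_linear hk
      ((isHomogeneous_C_mul_X _ _).sub (isHomogeneous_C_mul_X _ _)) hne (hlin i')
    refine ⟨c, ?_, hc⟩
    rintro rfl
    rw [C_0, zero_mul] at hc
    exact hne hc
  obtain ⟨c, -, hc⟩ := hL a hai
  obtain ⟨c', hc0', hc'⟩ := hL b hbi
  have h1 := congrArg (eval (Pi.single a 1)) hc
  have h2 := congrArg (eval (Pi.single a 1)) hc'
  simp [hai.symm, hab.symm] at h1 h2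
  rcases h2 with h2 | h2
  · exact hc0' h2
  · rw [h2, mul_zero] at h1
    exact hM (neg_eq_zero.mp h1)

/-! ### The normal form of a cubic plane Cremona map -/

/-- Binary forms as ternary forms in the last two variables. -/
noncomputable abbrev bin : MvPolynomial (Fin 2) ℂ →ₐ[ℂ] MvPolynomial (Fin 3) ℂ := rename Fin.succ

/-- The data of a cubic net with double point `[1 : 0 : 0]` in normal form: the net is spanned by
`x * C`, `y * C` and `D`, where `C = w * b₁ + b₂` and `D = w * a₂ + a₃` in the coordinates
`(w, x, y)` of the plane, and the `bᵢ`, `aᵢ` are binary forms in `(x, y)`.  The last two conditions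
say that the net defines a birational map and that it has no fixed component. -/
structure CubicData where
  b₁ : MvPolynomial (Fin 2) ℂ
  b₂ : MvPolynomial (Fin 2) ℂ
  a₂ : MvPolynomial (Fin 2) ℂ
  a₃ : MvPolynomial (Fin 2) ℂ
  hb₁ : b₁.IsHomogeneous 1
  hb₂ : b₂.IsHomogeneous 2
  ha₂ : a₂.IsHomogeneous 2
  ha₃ : a₃.IsHomogeneous 3
  disc_ne_zero : b₁ * a₃ - b₂ * a₂ ≠ 0
  no_common_zero : ∀ v : Fin 2 → ℂ, v ≠ 0 → eval v b₁ = 0 → eval v b₂ = 0 → eval v a₂ = 0 →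
    eval v a₃ ≠ 0

/-- The binary quartic whose roots are the directions of the lines which join the double point to
the simple base points. -/
noncomputable def CubicData.disc (T : CubicData) : MvPolynomial (Fin 2) ℂ :=
  T.b₁ * T.a₃ - T.b₂ * T.a₂

/-- The conic `C` through all base points. -/
noncomputable def CubicData.conic (T : CubicData) : MvPolynomial (Fin 3) ℂ :=
  X 0 * bin T.b₁ + bin T.b₂

/-- The cubic `D` of the net. -/
noncomputable def CubicData.cubic (T : CubicData) : MvPolynomial (Fin 3) ℂ :=
  X 0 * bin T.a₂ + bin T.a₃

/-- The three cubics which span the net. -/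
noncomputable def CubicData.form (T : CubicData) : Triple :=
  ![X 1 * T.conic, X 2 * T.conic, T.cubic]

/-- The linear substitution with matrix `S`. -/
noncomputable def linSub (S : Matrix (Fin 3) (Fin 3) ℂ) : Triple := fun i => ∑ j, C (S i j) * X j

theorem finSuccEquiv_bin (q : MvPolynomial (Fin 2) ℂ) :
    finSuccEquiv ℂ 2 (bin q) = Polynomial.C q := by
  have : (AlgHomClass.toAlgHom (finSuccEquiv ℂ 2)).comp bin =
      IsScalarTower.toAlgHom ℂ (MvPolynomial (Fin 2) ℂ) _ := by
    apply MvPolynomial.algHom_ext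
    intro i
    simpa using finSuccEquiv_X_succ
  exact DFunLike.congr_fun this q

theorem bin_decomposition_unique {p q p' q' : MvPolynomial (Fin 2) ℂ}
    (h : X 0 * bin p + bin q = X 0 * bin p' + bin q') : p = p' ∧ q = q' := by
  have h1 := congrArg (finSuccEquiv ℂ 2) h
  have hX : finSuccEquiv ℂ 2 (X 0) = Polynomial.X := finSuccEquiv_X_zero
  simp only [map_add, map_mul, hX, finSuccEquiv_bin] at h1
  have h2 := congrArg (fun r => r.coeff 1) h1
  have h3 := congrArg (fun r => r.coeff 0) h1
  simp [Polynomial.coeff_C] at h2 h3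
  exact ⟨h2, h3⟩

theorem exists_bin_decomposition {p : MvPolynomial (Fin 3) ℂ} (hp : p.IsHomogeneous 3) :
    ∃ r : ℕ → MvPolynomial (Fin 2) ℂ, (∀ i ≤ 3, (r i).IsHomogeneous (3 - i)) ∧
      p = X 0 ^ 3 * bin (r 3) + X 0 ^ 2 * bin (r 2) + X 0 * bin (r 1) + bin (r 0) := by
  let E := finSuccEquiv ℂ 2
  refine ⟨(E p).coeff, fun i hi => hp.finSuccEquiv_coeff_isHomogeneous i (3 - i) (by omega), ?_⟩
  have hdeg : (E p).natDegree < 4 := by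
    rw [natDegree_finSuccEquiv]
    have := (degreeOf_le_totalDegree p 0).trans hp.totalDegree_le
    omega
  have h1 := (E p).as_sum_range' 4 hdeg
  have hX : E (X 0) = Polynomial.X := finSuccEquiv_X_zero
  apply E.injective
  simp only [map_add, map_mul, map_pow, hX, E, finSuccEquiv_bin]
  conv_lhs => rw [h1]
  simp only [Finset.sum_range_succ, Finset.sum_range_zero, ← Polynomial.C_mul_X_pow_eq_monomial]
  ring

/-- A cubic form with a singular point at `[1 : 0 : 0]`. -/
theorem exists_bin_of_singular {p : MvPolynomial (Fin 3) ℂ} (hp : p.IsHomogeneous 3)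
    (hs : ∀ j, eval ![1, 0, 0] (pderiv j p) = 0) :
    ∃ a c : MvPolynomial (Fin 2) ℂ, a.IsHomogeneous 2 ∧ c.IsHomogeneous 3 ∧
      p = X 0 * bin a + bin c := by
  obtain ⟨r, hr, h⟩ := exists_bin_decomposition hp
  have hev : ∀ (q : MvPolynomial (Fin 2) ℂ), eval ![1, 0, 0] (bin q) = coeff 0 q := by
    intro q
    rw [bin, eval_rename, ← constantCoeff_eq, ← eval_zero]
    congr 2
    ext i
    fin_cases i <;> rfl
  have hpd : ∀ (j : Fin 2) (q : MvPolynomial (Fin 2) ℂ), pderiv j.succ (bin q) = bin (pderiv j q) :=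
    fun j q => pderiv_rename (Fin.succ_injective 2) ..
  have hpd0 : ∀ q : MvPolynomial (Fin 2) ℂ, pderiv 0 (bin q) = 0 := by
    intro q
    apply pderiv_eq_zero_of_notMem_vars
    intro hm
    obtain ⟨i, hi⟩ := Finset.mem_image.mp (vars_rename _ _ hm)
    exact Fin.succ_ne_zero i hi.2
  have hc0 : ∀ {q : MvPolynomial (Fin 2) ℂ} {n : ℕ}, q.IsHomogeneous n → n ≠ 0 → coeff 0 q = 0 :=
    fun hq hn => hq.coeff_eq_zero (by simpa using hn.symm)
  have h1 := hr 1 (by norm_num)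
  have h2 := hr 2 (by norm_num)
  have h3 := hr 3 (by norm_num)
  have h00 := hr 0 (by norm_num)
  have hr3 : r 3 = 0 := by
    have hs0 := hs 0
    rw [h] at hs0
    simp [hev, hpd0, hc0 h1 (by norm_num), hc0 h2 (by norm_num)] at hs0
    rw [Nat.sub_self, ← totalDegree_zero_iff_isHomogeneous, totalDegree_eq_zero_iff_eq_C] at h3
    rw [h3, hs0, C_0]
  have hr2 : r 2 = 0 := by
    have hz : ∀ j, pderiv j (r 2) = 0 := by
      intro j
      have hs0 := hs j.succ
      rw [h, hr3] at hs0
      have hX : pderiv j.succ (X 0 : MvPolynomial (Fin 3) ℂ) = 0 :=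
        pderiv_X_of_ne (Fin.succ_ne_zero j).symm
      have h1' := hc0 (h1.pderiv (i := j)) (by norm_num)
      have h0' := hc0 (h00.pderiv (i := j)) (by norm_num)
      simp [hev, hX, hpd, h1', h0'] at hs0
      have h2' := h2.pderiv (i := j)
      rw [show 3 - 2 - 1 = 0 from rfl, ← totalDegree_zero_iff_isHomogeneous,
        totalDegree_eq_zero_iff_eq_C] at h2'
      rw [h2', hs0, C_0]
    have := h2.sum_X_mul_pderiv
    simpa [hz] using this.symm
  refine ⟨r 1, r 0, h1, h00, ?_⟩
  rw [h, hr3, hr2]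
  simp

/-- A binary form which vanishes at a point is divisible by the linear form of that point. -/
theorem linear_dvd_of_eval_eq_zero {p : MvPolynomial (Fin 2) ℂ} {n : ℕ} (hp : p.IsHomogeneous n)
    {v : Fin 2 → ℂ} (hv : v ≠ 0) (h : eval v p = 0) : C (v 1) * X 0 - C (v 0) * X 1 ∣ p := by
  let I : Ideal (MvPolynomial (Fin 2) ℂ) := Ideal.span {C (v 1) * X 0 - C (v 0) * X 1}
  let π : MvPolynomial (Fin 2) ℂ →ₐ[ℂ] _ := Ideal.Quotient.mkₐ ℂ I
  have hπ : ∀ q, π q = 0 ↔ C (v 1) * X 0 - C (v 0) * X 1 ∣ q := fun q => by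
    rw [Ideal.Quotient.mkₐ_eq_mk, Ideal.Quotient.eq_zero_iff_mem, Ideal.mem_span_singleton]
  have hrel : π (C (v 1)) * π (X 0) = π (C (v 0)) * π (X 1) := by
    have := (hπ _).mpr dvd_rfl
    rw [map_sub, map_mul, map_mul, sub_eq_zero] at this
    exact this
  have key : ∀ k, π (C (v k)) ^ n * π p = 0 := by
    intro k
    have h1 : π p = aeval (fun i => π (X i)) p := by
      rw [← comp_aeval_apply, aeval_X_left_apply]
    rw [h1, ← IsHomogeneous.aeval_smul hp]
    have h2 : (fun i => π (C (v k)) * π (X i)) = fun i => π (X k) * π (C (v i)) := by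
      ext1 i
      fin_cases k <;> fin_cases i <;> simp only [Fin.mk_one, Fin.isValue,
        Fin.zero_eta] <;> first | ring1 | linear_combination hrel | linear_combination -hrel
    rw [h2, IsHomogeneous.aeval_smul hp]
    have h3 : aeval (fun i => π (C (v i))) p = π (C (eval v p)) := by
      rw [← comp_aeval_apply]
      congr 1
      exact aeval_algebraMap_apply ..
    rw [h3, h]; simp
  obtain ⟨k, hk⟩ : ∃ k, v k ≠ 0 := Function.ne_iff.mp hv
  rw [← hπ]
  have hu : IsUnit (π (C (v k)) ^ n) :=
    (((isUnit_iff_ne_zero.mpr hk).map C).map π).pow n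
  exact (hu.mul_right_eq_zero).mp (key k)

/-- The `i`-th coordinate of the cross product. -/
def crossProd {R : Type*} [CommRing R] (a c : Fin 3 → R) (i : Fin 3) : R :=
  a (i + 1) * c (i + 2) - a (i + 2) * c (i + 1)

theorem bind₁_bin (g : Triple) (q : MvPolynomial (Fin 2) ℂ) :
    bind₁ g (bin q) = aeval (fun i : Fin 2 => g i.succ) q := by
  rw [bind₁, bin, aeval_rename]; rfl

/-- A general line through the double point is not contracted: the point `w` of the line in direction
`(x, y)` is mapped to `w a + c`, so the image spans the line with coefficients `a × c`, and these
cannot vanish identically as the Jacobian determinant of the map does not. -/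
theorem exists_crossProd_ne_zero {f g : Triple} {e : ℕ} {h : MvPolynomial (Fin 3) ℂ}
    {a c : Fin 3 → MvPolynomial (Fin 2) ℂ}
    (hf : ∀ i, (f i).IsHomogeneous 3) (hg : ∀ i, (g i).IsHomogeneous e) (h0 : h ≠ 0)
    (hgf : ∀ i, bind₁ f (g i) = h * X i) (hac : ∀ i, f i = X 0 * bin (a i) + bin (c i)) :
    ∃ i, crossProd a c i ≠ 0 := by
  by_contra! hz
  refine det_jac_ne_zero hg hf h0 hgf ?_
  have hpd0 : ∀ q : MvPolynomial (Fin 2) ℂ, pderiv 0 (bin q) = 0 := by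
    intro q
    apply pderiv_eq_zero_of_notMem_vars
    intro hm
    obtain ⟨i, hi⟩ := Finset.mem_image.mp (vars_rename _ _ hm)
    exact Fin.succ_ne_zero i hi.2
  have hA : ∀ i, pderiv 0 (f i) = bin (a i) := by
    intro i
    rw [hac]; simp [hpd0]
  have hE : ∀ i, X 0 * bin (a i) + X 1 * pderiv 1 (f i) + X 2 * pderiv 2 (f i) =
      3 * (X 0 * bin (a i) + bin (c i)) := by
    intro i
    have := (hf i).sum_X_mul_pderiv
    rw [Fin.sum_univ_three, hA, nsmul_eq_mul] at this
    rw [this, hac]; norm_num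
  have hz' : ∀ i, bin (a (i + 1)) * bin (c (i + 2)) - bin (a (i + 2)) * bin (c (i + 1)) = 0 := by
    intro i
    rw [← map_mul, ← map_mul, ← map_sub]
    exact (congrArg bin (hz i)).trans (map_zero _)
  have e0 := hE 0
  have e1 := hE 1
  have e2 := hE 2
  have z0 := hz' 0
  have z1 := hz' 1
  have z2 := hz' 2
  simp only [Fin.isValue, zero_add, Fin.reduceAdd] at z0 z1 z2
  refine (mul_eq_zero.mp ?_).resolve_left (X_ne_zero (R := ℂ) (1 : Fin 3))
  rw [Matrix.det_fin_three]
  simp only [jac, Matrix.of_apply, hA]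
  generalize bin (a 0) = A0 at *
  generalize bin (a 1) = A1 at *
  generalize bin (a 2) = A2 at *
  generalize bin (c 0) = C0 at *
  generalize bin (c 1) = C1 at *
  generalize bin (c 2) = C2 at *
  linear_combination e0 * (A2 * pderiv 2 (f 1) - A1 * pderiv 2 (f 2)) +
    e1 * (A0 * pderiv 2 (f 2) - A2 * pderiv 2 (f 0)) +
    e2 * (A1 * pderiv 2 (f 0) - A0 * pderiv 2 (f 1)) +
    3 * (pderiv 2 (f 0) * z0 + pderiv 2 (f 1) * z1 + pderiv 2 (f 2) * z2)

theorem crossProd_isHomogeneous {a c : Fin 3 → MvPolynomial (Fin 2) ℂ}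
    (ha : ∀ i, (a i).IsHomogeneous 2) (hc : ∀ i, (c i).IsHomogeneous 3) (i : Fin 3) :
    (crossProd a c i).IsHomogeneous 5 :=
  ((ha _).mul (hc _)).sub ((ha _).mul (hc _))

/-- A point of the plane lies on the image of the line through the double point which carries its
preimage. -/
theorem sum_crossProd_mul_X {f g : Triple} {h : MvPolynomial (Fin 3) ℂ}
    {a c : Fin 3 → MvPolynomial (Fin 2) ℂ} (h0 : h ≠ 0)
    (hfg : ∀ i, bind₁ g (f i) = h * X i) (hac : ∀ i, f i = X 0 * bin (a i) + bin (c i)) :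
    ∑ i, aeval (fun i : Fin 2 => g i.succ) (crossProd a c i) * X i = 0 := by
  have key : ∀ i, g 0 * aeval (fun i : Fin 2 => g i.succ) (a i) +
      aeval (fun i : Fin 2 => g i.succ) (c i) = h * X i := by
    intro i
    rw [← hfg, hac, map_add, map_mul, bind₁_bin, bind₁_bin, bind₁_X_right]
  refine mul_left_cancel₀ h0 ?_
  have e0 := key 0
  have e1 := key 1
  have e2 := key 2
  rw [Fin.sum_univ_three, mul_zero]
  simp only [crossProd, map_sub, map_mul, Fin.isValue, zero_add, Fin.reduceAdd]
  linear_combination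
    -(aeval (fun i : Fin 2 => g i.succ) (a 1) * aeval (fun i : Fin 2 => g i.succ) (c 2) -
      aeval (fun i : Fin 2 => g i.succ) (a 2) * aeval (fun i : Fin 2 => g i.succ) (c 1)) * e0 -
    (aeval (fun i : Fin 2 => g i.succ) (a 2) * aeval (fun i : Fin 2 => g i.succ) (c 0) -
      aeval (fun i : Fin 2 => g i.succ) (a 0) * aeval (fun i : Fin 2 => g i.succ) (c 2)) * e1 -
    (aeval (fun i : Fin 2 => g i.succ) (a 0) * aeval (fun i : Fin 2 => g i.succ) (c 1) -
      aeval (fun i : Fin 2 => g i.succ) (a 1) * aeval (fun i : Fin 2 => g i.succ) (c 0)) * e2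

theorem sub_dvd_aeval_sub {R : Type*} [CommRing R] [Algebra ℂ R] {p : MvPolynomial (Fin 2) ℂ}
    {n : ℕ} (hp : p.IsHomogeneous n) (u v : R) (s : ℂ) :
    u - algebraMap ℂ R s * v ∣ aeval ![u, v] p - v ^ n * algebraMap ℂ R (eval ![s, 1] p) := by
  rw [← Ideal.mem_span_singleton, ← Ideal.Quotient.eq_zero_iff_mem, ← Ideal.Quotient.mkₐ_eq_mk ℂ]
  set I := Ideal.span {u - algebraMap ℂ R s * v}
  have hrel : Ideal.Quotient.mkₐ ℂ I u = Ideal.Quotient.mkₐ ℂ I (algebraMap ℂ R s * v) := by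
    rw [← sub_eq_zero, ← map_sub, Ideal.Quotient.mkₐ_eq_mk, Ideal.Quotient.eq_zero_iff_mem]
    exact Ideal.subset_span rfl
  have h1 : v ^ n * algebraMap ℂ R (eval ![s, 1] p) = aeval ![algebraMap ℂ R s * v, v] p := by
    have h2 := IsHomogeneous.aeval_smul hp v (fun i => algebraMap ℂ R (![s, 1] i))
    have h3 : aeval (fun i => algebraMap ℂ R (![s, 1] i)) p = algebraMap ℂ R (eval ![s, 1] p) :=
      aeval_algebraMap_apply ..
    rw [← h3, ← h2]
    congr 2
    ext i
    fin_cases i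
    · simp [mul_comm]
    · simp
  rw [h1, map_sub, sub_eq_zero, comp_aeval_apply, comp_aeval_apply]
  congr 2
  ext i
  fin_cases i
  · exact hrel
  · rfl

/-- The pencil of lines through the double point is mapped to a pencil of lines: the ratio of the
last two coordinates of the inverse is a ratio of linear forms `G₁ / G₂`.  Namely, once `G₁` and
`G₂` are coprime, the curve `G₁ = s G₂` is part of the image of the line `x = s y`, which is a
line. -/
theorem exists_linear_ratio {f g : Triple} {e : ℕ} {h h' : MvPolynomial (Fin 3) ℂ}
    {a c : Fin 3 → MvPolynomial (Fin 2) ℂ}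
    (hf : ∀ i, (f i).IsHomogeneous 3) (hg : ∀ i, (g i).IsHomogeneous e) (h0 : h ≠ 0) (h0' : h' ≠ 0)
    (hgf : ∀ i, bind₁ f (g i) = h * X i) (hfg : ∀ i, bind₁ g (f i) = h' * X i)
    (ha : ∀ i, (a i).IsHomogeneous 2) (hc : ∀ i, (c i).IsHomogeneous 3)
    (hac : ∀ i, f i = X 0 * bin (a i) + bin (c i)) :
    ∃ G₁ G₂ : MvPolynomial (Fin 3) ℂ, G₁.IsHomogeneous 1 ∧ G₂.IsHomogeneous 1 ∧
      bind₁ f G₁ ≠ 0 ∧ X 2 * bind₁ f G₁ = X 1 * bind₁ f G₂ := by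
  have hg2 : g 2 ≠ 0 := by
    intro hz
    have := hgf 2
    rw [hz, map_zero] at this
    exact mul_ne_zero h0 (X_ne_zero 2) this.symm
  obtain ⟨G₁, G₂, d, hrel, hd1, hd2⟩ :=
    UniqueFactorizationMonoid.exists_reduced_factors' (g 1) (g 2) hg2
  have hd0 : d ≠ 0 := by rintro rfl; exact hg2 (by rw [← hd2, zero_mul])
  have hG20 : G₂ ≠ 0 := by rintro rfl; exact hg2 (by rw [← hd2, mul_zero])
  obtain ⟨n, δ, hnδ, hdn, hG2⟩ := IsHomogeneous.factor (hd2 ▸ hg 2) (mul_ne_zero hd0 hG20)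
  have hG1 : G₁.IsHomogeneous δ := IsHomogeneous.of_mul_left hdn hd0 (by rw [hd1, hnδ]; exact hg 1)
  have hratio : X 2 * bind₁ f G₁ = X 1 * bind₁ f G₂ := by
    have e1 := hgf 1
    have e2 := hgf 2
    rw [← hd1, map_mul] at e1
    rw [← hd2, map_mul] at e2
    have hdf : bind₁ f d ≠ 0 := by
      intro hz
      rw [hz, zero_mul] at e1
      exact mul_ne_zero h0 (X_ne_zero 1) e1.symm
    refine mul_left_cancel₀ hdf ?_
    linear_combination X 2 * e1 - X 1 * e2
  have hG1f : bind₁ f G₁ ≠ 0 := by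
    intro hz
    have e1 := hgf 1
    rw [← hd1, map_mul, hz, mul_zero] at e1
    exact mul_ne_zero h0 (X_ne_zero 1) e1.symm
  -- a general line of the image pencil
  obtain ⟨i, hi⟩ := exists_crossProd_ne_zero hf hg h0 hgf hac
  have hN := crossProd_isHomogeneous ha hc
  obtain ⟨s, hs⟩ : ∃ s : ℂ, eval ![s, 1] (crossProd a c i) ≠ 0 := by
    by_contra! hz
    exact hi (eq_zero_of_eval_one_right (hN i) hz)
  set Λ : MvPolynomial (Fin 3) ℂ := ∑ i, C (eval ![s, 1] (crossProd a c i)) * X i with hΛ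
  have hΛ1 : Λ.IsHomogeneous 1 := IsHomogeneous.sum _ _ _ fun i _ => isHomogeneous_C_mul_X _ _
  have hΛ0 : Λ ≠ 0 := by
    intro hz
    have := congrArg (eval (Pi.single i 1)) hz
    rw [hΛ, map_sum, Finset.sum_eq_single i] at this
    · simp [hs] at this
    · intro j _ hj; simp [hj]
    · simp
  have hdvd : G₁ - C s * G₂ ∣ Λ := by
    have hsum := sum_crossProd_mul_X h0' hfg hac
    have hsum' : ∑ i, aeval ![G₁, G₂] (crossProd a c i) * X i = 0 := by
      refine mul_left_cancel₀ (pow_ne_zero 5 hd0) ?_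
      rw [mul_zero, ← hsum, Finset.mul_sum]
      refine Finset.sum_congr rfl fun i _ => ?_
      rw [← mul_assoc, ← IsHomogeneous.aeval_smul (hN i)]
      congr 3
      ext1 j
      fin_cases j
      · exact hd1
      · exact hd2
    have h1 : G₁ - C s * G₂ ∣ G₂ ^ 5 * Λ := by
      have : G₂ ^ 5 * Λ = -∑ i, (aeval ![G₁, G₂] (crossProd a c i) -
          G₂ ^ 5 * C (eval ![s, 1] (crossProd a c i))) * X i := by
        simp only [sub_mul, Finset.sum_sub_distrib, hsum', hΛ, Finset.mul_sum, mul_assoc]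
        ring
      rw [this, dvd_neg]
      exact Finset.dvd_sum fun i _ =>
        dvd_mul_of_dvd_left (sub_dvd_aeval_sub (hN i) G₁ G₂ s) _
    refine IsRelPrime.dvd_of_dvd_mul_left (IsRelPrime.pow_right fun q hq1 hq2 => ?_) h1
    refine hrel ?_ hq2
    have := dvd_add hq1 (dvd_mul_of_dvd_right hq2 (C s))
    simpa using this
  obtain ⟨q, hq⟩ := hdvd
  have hδ : δ ≤ 1 := by
    have h1 := hq ▸ hΛ0
    obtain ⟨p, p', hpp, hp, -⟩ := IsHomogeneous.factor (hq ▸ hΛ1) h1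
    have h2 : (G₁ - C s * G₂).IsHomogeneous δ := hG1.sub (hG2.C_mul s)
    have := h2.inj_right hp (left_ne_zero_of_mul h1)
    omega
  interval_cases δ
  · exfalso
    rw [← totalDegree_zero_iff_isHomogeneous, totalDegree_eq_zero_iff_eq_C] at hG1 hG2
    rw [hG1, hG2, bind₁_C_right, bind₁_C_right] at hratio
    have h1 := congrArg (eval ![0, 1, 0]) hratio
    simp at h1
    rw [← h1, C_0] at hG2
    exact hG20 hG2
  · exact ⟨G₁, G₂, hG1, hG2, hG1f, hratio⟩

theorem sum_mul_X_of_isHomogeneous_one {G : MvPolynomial (Fin 3) ℂ} (hG : G.IsHomogeneous 1) :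
    ∃ γ : Fin 3 → ℂ, G = ∑ i, C (γ i) * X i := by
  refine ⟨fun i => coeff 0 (pderiv i G), ?_⟩
  have h1 := hG.sum_X_mul_pderiv
  rw [one_smul] at h1
  rw [← h1]
  refine Finset.sum_congr rfl fun i _ => ?_
  have h2 := hG.pderiv (i := i)
  rw [Nat.sub_self, ← totalDegree_zero_iff_isHomogeneous, totalDegree_eq_zero_iff_eq_C] at h2
  rw [mul_comm, h1, ← h2]

/-- Two vectors with nonzero cross product are the first rows of an invertible matrix, whose last
row is a coordinate vector. -/
theorem exists_matrix_of_crossProd {γ δ : Fin 3 → ℂ} {k : Fin 3} (h : crossProd γ δ k ≠ 0) :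
    IsUnit (Matrix.of ![γ, δ, Pi.single k 1]).det := by
  rw [isUnit_iff_ne_zero, Matrix.det_fin_three]
  fin_cases k <;> simp [crossProd] at h ⊢ <;> intro hz <;> apply h <;> linear_combination hz

theorem eq_sum_inv_of_rows {σ : Type*} {γ δ : Fin 3 → ℂ} {k : Fin 3} (hk : crossProd γ δ k ≠ 0)
    (u : Fin 3 → MvPolynomial σ ℂ) {w₀ w₁ : MvPolynomial σ ℂ} (h₀ : ∑ l, C (γ l) * u l = w₀)
    (h₁ : ∑ l, C (δ l) * u l = w₁) (i : Fin 3) :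
    u i = ∑ j, C ((Matrix.of ![γ, δ, Pi.single k 1])⁻¹ i j) * ![w₀, w₁, u k] j := by
  set A := Matrix.of ![γ, δ, Pi.single k 1] with hA
  have hrow : ∀ j, ![w₀, w₁, u k] j = ∑ l, C (A j l) * u l := by
    intro j
    fin_cases j
    · exact h₀.symm
    · exact h₁.symm
    · simp [hA, Pi.single_apply]
  have hinv : A⁻¹ * A = 1 := Matrix.nonsing_inv_mul A (exists_matrix_of_crossProd hk)
  simp only [hrow, Finset.mul_sum]
  rw [Finset.sum_comm]
  have h2 : ∀ l, ∑ j, C (A⁻¹ i j) * (C (A j l) * u l) =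
      C ((1 : Matrix (Fin 3) (Fin 3) ℂ) i l) * u l := by
    intro l
    rw [← hinv, Matrix.mul_apply, map_sum, Finset.sum_mul]
    refine Finset.sum_congr rfl fun j _ => ?_
    rw [map_mul, mul_assoc]
  simp only [h2, Matrix.one_apply]
  simp

/-- **Normal form.** Three cubic forms which define a birational map and have a common singular
point at `[1 : 0 : 0]` span the net of some `CubicData`. -/
theorem exists_cubicData {f g : Triple} {e : ℕ} {h h' : MvPolynomial (Fin 3) ℂ}
    (hf : ∀ i, (f i).IsHomogeneous 3) (hnc : ∀ q, (∀ i, q ∣ f i) → IsUnit q)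
    (hg : ∀ i, (g i).IsHomogeneous e) (h0 : h ≠ 0) (h0' : h' ≠ 0)
    (hgf : ∀ i, bind₁ f (g i) = h * X i) (hfg : ∀ i, bind₁ g (f i) = h' * X i)
    (hs : ∀ i j, eval ![1, 0, 0] (pderiv j (f i)) = 0) :
    ∃ (T : CubicData) (B : Matrix (Fin 3) (Fin 3) ℂ), IsUnit B.det ∧
      ∀ i, f i = ∑ j, C (B i j) * T.form j := by
  choose a c ha hc hac using fun i => exists_bin_of_singular (hf i) (hs i)
  obtain ⟨G₁, G₂, hG1, hG2, hG1f, hratio⟩ := exists_linear_ratio hf hg h0 h0' hgf hfg ha hc hac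
  obtain ⟨γ, rfl⟩ := sum_mul_X_of_isHomogeneous_one hG1
  obtain ⟨δ, rfl⟩ := sum_mul_X_of_isHomogeneous_one hG2
  have hbind : ∀ ε : Fin 3 → ℂ, bind₁ f (∑ i, C (ε i) * X i) = ∑ i, C (ε i) * f i := by
    intro ε
    simp [map_sum]
  rw [hbind] at hratio hG1f
  rw [hbind] at hratio
  -- the two image forms are `x * C` and `y * C`
  have hdec : ∀ ε : Fin 3 → ℂ, ∑ i, C (ε i) * f i =
      X 0 * bin (∑ i, C (ε i) * a i) + bin (∑ i, C (ε i) * c i) := by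
    intro ε
    simp only [hac, map_sum, map_mul, Finset.mul_sum, ← Finset.sum_add_distrib, bin, rename_C]
    refine Finset.sum_congr rfl fun i _ => by ring
  have hbX : ∀ i : Fin 2, bin (X i) = X i.succ := fun i => rename_X _ _
  obtain ⟨hα, hβ⟩ := bin_decomposition_unique
    (p := X 1 * ∑ i, C (γ i) * a i) (q := X 1 * ∑ i, C (γ i) * c i)
    (p' := X 0 * ∑ i, C (δ i) * a i) (q' := X 0 * ∑ i, C (δ i) * c i) (by
      rw [hdec, hdec] at hratio
      simp only [map_mul, hbX] at hratio ⊢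
      simp only [Fin.isValue, Fin.succ_zero_eq_one, Fin.succ_one_eq_two] at hratio ⊢
      linear_combination hratio)
  have hdiv : ∀ p q : MvPolynomial (Fin 2) ℂ, X 1 * p = X 0 * q →
      ∃ b, p = X 0 * b ∧ q = X 1 * b := by
    intro p q hpq
    have h1 : (X 0 : MvPolynomial (Fin 2) ℂ) ∣ X 1 * p := ⟨q, hpq⟩
    have h2 := (X_prime.dvd_or_dvd h1).resolve_left fun h => by simpa using X_dvd_X.mp h
    obtain ⟨b, rfl⟩ := h2
    exact ⟨b, rfl, mul_left_cancel₀ (X_ne_zero 0) (by rw [← hpq]; ring)⟩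
  obtain ⟨b₁, hb1, hb1'⟩ := hdiv _ _ hα
  obtain ⟨b₂, hb2, hb2'⟩ := hdiv _ _ hβ
  have hX0 : (X 0 : MvPolynomial (Fin 2) ℂ).IsHomogeneous 1 := isHomogeneous_X _ _
  have hhb1 : b₁.IsHomogeneous 1 := by
    refine IsHomogeneous.of_mul_left hX0 (X_ne_zero 0) ?_
    rw [← hb1]
    exact IsHomogeneous.sum _ _ _ fun i _ => (ha i).C_mul _
  have hhb2 : b₂.IsHomogeneous 2 := by
    refine IsHomogeneous.of_mul_left hX0 (X_ne_zero 0) ?_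
    rw [← hb2]
    exact IsHomogeneous.sum _ _ _ fun i _ => (hc i).C_mul _
  obtain ⟨k, hk⟩ : ∃ k, crossProd γ δ k ≠ 0 := by
    by_contra! hz
    have h1 : ∀ i, C (γ i) * ∑ j, C (δ j) * f j = C (δ i) * ∑ j, C (γ j) * f j := by
      intro i
      have e0 := congrArg (C (σ := Fin 3)) (hz 0)
      have e1 := congrArg (C (σ := Fin 3)) (hz 1)
      have e2 := congrArg (C (σ := Fin 3)) (hz 2)
      simp only [crossProd, Fin.isValue, zero_add, Fin.reduceAdd, C_sub, C_mul, C_0] at e0 e1 e2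
      rw [Fin.sum_univ_three, Fin.sum_univ_three]
      fin_cases i <;> simp only [Fin.zero_eta, Fin.mk_one, Fin.reduceFinMk]
      · linear_combination e2 * f 1 - e1 * f 2
      · linear_combination -e2 * f 0 + e0 * f 2
      · linear_combination e1 * f 0 - e0 * f 1
    have h2 : ∀ i, C (γ i) * X 2 - C (δ i) * X 1 = (0 : MvPolynomial (Fin 3) ℂ) := by
      intro i
      refine (mul_eq_zero.mp ?_).resolve_right hG1f
      linear_combination C (γ i) * hratio + X 1 * h1 i
    apply hG1f
    refine Finset.sum_eq_zero fun i _ => ?_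
    have h3 := congrArg (eval ![0, 0, 1]) (h2 i)
    simp at h3
    rw [h3, C_0, zero_mul]
  set A := Matrix.of ![γ, δ, Pi.single k 1] with hA
  have hAu : IsUnit A.det := exists_matrix_of_crossProd hk
  have haB : ∀ i, a i = ∑ j, C (A⁻¹ i j) * ![X 0 * b₁, X 1 * b₁, a k] j :=
    eq_sum_inv_of_rows hk a hb1 hb1'
  have hcB : ∀ i, c i = ∑ j, C (A⁻¹ i j) * ![X 0 * b₂, X 1 * b₂, c k] j :=
    eq_sum_inv_of_rows hk c hb2 hb2'
  have hfB : ∀ i, f i = ∑ j, C (A⁻¹ i j) *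
      ![X 1 * (X 0 * bin b₁ + bin b₂), X 2 * (X 0 * bin b₁ + bin b₂), f k] j := by
    refine eq_sum_inv_of_rows hk f ?_ ?_
    · rw [hdec, hb1, hb2, map_mul, map_mul, hbX, Fin.succ_zero_eq_one]; ring
    · rw [hdec, hb1', hb2', map_mul, map_mul, hbX, Fin.succ_one_eq_two]; ring
  have hB : IsUnit (A⁻¹).det := by
    rw [Matrix.det_nonsing_inv]
    exact hAu.ringInverse
  refine ⟨⟨b₁, b₂, a k, c k, hhb1, hhb2, ha k, hc k, fun hz => ?_, fun v hv v1 v2 v3 v4 => ?_⟩,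
    A⁻¹, hB, fun i => by rw [hfB i, hac k]; rfl⟩
  · obtain ⟨i, hi⟩ := exists_crossProd_ne_zero hf hg h0 hgf hac
    apply hi
    rw [crossProd, haB (i + 1), haB (i + 2), hcB (i + 1), hcB (i + 2)]
    simp only [Fin.sum_univ_three, Matrix.cons_val]
    linear_combination (C (A⁻¹ (i + 1) 0) * C (A⁻¹ (i + 2) 2) * X 0 +
      C (A⁻¹ (i + 1) 1) * C (A⁻¹ (i + 2) 2) * X 1 - C (A⁻¹ (i + 2) 0) * C (A⁻¹ (i + 1) 2) * X 0 -
      C (A⁻¹ (i + 2) 1) * C (A⁻¹ (i + 1) 2) * X 1) * hz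
  · -- a common zero of the binary forms gives a common linear factor of the cubics
    have d1 := linear_dvd_of_eval_eq_zero hhb1 hv v1
    have d2 := linear_dvd_of_eval_eq_zero hhb2 hv v2
    have d3 := linear_dvd_of_eval_eq_zero (ha k) hv v3
    have d4 := linear_dvd_of_eval_eq_zero (hc k) hv v4
    rw [hac k] at hfB
    have hu := hnc (bin (C (v 1) * X 0 - C (v 0) * X 1)) fun i => by
      rw [hfB i]
      have e1 := map_dvd bin d1
      have e2 := map_dvd bin d2
      have e3 := map_dvd bin d3
      have e4 := map_dvd bin d4
      refine Finset.dvd_sum fun j _ => dvd_mul_of_dvd_right ?_ _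
      fin_cases j
      · exact dvd_mul_of_dvd_right (dvd_add (dvd_mul_of_dvd_right e1 _) e2) _
      · exact dvd_mul_of_dvd_right (dvd_add (dvd_mul_of_dvd_right e1 _) e2) _
      · exact dvd_add (dvd_mul_of_dvd_right e3 _) e4
    have h1 := hu.map (eval 0)
    simp [bin] at h1

/-! ### Coordinates adapted to the double point -/

/-- Homogeneous coordinates of the plane as affine-linear polynomials in two local coordinates; the
first column of the matrix is the origin of the chart. -/
noncomputable def chartLin (M : Matrix (Fin 3) (Fin 3) ℂ) : Fin 3 → LocalPoly := fun i =>
  C (M i 0) + C (M i 1) * X 0 + C (M i 2) * X 1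

theorem exists_chartLin_eq (p : ℙ ℂ (Fin 3 → ℂ)) :
    ∃ M : Matrix (Fin 3) (Fin 3) ℂ, IsUnit M.det ∧ affineChart p = chartLin M ∧
      ∃ c : ℂ, c ≠ 0 ∧ ∀ i, p.rep i = c * M i 0 := by
  by_cases h2 : p.rep 2 ≠ 0
  · refine ⟨!![p.rep 0 / p.rep 2, 1, 0; p.rep 1 / p.rep 2, 0, 1; 1, 0, 0], ?_, ?_, p.rep 2, h2, ?_⟩
    · simp [Matrix.det_fin_three]
    · ext1 i
      rw [affineChart, if_pos h2]
      fin_cases i <;> simp [chartLin] <;> ring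
    · intro i
      fin_cases i
      all_goals simp
      all_goals field_simp
  by_cases h1 : p.rep 1 ≠ 0
  · refine ⟨!![p.rep 0 / p.rep 1, 1, 0; 1, 0, 0; 0, 0, 1], ?_, ?_, p.rep 1, h1, ?_⟩
    · simp [Matrix.det_fin_three]
    · ext1 i
      rw [affineChart, if_neg h2, if_pos h1]
      fin_cases i <;> simp [chartLin] <;> ring
    · intro i
      push Not at h2
      fin_cases i
      all_goals simp [h2]
      all_goals field_simp
  · push Not at h1 h2
    have h0 : p.rep 0 ≠ 0 := by
      intro h0
      apply p.rep_nonzero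
      ext i
      fin_cases i <;> assumption
    refine ⟨1, by simp, ?_, p.rep 0, h0, ?_⟩
    · ext1 i
      rw [affineChart, if_neg (by simp [h2]), if_neg (by simp [h1])]
      fin_cases i <;> simp [chartLin, Matrix.one_apply]
    · intro i
      fin_cases i <;> simp [h1, h2, Matrix.one_apply]

theorem linSub_one : linSub 1 = X := by
  ext1 i
  simp [linSub, Matrix.one_apply]

theorem bind₁_linSub (g : Triple) (S : Matrix (Fin 3) (Fin 3) ℂ) (i : Fin 3) :
    bind₁ g (linSub S i) = ∑ j, C (S i j) * g j := by
  simp [linSub, map_sum]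

theorem bind₁_linSub_linSub (S A : Matrix (Fin 3) (Fin 3) ℂ) (p : MvPolynomial (Fin 3) ℂ) :
    bind₁ (linSub A) (bind₁ (linSub S) p) = bind₁ (linSub (S * A)) p := by
  rw [bind₁_bind₁]
  congr 2
  ext1 i
  rw [bind₁_linSub]
  simp only [linSub, Matrix.mul_apply, map_sum, Finset.mul_sum, Finset.sum_mul, map_mul]
  rw [Finset.sum_comm]
  simp only [mul_assoc]

/-- `T` describes the net of `φ`, with double point `P`, after the substitution `Q`: its inverse `M`
is the matrix of the affine chart at `P`, so that the local coordinates at `P` are `x` and `y`. -/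
structure IsNormalFrame (φ : PlaneCremonaMap) (T : CubicData) (P : ℙ ℂ (Fin 3 → ℂ))
    (Q M : Matrix (Fin 3) (Fin 3) ℂ) : Prop where
  mul_eq_one : Q * M = 1
  chart : affineChart P = chartLin M
  rep : ∃ c : ℂ, c ≠ 0 ∧ ∀ i, P.rep i = c * M i 0
  form : ∃ B : Matrix (Fin 3) (Fin 3) ℂ, IsUnit B.det ∧
    ∀ i, φ.form i = ∑ j, C (B i j) * bind₁ (linSub Q) (T.form j)

theorem linSub_isHomogeneous (S : Matrix (Fin 3) (Fin 3) ℂ) (i : Fin 3) :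
    (linSub S i).IsHomogeneous 1 :=
  IsHomogeneous.sum _ _ _ fun _ _ => isHomogeneous_C_mul_X _ _

theorem exists_isNormalFrame (φ : PlaneCremonaMap) (hφ : φ.degree = 3) :
    ∃ T P Q M, IsNormalFrame φ T P Q M := by
  obtain ⟨e, g, hg, ⟨h, h0, hgf⟩, ⟨h', h0', hfg⟩⟩ := φ.birational
  have hf : ∀ i, (φ.form i).IsHomogeneous 3 := fun i => by
    have := φ.isHomogeneous i
    rwa [hφ] at this
  obtain ⟨v, hv, hsing⟩ := exists_double_point hf φ.no_common_factor e g h' hg h0' hfg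
  let P : ℙ ℂ (Fin 3 → ℂ) := Projectivization.mk ℂ v hv
  obtain ⟨S, hS, hchart, c, hc0, hc⟩ := exists_chartLin_eq P
  obtain ⟨a, ha⟩ := Projectivization.exists_smul_eq_mk_rep ℂ v hv
  have hSS : S⁻¹ * S = 1 := Matrix.nonsing_inv_mul S hS
  have hSS' : S * S⁻¹ = 1 := Matrix.mul_nonsing_inv S hS
  have hinv : ∀ p, bind₁ (linSub S⁻¹) (bind₁ (linSub S) p) = p := fun p => by
    rw [bind₁_linSub_linSub, hSS', linSub_one, bind₁_X_left]; rfl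
  have hinv' : ∀ p, bind₁ (linSub S) (bind₁ (linSub S⁻¹) p) = p := fun p => by
    rw [bind₁_linSub_linSub, hSS, linSub_one, bind₁_X_left]; rfl
  obtain ⟨T, B, hB, hT⟩ := exists_cubicData (f := fun i => bind₁ (linSub S) (φ.form i))
    (g := fun i => ∑ j, C (S⁻¹ i j) * g j) (e := e) (h := bind₁ (linSub S) h) (h' := h')
    (fun i => by simpa using (hf i).aeval _ (linSub_isHomogeneous S))
    (fun q hq => by
      have h1 := φ.no_common_factor (bind₁ (linSub S⁻¹) q) fun i => by
        have := map_dvd (bind₁ (linSub S⁻¹)) (hq i)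
        rwa [hinv] at this
      have h2 := h1.map (bind₁ (linSub S))
      rwa [hinv'] at h2)
    (fun i => IsHomogeneous.sum _ _ _ fun j _ => (hg j).C_mul _)
    (fun hz => h0 (by rw [← hinv h, hz, map_zero])) h0'
    (fun i => by
      have h1 : ∀ j, bind₁ (fun i => bind₁ (linSub S) (φ.form i)) (g j) =
          bind₁ (linSub S) h * linSub S j := by
        intro j
        have := congrArg (bind₁ (linSub S)) (hgf j)
        rwa [bind₁_bind₁, map_mul, bind₁_X_right] at this
      have h2 : ∑ j, C (S⁻¹ i j) * linSub S j = X i := by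
        rw [← bind₁_linSub, ← bind₁_X_right (R := ℂ) (linSub S⁻¹) i, hinv']
      simp only [map_sum, map_mul, bind₁_C_right, h1, ← h2, Finset.mul_sum]
      refine Finset.sum_congr rfl fun j _ => by ring)
    (fun i => by
      rw [bind₁_bind₁, ← hfg]
      congr 2
      ext1 j
      have h1 := congrArg (bind₁ g) (hinv (X j))
      rw [bind₁_X_right, bind₁_linSub, bind₁_X_right] at h1
      rw [bind₁_linSub, ← h1, map_sum]
      simp only [map_mul, bind₁_C_right, bind₁_linSub])
    (fun i j => by
      rw [pderiv_bind₁, map_sum]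
      refine Finset.sum_eq_zero fun k _ => ?_
      have h1 : eval ![1, 0, 0] (bind₁ (linSub S) (pderiv k (φ.form i))) =
          eval (fun l => S l 0) (pderiv k (φ.form i)) := by
        rw [← aeval_eq_eval, ← aeval_eq_eval, aeval_bind₁]
        congr 2
        ext l
        simp [linSub, Fin.sum_univ_three]
      have h2 : (fun l => S l 0) = fun l => (c⁻¹ * a : ℂ) * v l := by
        ext1 l
        have h3 := hc l
        have h4 := congrFun ha l
        rw [← h4, Pi.smul_apply, Units.smul_def, smul_eq_mul] at h3
        rw [mul_assoc, h3, ← mul_assoc, inv_mul_cancel₀ hc0, one_mul]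
      have h3 := IsHomogeneous.aeval_smul ((hf i).pderiv (i := k)) (c⁻¹ * a : ℂ) v
      simp only [aeval_eq_eval, hsing, mul_zero] at h3
      rw [map_mul, h1, h2, h3, zero_mul])
  refine ⟨T, P, S⁻¹, S, hSS, hchart, ⟨c, hc0, hc⟩, B, hB, fun i => ?_⟩
  have h1 := congrArg (bind₁ (linSub S⁻¹)) (hT i)
  rw [hinv] at h1
  rw [h1]
  simp

/-! ### Multiplicities and strict transforms -/

theorem mult_eq {ι : Type} {g : ι → LocalPoly} {n : ℕ}
    (h : ∀ i d, d.degree < n → coeff d (g i) = 0) {i₀ : ι} {d₀ : Fin 2 →₀ ℕ} (hd : d₀.degree = n)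
    (h₀ : coeff d₀ (g i₀) ≠ 0) : mult g = n := by
  have h1 : (⨅ i, MvPowerSeries.order (g i : MvPowerSeries (Fin 2) ℂ)) = n := by
    refine le_antisymm ((iInf_le _ i₀).trans ?_) (le_iInf fun i => ?_)
    · rw [← hd]
      exact MvPowerSeries.order_le (by simpa using h₀)
    · exact MvPowerSeries.nat_le_order fun d hd => by simpa using h i d hd
  rw [mult, h1, ENat.toNat_natCast]

theorem coeff_eq_zero_of_lt_mult {ι : Type} {g : ι → LocalPoly} (i : ι) {d : Fin 2 →₀ ℕ}
    (hd : d.degree < mult g) : coeff d (g i) = 0 := by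
  have h1 : (d.degree : ℕ∞) < MvPowerSeries.order (g i : MvPowerSeries (Fin 2) ℂ) := by
    have h2 : ((mult g : ℕ) : ℕ∞) ≤ ⨅ i, MvPowerSeries.order (g i : MvPowerSeries (Fin 2) ℂ) :=
      ENat.natCast_toNat_le_self _
    refine lt_of_lt_of_le ?_ (h2.trans (iInf_le _ i))
    exact_mod_cast hd
  have := MvPowerSeries.coeff_of_lt_order h1
  simpa using this

theorem mult_eq_zero {ι : Type} {g : ι → LocalPoly} {i : ι} (h : constantCoeff (g i) ≠ 0) :
    mult g = 0 :=
  mult_eq (d₀ := 0) (i₀ := i) (fun _ _ hd => absurd hd (Nat.not_lt_zero _)) (map_zero _) h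

theorem mult_eq_one {ι : Type} {g : ι → LocalPoly} (h : ∀ i, constantCoeff (g i) = 0) {i : ι}
    {j : Fin 2} (h₀ : coeff (Finsupp.single j 1) (g i) ≠ 0) : mult g = 1 := by
  refine mult_eq (fun i d hd => ?_) (Finsupp.degree_single _ _) h₀
  rw [Nat.lt_one_iff, Finsupp.degree_eq_zero_iff] at hd
  rw [hd]
  exact h i

/-- The action of a matrix on a triple of equations, which does not change the linear system when
the matrix is invertible. -/
noncomputable def matAct (B : Matrix (Fin 3) (Fin 3) ℂ) (g : Fin 3 → LocalPoly) :
    Fin 3 → LocalPoly :=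
  fun i => ∑ j, C (B i j) * g j

theorem matAct_matAct (A B : Matrix (Fin 3) (Fin 3) ℂ) (g : Fin 3 → LocalPoly) :
    matAct A (matAct B g) = matAct (A * B) g := by
  ext1 i
  simp only [matAct, Matrix.mul_apply, map_sum, map_mul, Finset.mul_sum, Finset.sum_mul]
  rw [Finset.sum_comm]
  simp only [mul_assoc]

theorem matAct_one (g : Fin 3 → LocalPoly) : matAct 1 g = g := by
  ext1 i
  simp [matAct, Matrix.one_apply]

theorem iInf_order_le_matAct (B : Matrix (Fin 3) (Fin 3) ℂ) (g : Fin 3 → LocalPoly) :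
    (⨅ i, MvPowerSeries.order (g i : MvPowerSeries (Fin 2) ℂ)) ≤
      ⨅ i, MvPowerSeries.order (matAct B g i : MvPowerSeries (Fin 2) ℂ) := by
  refine le_iInf fun i => MvPowerSeries.le_order fun d hd => ?_
  rw [coeff_coe, matAct, coeff_sum]
  refine Finset.sum_eq_zero fun j _ => ?_
  have := MvPowerSeries.coeff_of_lt_order (hd.trans_le (iInf_le _ j))
  rw [coeff_coe] at this
  rw [coeff_C_mul, this, mul_zero]

theorem mult_matAct {B : Matrix (Fin 3) (Fin 3) ℂ} (hB : IsUnit B.det) (g : Fin 3 → LocalPoly) :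
    mult (matAct B g) = mult g := by
  have h1 := iInf_order_le_matAct B g
  have h2 := iInf_order_le_matAct B⁻¹ (matAct B g)
  rw [matAct_matAct, Matrix.nonsing_inv_mul B hB, matAct_one] at h2
  rw [mult, mult, le_antisymm h1 h2]

theorem strictTransform_matAct {B : Matrix (Fin 3) (Fin 3) ℂ} (hB : IsUnit B.det) (t : OnePoint ℂ)
    (g : Fin 3 → LocalPoly) :
    strictTransform t (matAct B g) = matAct B (strictTransform t g) := by
  ext1 i
  rw [strictTransform, mult_matAct hB]
  ext d
  simp [matAct, strictTransform, coeff_divMonomial, coeff_sum, coeff_C_mul, map_sum]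

theorem iterStrictTransform_matAct {B : Matrix (Fin 3) (Fin 3) ℂ} (hB : IsUnit B.det)
    (l : List (OnePoint ℂ)) (g : Fin 3 → LocalPoly) :
    iterStrictTransform l (matAct B g) = matAct B (iterStrictTransform l g) := by
  induction l generalizing g with
  | nil => rfl
  | cons t l ih =>
    change iterStrictTransform l (strictTransform t _) = _
    rw [strictTransform_matAct hB, ih]; rfl

/-- The directions of the points around the label `t` of the exceptional curve, as functions of
the second coordinate of the chart: `blowUpChart t j` is `X 0 * dirPoly t j`. -/
noncomputable def dirPoly (t : OnePoint ℂ) : Fin 2 → LocalPoly :=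
  t.elim ![X 1, 1] (fun s => ![1, X 1 + C s])

theorem blowUpChart_eq (t : OnePoint ℂ) (j : Fin 2) : blowUpChart t j = X 0 * dirPoly t j := by
  induction t using OnePoint.rec <;> fin_cases j <;> simp [blowUpChart, dirPoly]

theorem X_pow_dvd_bind₁_blowUpChart {p : LocalPoly} {n : ℕ}
    (h : ∀ d, d.degree < n → coeff d p = 0) (t : OnePoint ℂ) :
    X 0 ^ n ∣ bind₁ (blowUpChart t) p := by
  rw [← support_sum_monomial_coeff p, map_sum]
  refine Finset.dvd_sum fun d hd => ?_
  have hn : n ≤ d.degree := by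
    by_contra! hlt
    exact (mem_support_iff.mp hd) (h d hlt)
  rw [bind₁_monomial]
  refine dvd_mul_of_dvd_right ((pow_dvd_pow _ hn).trans ?_) _
  rw [show d.degree = ∑ i ∈ d.support, d i from rfl, ← Finset.prod_pow_eq_pow_sum]
  refine Finset.prod_dvd_prod_of_dvd _ _ fun j _ => ?_
  rw [blowUpChart_eq, mul_pow]
  exact dvd_mul_right _ _

theorem divMonomial_X_pow_mul (n : ℕ) (r : LocalPoly) :
    (X 0 ^ n * r).divMonomial (Finsupp.single 0 n) = r := by
  rw [X_pow_eq_monomial, divMonomial_monomial_mul]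

theorem X_pow_mul_strictTransform {ι : Type} (t : OnePoint ℂ) (g : ι → LocalPoly) (i : ι) :
    X 0 ^ mult g * strictTransform t g i = bind₁ (blowUpChart t) (g i) := by
  obtain ⟨r, hr⟩ := X_pow_dvd_bind₁_blowUpChart (n := mult g) (p := g i)
    (fun d hd => coeff_eq_zero_of_lt_mult i hd) t
  rw [strictTransform, hr, divMonomial_X_pow_mul]

theorem strictTransform_eq {ι : Type} {t : OnePoint ℂ} {g : ι → LocalPoly} {i : ι} {r : LocalPoly}
    {n : ℕ} (hn : mult g = n) (h : bind₁ (blowUpChart t) (g i) = X 0 ^ n * r) :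
    strictTransform t g i = r := by
  rw [strictTransform, hn, h, divMonomial_X_pow_mul]

theorem constantCoeff_bind₁_blowUpChart (t : OnePoint ℂ) (p : LocalPoly) :
    constantCoeff (bind₁ (blowUpChart t) p) = constantCoeff p := by
  rw [← eval_zero, ← aeval_eq_eval, aeval_bind₁]
  congr 2
  ext j
  simp [blowUpChart_eq]

/-- There is no base point over a point which is not a base point. -/
theorem mult_iterStrictTransform_eq_zero {ι : Type} {g : ι → LocalPoly} {i : ι}
    (h : constantCoeff (g i) ≠ 0) (l : List (OnePoint ℂ)) :
    mult (iterStrictTransform l g) = 0 := by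
  induction l generalizing g with
  | nil => exact mult_eq_zero h
  | cons t l ih =>
    refine ih (g := strictTransform t g) ?_
    have h1 := X_pow_mul_strictTransform t g i
    rw [mult_eq_zero h, pow_zero, one_mul] at h1
    rwa [h1, constantCoeff_bind₁_blowUpChart]

open scoped PowerSeries

/-! ### Smooth arcs and chains of simple base points -/

/-- The value of a polynomial along an arc through the origin, to first order. -/
theorem aeval_arc {A : Type*} [CommRing A] [Algebra ℂ A] {η : Fin 2 → A⟦X⟧}
    (hη : ∀ j, PowerSeries.constantCoeff (η j) = 0) (p : LocalPoly) :
    PowerSeries.constantCoeff (aeval η p) = algebraMap ℂ A (constantCoeff p) ∧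
    PowerSeries.coeff 1 (aeval η p) =
      ∑ j, algebraMap ℂ A (coeff (Finsupp.single j 1) p) * PowerSeries.coeff 1 (η j) := by
  induction p using MvPolynomial.induction_on with
  | C a =>
    have h : ∀ j : Fin 2, coeff (Finsupp.single j 1) (C a : LocalPoly) = 0 := by
      intro j
      rw [coeff_C, if_neg]
      intro h
      have := DFunLike.congr_fun h j
      simp at this
    simp [h, PowerSeries.algebraMap_apply]
  | add p q hp hq =>
    refine ⟨by simp [hp.1, hq.1], ?_⟩
    simp only [map_add, hp.2, hq.2, coeff_add, add_mul, Finset.sum_add_distrib]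
  | mul_X p i hp =>
    refine ⟨by simp [hη], ?_⟩
    have h : ∀ j : Fin 2, coeff (Finsupp.single j 1) (p * X i) =
        if j = i then constantCoeff p else 0 := by
      intro j
      rw [coeff_mul_X']
      by_cases hij : j = i
      · subst hij; simp [constantCoeff_eq]
      · simp [hij, Ne.symm hij]
    rw [map_mul, aeval_X, PowerSeries.coeff_mul, Finset.Nat.antidiagonal_succ]
    simp [h, hη, hp.1]
    fin_cases i <;> simp

/-- A smooth arc through the origin. -/
structure IsArc (γ : Fin 2 → ℂ⟦X⟧) : Prop where
  const : ∀ j, PowerSeries.constantCoeff (γ j) = 0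
  smooth : ∃ j, PowerSeries.coeff 1 (γ j) ≠ 0

/-- The quotient of a power series by the variable, if it has no constant term. -/
noncomputable def dropX (φ : ℂ⟦X⟧) : ℂ⟦X⟧ := PowerSeries.mk fun n => PowerSeries.coeff (n + 1) φ

theorem X_mul_dropX {φ : ℂ⟦X⟧} (h : PowerSeries.constantCoeff φ = 0) :
    PowerSeries.X * dropX φ = φ := by
  ext n
  cases n with
  | zero => simp [h]
  | succ n => rw [PowerSeries.coeff_succ_X_mul, dropX, PowerSeries.coeff_mk]

theorem constantCoeff_dropX (φ : ℂ⟦X⟧) :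
    PowerSeries.constantCoeff (dropX φ) = PowerSeries.coeff 1 φ := by
  rw [← PowerSeries.coeff_zero_eq_constantCoeff_apply, dropX, PowerSeries.coeff_mk]

open Classical in
/-- The label of the point in which the strict transform of the arc meets the exceptional curve. -/
noncomputable def arcLabel (γ : Fin 2 → ℂ⟦X⟧) : OnePoint ℂ :=
  if PowerSeries.coeff 1 (γ 0) = 0 then OnePoint.infty
  else ((PowerSeries.coeff 1 (γ 1) / PowerSeries.coeff 1 (γ 0) : ℂ) : OnePoint ℂ)

open Classical in
/-- The strict transform of the arc in the chart around that point. -/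
noncomputable def arcNext (γ : Fin 2 → ℂ⟦X⟧) : Fin 2 → ℂ⟦X⟧ :=
  if PowerSeries.coeff 1 (γ 0) = 0 then ![γ 1, dropX (γ 0) * (dropX (γ 1))⁻¹]
  else ![γ 0, dropX (γ 1) * (dropX (γ 0))⁻¹ -
    PowerSeries.C (PowerSeries.coeff 1 (γ 1) / PowerSeries.coeff 1 (γ 0))]

/-- The labels of the first `n` infinitely near points of the arc. -/
noncomputable def arcLabels : ℕ → (Fin 2 → ℂ⟦X⟧) → List (OnePoint ℂ)
  | 0, _ => []
  | n + 1, γ => arcLabel γ :: arcLabels n (arcNext γ)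

theorem length_arcLabels (n : ℕ) (γ : Fin 2 → ℂ⟦X⟧) : (arcLabels n γ).length = n := by
  induction n generalizing γ with
  | zero => rfl
  | succ n ih => simp [arcLabels, ih]

theorem mul_dropX_inv {φ ψ : ℂ⟦X⟧} (hφ : PowerSeries.constantCoeff φ = 0)
    (hψ : PowerSeries.constantCoeff ψ = 0) (h : PowerSeries.coeff 1 ψ ≠ 0) :
    ψ * (dropX φ * (dropX ψ)⁻¹) = φ := by
  have h1 : dropX ψ * (dropX ψ)⁻¹ = 1 :=
    PowerSeries.mul_inv_cancel _ (by rwa [constantCoeff_dropX])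
  calc ψ * (dropX φ * (dropX ψ)⁻¹) = PowerSeries.X * dropX ψ * (dropX φ * (dropX ψ)⁻¹) := by
        rw [X_mul_dropX hψ]
    _ = PowerSeries.X * dropX φ * (dropX ψ * (dropX ψ)⁻¹) := by ring
    _ = φ := by rw [h1, mul_one, X_mul_dropX hφ]

theorem IsArc.next {γ : Fin 2 → ℂ⟦X⟧} (h : IsArc γ) :
    IsArc (arcNext γ) ∧ PowerSeries.coeff 1 (arcNext γ 0) ≠ 0 ∧
      ∀ j, γ j = aeval (arcNext γ) (blowUpChart (arcLabel γ) j) := by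
  by_cases h0 : PowerSeries.coeff 1 (γ 0) = 0
  · have h1 : PowerSeries.coeff 1 (γ 1) ≠ 0 := by
      obtain ⟨j, hj⟩ := h.smooth
      fin_cases j
      · exact absurd h0 hj
      · exact hj
    simp only [arcNext, arcLabel, if_pos h0]
    refine ⟨⟨fun j => ?_, 0, h1⟩, h1, fun j => ?_⟩
    · fin_cases j
      · exact h.const 1
      · simp [constantCoeff_dropX, h0]
    · fin_cases j
      · simp [blowUpChart, mul_dropX_inv (h.const 0) (h.const 1) h1]
      · simp [blowUpChart]
  · simp only [arcNext, arcLabel, if_neg h0]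
    refine ⟨⟨fun j => ?_, 0, h0⟩, h0, fun j => ?_⟩
    · fin_cases j
      · exact h.const 0
      · simp [constantCoeff_dropX, div_eq_mul_inv]
    · fin_cases j
      · simp [blowUpChart]
      · simp [blowUpChart, mul_dropX_inv (h.const 1) (h.const 0) h0]

/-- The strict transform of a system of multiplicity one, restricted to the exceptional curve. -/
theorem aeval_strictTransform_exceptional {ι : Type} {g : ι → LocalPoly} (hg : mult g = 1)
    (t : OnePoint ℂ) (i : ι) {A : Type*} [CommRing A] [Algebra ℂ A] (y : A) :
    aeval ![0, y] (strictTransform t g i) = ∑ j, algebraMap ℂ A (coeff (Finsupp.single j 1) (g i)) *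
      aeval ![0, y] (dirPoly t j) := by
  set η : Fin 2 → A⟦X⟧ := ![PowerSeries.X, PowerSeries.C y] with hη
  have hcc : ∀ p : LocalPoly, PowerSeries.constantCoeff (aeval η p) = aeval ![0, y] p := by
    intro p
    have := comp_aeval_apply (R := ℂ) (f := η)
      (AlgHom.mk (PowerSeries.constantCoeff (R := A)) (fun r => by
        simp [PowerSeries.algebraMap_apply])) p
    refine Eq.trans this ?_
    congr 2
    ext j
    fin_cases j <;> simp [hη]
  have h1 := congrArg (aeval η) (X_pow_mul_strictTransform t g i)
  rw [hg, pow_one, map_mul, aeval_X, aeval_bind₁] at h1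
  have h2 := congrArg (PowerSeries.coeff 1) h1
  have h3 : PowerSeries.coeff 1 (η 0 * aeval η (strictTransform t g i)) =
      aeval ![0, y] (strictTransform t g i) := by
    rw [← hcc, ← PowerSeries.coeff_zero_eq_constantCoeff_apply]
    exact PowerSeries.coeff_succ_X_mul 0 _
  rw [h3, (aeval_arc (fun j => by simp [blowUpChart_eq, hη]) (g i)).2] at h2
  rw [h2]
  refine Finset.sum_congr rfl fun j _ => ?_
  rw [← hcc, ← PowerSeries.coeff_zero_eq_constantCoeff_apply, blowUpChart_eq, map_mul, aeval_X]
  congr 1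
  exact PowerSeries.coeff_succ_X_mul 0 _

/-- The constant term of the strict transform of a curve through the origin. -/
theorem constantCoeff_strictTransform {ι : Type} {g : ι → LocalPoly} (hg : mult g = 1)
    (t : OnePoint ℂ) (i : ι) :
    constantCoeff (strictTransform t g i) =
      ∑ j, coeff (Finsupp.single j 1) (g i) * constantCoeff (dirPoly t j) := by
  have h1 := aeval_strictTransform_exceptional hg t i (0 : ℂ)
  have h2 : (![0, 0] : Fin 2 → ℂ) = 0 := by ext j; fin_cases j <;> rfl
  simpa only [aeval_eq_eval, h2, eval_zero, Algebra.algebraMap_self, RingHom.id_apply] using h1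

/-- The linear part of the strict transform in the direction of the exceptional curve. -/
theorem coeff_one_strictTransform {ι : Type} {g : ι → LocalPoly} (hg : mult g = 1)
    (t : OnePoint ℂ) (i : ι) :
    coeff (Finsupp.single 1 1) (strictTransform t g i) =
      t.elim (coeff (Finsupp.single 0 1) (g i)) (fun _ => coeff (Finsupp.single 1 1) (g i)) := by
  have h1 := aeval_strictTransform_exceptional hg t i (PowerSeries.X : ℂ⟦X⟧)
  have h2 := congrArg (PowerSeries.coeff 1) h1
  rw [(aeval_arc (fun j => by fin_cases j <;> simp) _).2] at h2
  simp only [Fin.sum_univ_two, Matrix.cons_val, map_zero, mul_zero, zero_add,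
    PowerSeries.coeff_one_X, mul_one, Algebra.algebraMap_self, RingHom.id_apply, map_add] at h2
  rw [h2]
  induction t using OnePoint.rec <;> simp [dirPoly]

theorem eq_arcLabel_of_tangent {γ : Fin 2 → ℂ⟦X⟧} (hγ : IsArc γ) {α : Fin 2 → ℂ} (hα : α ≠ 0)
    (h : ∑ j, α j * PowerSeries.coeff 1 (γ j) = 0) {t : OnePoint ℂ}
    (ht : ∑ j, α j * constantCoeff (dirPoly t j) = 0) : t = arcLabel γ := by
  rw [Fin.sum_univ_two] at h ht
  have hα' : α 0 ≠ 0 ∨ α 1 ≠ 0 := by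
    by_contra! hz
    apply hα
    ext j
    fin_cases j
    exacts [hz.1, hz.2]
  rw [arcLabel]
  induction t using OnePoint.rec with
  | infty =>
    simp only [dirPoly, OnePoint.elim_infty, Matrix.cons_val, constantCoeff_X, mul_zero, zero_add,
      map_one, mul_one] at ht
    rw [if_pos]
    rw [ht, zero_mul, add_zero] at h
    exact (mul_eq_zero.mp h).resolve_left (hα'.resolve_right (not_not.mpr ht))
  | coe s =>
    simp only [dirPoly, OnePoint.elim_some, Matrix.cons_val, map_one, mul_one, map_add,
      constantCoeff_X, zero_add, constantCoeff_C] at ht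
    have hα1 : α 1 ≠ 0 := by
      intro hz
      rw [hz, zero_mul, add_zero] at ht
      rcases hα' with h' | h'
      exacts [h' ht, h' hz]
    have h0 : PowerSeries.coeff 1 (γ 0) ≠ 0 := by
      intro hz
      rw [hz, mul_zero, zero_add] at h
      have h1 := (mul_eq_zero.mp h).resolve_left hα1
      obtain ⟨j, hj⟩ := hγ.smooth
      fin_cases j
      exacts [hj hz, hj h1]
    rw [if_neg h0]
    congr 1
    rw [eq_div_iff h0]
    refine mul_left_cancel₀ hα1 ?_
    linear_combination PowerSeries.coeff 1 (γ 0) * ht - h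

/-- **Chains.** Let a linear system contain a smooth curve along a smooth arc `γ` (a member of the
system vanishes on `γ` and has a nonzero linear part), and let `m` be the least order of its
members along `γ`.  Then the base points of the system over the origin are the first `m` points of
the arc, and they are simple: each blow-up lowers `m` by one and keeps the hypotheses. -/
theorem mult_chain (m : ℕ) {ι : Type} (g : ι → LocalPoly) (γ : Fin 2 → ℂ⟦X⟧) (hγ : IsArc γ)
    (hle : ∀ i, (m : ℕ∞) ≤ (aeval γ (g i)).order) (heq : ∃ i, (aeval γ (g i)).order = m)
    (hw : ∃ i, aeval γ (g i) = 0 ∧ ∃ j, coeff (Finsupp.single j 1) (g i) ≠ 0) :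
    (∀ j < m, mult (iterStrictTransform (arcLabels j γ) g) = 1) ∧
      ∀ l, 0 < mult (iterStrictTransform l g) → ∃ j < m, l = arcLabels j γ := by
  induction m generalizing g γ with
  | zero =>
    refine ⟨fun j hj => absurd hj (Nat.not_lt_zero j), fun l hl => ?_⟩
    obtain ⟨i, hi⟩ := heq
    have h1 : constantCoeff (g i) ≠ 0 := by
      intro hz
      have := (aeval_arc hγ.const (g i)).1
      rw [hz, map_zero] at this
      exact PowerSeries.order_ne_zero_iff_constCoeff_eq_zero.mpr this (by simpa using hi)
    rw [mult_iterStrictTransform_eq_zero h1] at hl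
    exact absurd hl (lt_irrefl 0)
  | succ m ih =>
    have hc : ∀ i, constantCoeff (g i) = 0 := by
      intro i
      have h1 := (aeval_arc hγ.const (g i)).1
      have h2 : (aeval γ (g i)).order ≠ 0 := by
        intro hz
        have := hle i
        rw [hz] at this
        simp at this
      rw [PowerSeries.order_ne_zero_iff_constCoeff_eq_zero.mp h2] at h1
      exact h1.symm
    obtain ⟨i₀, hi₀, j₀, hj₀⟩ := hw
    have hm : mult g = 1 := mult_eq_one hc hj₀
    obtain ⟨hγ', hγ0, hbl⟩ := hγ.next
    have hα : (fun j => coeff (Finsupp.single j 1) (g i₀)) ≠ 0 := fun hz => hj₀ (congrFun hz j₀)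
    have htan : ∑ j, coeff (Finsupp.single j 1) (g i₀) * PowerSeries.coeff 1 (γ j) = 0 := by
      have := (aeval_arc hγ.const (g i₀)).2
      rw [hi₀] at this
      simpa using this.symm
    -- orders along the lifted arc drop by one
    have hstep : ∀ i, arcNext γ 0 * aeval (arcNext γ) (strictTransform (arcLabel γ) g i) =
        aeval γ (g i) := by
      intro i
      have h1 := congrArg (aeval (arcNext γ)) (X_pow_mul_strictTransform (arcLabel γ) g i)
      rw [hm, pow_one, map_mul, aeval_X, aeval_bind₁] at h1
      rw [h1]
      congr 2
      ext1 j
      exact (hbl j).symm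
    have hord0 : (arcNext γ 0).order = 1 := by
      refine (PowerSeries.order_eq_nat (n := 1)).mpr ⟨hγ0, fun k hk => ?_⟩
      rw [Nat.lt_one_iff.mp hk]
      simpa using hγ'.const 0
    have hord : ∀ i, (aeval γ (g i)).order =
        1 + (aeval (arcNext γ) (strictTransform (arcLabel γ) g i)).order := by
      intro i
      rw [← hstep, PowerSeries.order_mul, hord0]
    have hcast : ((m + 1 : ℕ) : ℕ∞) = 1 + m := by push_cast; ring
    have hone : (1 : ℕ∞) ≠ ⊤ := by simp
    have hIH := ih (strictTransform (arcLabel γ) g) (arcNext γ) hγ'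
      (fun i => by
        have := hle i
        rw [hord, hcast] at this
        exact (ENat.add_le_add_iff_left hone).mp this)
      (by
        obtain ⟨i, hi⟩ := heq
        refine ⟨i, ?_⟩
        rw [hord, hcast] at hi
        exact le_antisymm ((ENat.add_le_add_iff_left hone).mp hi.le)
          ((ENat.add_le_add_iff_left hone).mp hi.ge))
      (by
        have hz : aeval (arcNext γ) (strictTransform (arcLabel γ) g i₀) = 0 := by
          have h1 := hstep i₀
          rw [hi₀] at h1
          refine (mul_eq_zero.mp h1).resolve_left fun hz => hγ0 ?_
          rw [hz, map_zero]
        refine ⟨i₀, hz, 1, ?_⟩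
        have h0 : ∑ j, coeff (Finsupp.single j 1) (g i₀) *
            constantCoeff (dirPoly (arcLabel γ) j) = 0 := by
          rw [← constantCoeff_strictTransform hm]
          have := (aeval_arc hγ'.const (strictTransform (arcLabel γ) g i₀)).1
          rw [hz, map_zero] at this
          exact this.symm
        rw [coeff_one_strictTransform hm]
        generalize arcLabel γ = t at h0
        rw [Fin.sum_univ_two] at h0
        intro h1
        induction t using OnePoint.rec with
        | infty =>
          simp only [dirPoly, OnePoint.elim_infty, Matrix.cons_val, constantCoeff_X, mul_zero,
            zero_add, map_one, mul_one] at h0 h1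
          fin_cases j₀
          exacts [hj₀ h1, hj₀ h0]
        | coe s =>
          simp only [dirPoly, OnePoint.elim_some, Matrix.cons_val, map_one, mul_one] at h0 h1
          rw [h1, zero_mul, add_zero] at h0
          fin_cases j₀
          exacts [hj₀ h0, hj₀ h1])
    refine ⟨fun j hj => ?_, fun l hl => ?_⟩
    · cases j with
      | zero => exact hm
      | succ j => exact hIH.1 j (by omega)
    · cases l with
      | nil => exact ⟨0, by omega, rfl⟩
      | cons t l =>
        have ht : t = arcLabel γ := by
          refine eq_arcLabel_of_tangent hγ hα htan ?_
          rw [← constantCoeff_strictTransform hm]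
          by_contra hne
          have := mult_iterStrictTransform_eq_zero hne l
          change 0 < mult (iterStrictTransform l (strictTransform t g)) at hl
          omega
        subst ht
        obtain ⟨j, hj, rfl⟩ := hIH.2 l hl
        exact ⟨j + 1, by omega, rfl⟩

/-! ### Proximity -/

/-- The strict transforms of an exceptional curve pass through the points with labels
`∞, 0, 0, …` and through no others. -/
theorem mult_exceptional_pos_iff (l : List (OnePoint ℂ)) :
    0 < mult (iterStrictTransform l (fun _ : Unit => (X 0 : LocalPoly))) ↔
      l = [] ∨ ∃ n, l = OnePoint.infty :: List.replicate n ((0 : ℂ) : OnePoint ℂ) := by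
  have hmX : ∀ j : Fin 2, mult (fun _ : Unit => (X j : LocalPoly)) = 1 := fun j =>
    mult_eq_one (i := ()) (j := j) (fun _ => constantCoeff_X ℂ j) (by simp)
  have h1 : ∀ l, 0 < mult (iterStrictTransform l (fun _ : Unit => (X 1 : LocalPoly))) ↔
      ∃ n, l = List.replicate n ((0 : ℂ) : OnePoint ℂ) := by
    intro l
    induction l with
    | nil =>
      refine ⟨fun _ => ⟨0, rfl⟩, fun _ => ?_⟩
      exact (hmX 1).ge
    | cons t l ih =>
      change 0 < mult (iterStrictTransform l (strictTransform t _)) ↔ _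
      induction t using OnePoint.rec with
      | infty =>
        have : strictTransform OnePoint.infty (fun _ : Unit => (X 1 : LocalPoly)) = fun _ => 1 := by
          ext1 i
          exact strictTransform_eq (hmX 1) (by simp [blowUpChart])
        rw [this, mult_iterStrictTransform_eq_zero (i := ()) (by simp)]
        refine ⟨fun h => absurd h (lt_irrefl 0), fun ⟨n, hn⟩ => ?_⟩
        have := List.eq_of_mem_replicate (hn ▸ List.mem_cons_self (a := OnePoint.infty) (l := l))
        simp at this
      | coe s =>
        have hst : strictTransform (s : OnePoint ℂ) (fun _ : Unit => (X 1 : LocalPoly)) =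
            fun _ => X 1 + C s := by
          ext1 i
          exact strictTransform_eq (hmX 1) (by simp [blowUpChart])
        rw [hst]
        by_cases hs : s = 0
        · subst hs
          rw [C_0, add_zero, ih]
          constructor
          · rintro ⟨n, rfl⟩
            exact ⟨n + 1, rfl⟩
          · rintro ⟨n, hn⟩
            cases n with
            | zero => simp at hn
            | succ n => exact ⟨n, (List.cons.inj hn).2⟩
        · rw [mult_iterStrictTransform_eq_zero (i := ()) (by simpa using hs)]
          refine ⟨fun h => absurd h (lt_irrefl 0), fun ⟨n, hn⟩ => ?_⟩
          have := List.eq_of_mem_replicate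
            (hn ▸ List.mem_cons_self (a := (s : OnePoint ℂ)) (l := l))
          exact absurd (OnePoint.coe_injective this) hs
  cases l with
  | nil =>
    refine ⟨fun _ => Or.inl rfl, fun _ => ?_⟩
    exact (hmX 0).ge
  | cons t l =>
    change 0 < mult (iterStrictTransform l (strictTransform t _)) ↔ _
    induction t using OnePoint.rec with
    | infty =>
      have : strictTransform OnePoint.infty (fun _ : Unit => (X 0 : LocalPoly)) = fun _ => X 1 := by
        ext1 i
        exact strictTransform_eq (hmX 0) (by simp [blowUpChart])
      rw [this, h1]
      simp
    | coe s =>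
      have : strictTransform (s : OnePoint ℂ) (fun _ : Unit => (X 0 : LocalPoly)) = fun _ => 1 := by
        ext1 i
        exact strictTransform_eq (hmX 0) (by simp [blowUpChart])
      rw [this, mult_iterStrictTransform_eq_zero (i := ()) (by simp)]
      simp

theorem order_dropX {φ : ℂ⟦X⟧} (h : PowerSeries.constantCoeff φ = 0) :
    φ.order = 1 + (dropX φ).order := by
  conv_lhs => rw [← X_mul_dropX h]
  rw [PowerSeries.order_mul, PowerSeries.order_X]

theorem order_mul_of_constantCoeff_ne_zero {φ ψ : ℂ⟦X⟧} (h : PowerSeries.constantCoeff ψ ≠ 0) :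
    (φ * ψ).order = φ.order := by
  rw [PowerSeries.order_mul, PowerSeries.order_zero_of_unit
    (PowerSeries.isUnit_iff_constantCoeff.mpr (isUnit_iff_ne_zero.mpr h)), add_zero]

theorem constantCoeff_inv_ne_zero {φ : ℂ⟦X⟧} (h : PowerSeries.constantCoeff φ ≠ 0) :
    PowerSeries.constantCoeff φ⁻¹ ≠ 0 := by
  simpa using h

theorem cast_zero_lt_order {φ : ℂ⟦X⟧} (h : PowerSeries.constantCoeff φ = 0) :
    ((0 : ℕ) : ℕ∞) < φ.order := by
  rw [Nat.cast_zero, pos_iff_ne_zero]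
  exact PowerSeries.order_ne_zero_iff_constCoeff_eq_zero.mpr h

theorem cast_succ_lt_iff (n : ℕ) (x : ℕ∞) : ((n + 1 : ℕ) : ℕ∞) < 1 + x ↔ (n : ℕ∞) < x := by
  rw [Nat.cast_add, Nat.cast_one, add_comm, ENat.add_lt_add_iff_left (by simp)]

theorem cast_succ_lt_order_iff {φ : ℂ⟦X⟧} (h : PowerSeries.constantCoeff φ = 0) (n : ℕ) :
    ((n + 1 : ℕ) : ℕ∞) < φ.order ↔ (n : ℕ∞) < (dropX φ).order := by
  rw [order_dropX h, cast_succ_lt_iff]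

/-- The points of an arc transversal to `x = 0` which lie on the curve `y = 0`. -/
theorem arcLabels_eq_replicate_iff (i : ℕ) {γ : Fin 2 → ℂ⟦X⟧} (hγ : IsArc γ)
    (h0 : PowerSeries.coeff 1 (γ 0) ≠ 0) :
    (∃ n, arcLabels i γ = List.replicate n ((0 : ℂ) : OnePoint ℂ)) ↔ (i : ℕ∞) < (γ 1).order := by
  induction i generalizing γ with
  | zero => exact ⟨fun _ => cast_zero_lt_order (hγ.const 1), fun _ => ⟨0, rfl⟩⟩
  | succ i ih =>
    rw [cast_succ_lt_order_iff (hγ.const 1)]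
    have hlab : arcLabel γ = ((PowerSeries.coeff 1 (γ 1) / PowerSeries.coeff 1 (γ 0) : ℂ) :
      OnePoint ℂ) := if_neg h0
    by_cases h1 : PowerSeries.coeff 1 (γ 1) = 0
    · have hnext : arcNext γ 1 = dropX (γ 1) * (dropX (γ 0))⁻¹ := by
        simp [arcNext, h0, h1]
      have hu : PowerSeries.constantCoeff (dropX (γ 0))⁻¹ ≠ 0 :=
        constantCoeff_inv_ne_zero (by rwa [constantCoeff_dropX])
      rw [← order_mul_of_constantCoeff_ne_zero hu, ← hnext, ← ih hγ.next.1 hγ.next.2.1, arcLabels,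
        hlab, h1, zero_div]
      constructor
      · rintro ⟨n, hn⟩
        cases n with
        | zero => simp at hn
        | succ n => exact ⟨n, (List.cons.inj hn).2⟩
      · rintro ⟨n, hn⟩
        exact ⟨n + 1, by rw [hn, List.replicate_succ]⟩
    · have h2 : (dropX (γ 1)).order = 0 := by
        by_contra h
        exact h1 (by
          rw [← constantCoeff_dropX]
          exact PowerSeries.order_ne_zero_iff_constCoeff_eq_zero.mp h)
      rw [h2]
      refine ⟨fun ⟨n, hn⟩ => ?_, fun h => absurd h (by simp)⟩
      rw [arcLabels, hlab] at hn
      have := List.eq_of_mem_replicate (hn ▸ List.mem_cons_self)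
      rw [OnePoint.coe_eq_coe, div_eq_zero_iff] at this
      exact absurd this (not_or.mpr ⟨h1, h0⟩)

/-- The points of an arc that lie on the curve `x = 0`. -/
theorem arcLabels_exceptional_iff (i : ℕ) {γ : Fin 2 → ℂ⟦X⟧} (hγ : IsArc γ) :
    (arcLabels i γ = [] ∨ ∃ n, arcLabels i γ =
      OnePoint.infty :: List.replicate n ((0 : ℂ) : OnePoint ℂ)) ↔ (i : ℕ∞) < (γ 0).order := by
  cases i with
  | zero => exact ⟨fun _ => cast_zero_lt_order (hγ.const 0), fun _ => Or.inl rfl⟩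
  | succ i =>
    rw [cast_succ_lt_order_iff (hγ.const 0)]
    by_cases h0 : PowerSeries.coeff 1 (γ 0) = 0
    · have h1 : PowerSeries.coeff 1 (γ 1) ≠ 0 := by
        obtain ⟨j, hj⟩ := hγ.smooth
        fin_cases j
        exacts [absurd h0 hj, hj]
      have hnext : arcNext γ 1 = dropX (γ 0) * (dropX (γ 1))⁻¹ := by
        simp [arcNext, h0]
      have hu : PowerSeries.constantCoeff (dropX (γ 1))⁻¹ ≠ 0 :=
        constantCoeff_inv_ne_zero (by rwa [constantCoeff_dropX])
      rw [← order_mul_of_constantCoeff_ne_zero hu, ← hnext,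
        ← arcLabels_eq_replicate_iff i hγ.next.1 hγ.next.2.1, arcLabels,
        show arcLabel γ = OnePoint.infty from if_pos h0]
      simp
    · have h2 : (dropX (γ 0)).order = 0 := by
        by_contra h
        exact h0 (by
          rw [← constantCoeff_dropX]
          exact PowerSeries.order_ne_zero_iff_constCoeff_eq_zero.mp h)
      rw [h2, arcLabels, show arcLabel γ = _ from if_neg h0]
      simp

/-- After the first blow-up, an arc is transversal to the exceptional curve. -/
theorem arcLabels_ne_append_infty (a l : List (OnePoint ℂ)) (t : OnePoint ℂ) (i : ℕ)
    {γ : Fin 2 → ℂ⟦X⟧} (hγ : IsArc γ) : arcLabels i γ ≠ a ++ t :: OnePoint.infty :: l := by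
  induction a generalizing γ i with
  | nil =>
    intro h
    match i, h with
    | 1, h => simp [arcLabels] at h
    | i + 2, h =>
      have h1 : arcLabel (arcNext γ) = OnePoint.infty := by
        simp only [arcLabels, List.nil_append, List.cons.injEq] at h
        exact h.2.1
      rw [arcLabel, if_neg hγ.next.2.1] at h1
      exact OnePoint.coe_ne_infty _ h1
  | cons s a ih =>
    intro h
    cases i with
    | zero => simp [arcLabels] at h
    | succ i =>
      simp only [arcLabels, List.cons_append, List.cons.injEq] at h
      exact ih i hγ.next.1 h.2

theorem exists_arcLabels_succ (j : ℕ) (γ : Fin 2 → ℂ⟦X⟧) :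
    ∃ t, arcLabels (j + 1) γ = arcLabels j γ ++ [t] := by
  induction j generalizing γ with
  | zero => exact ⟨arcLabel γ, rfl⟩
  | succ j ih =>
    obtain ⟨t, ht⟩ := ih (arcNext γ)
    exact ⟨t, by rw [arcLabels, ht]; rfl⟩

/-- The points of an arc: each is proximate to its predecessor only. -/
theorem proximate_arcLabels_iff (b : ℙ ℂ (Fin 3 → ℂ)) (a : List (OnePoint ℂ))
    {γ : Fin 2 → ℂ⟦X⟧} (hγ : IsArc γ) (i j : ℕ) :
    Proximate ⟨b, a ++ arcLabels i γ⟩ ⟨b, a ++ arcLabels j γ⟩ ↔ i = j + 1 := by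
  constructor
  · rintro ⟨-, t, l, h, hl⟩
    simp only [List.append_assoc, List.append_cancel_left_eq] at h
    rcases (mult_exceptional_pos_iff l).mp hl with rfl | ⟨n, rfl⟩
    · have := congrArg List.length h
      simpa [length_arcLabels] using this
    · exact absurd h (arcLabels_ne_append_infty _ _ _ _ hγ)
  · rintro rfl
    obtain ⟨t, ht⟩ := exists_arcLabels_succ j γ
    refine ⟨rfl, t, [], by simp [ht], (mult_exceptional_pos_iff []).mpr (Or.inl rfl)⟩

/-- Proximity to a point `p` of the points of an arc through the point with label `t` of the first
neighbourhood of `p`. -/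
theorem proximate_cons_arcLabels_iff (b : ℙ ℂ (Fin 3 → ℂ)) (t : OnePoint ℂ)
    {γ : Fin 2 → ℂ⟦X⟧} (hγ : IsArc γ) (i : ℕ) :
    Proximate ⟨b, [t] ++ arcLabels i γ⟩ ⟨b, []⟩ ↔ (i : ℕ∞) < (γ 0).order := by
  rw [← arcLabels_exceptional_iff i hγ]
  constructor
  · rintro ⟨-, t, l, h, hl⟩
    obtain ⟨-, rfl⟩ := List.cons.inj h
    exact (mult_exceptional_pos_iff _).mp hl
  · intro h
    exact ⟨rfl, t, _, rfl, (mult_exceptional_pos_iff _).mpr h⟩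

/-! ### Families of triples of power series -/

/-- The triple `(d₀ f, d₁ f, g)`; the normal form of a cubic map is of this shape. -/
def pencilTriple {A : Type*} [Mul A] (d : Fin 2 → A) (f g : A) : Fin 3 → A :=
  ![d 0 * f, d 1 * f, g]

theorem map_pencilTriple {A B F : Type*} [Mul A] [Mul B] [FunLike F A B] [MulHomClass F A B] (e : F)
    (d : Fin 2 → A) (f g : A) (i : Fin 3) :
    e (pencilTriple d f g i) = pencilTriple (fun j => e (d j)) (e f) (e g) i := by
  fin_cases i <;> simp [pencilTriple]

theorem X_pow_dvd_iff_le_order (n : ℕ) (φ : ℂ⟦X⟧) :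
    PowerSeries.X ^ n ∣ φ ↔ (n : ℕ∞) ≤ φ.order := by
  rw [PowerSeries.X_pow_dvd_iff]
  exact ⟨PowerSeries.nat_le_order φ n, fun h m hm =>
    PowerSeries.coeff_of_lt_order m (lt_of_lt_of_le (by exact_mod_cast hm) h)⟩

theorem lt_order_iff_dvd (n : ℕ) (φ : ℂ⟦X⟧) :
    (n : ℕ∞) < φ.order ↔ PowerSeries.X ^ (n + 1) ∣ φ := by
  rw [X_pow_dvd_iff_le_order, Nat.cast_add, Nat.cast_one]
  exact (ENat.add_one_le_iff (by simp)).symm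

theorem X_pow_dvd_of_mul {φ ψ : ℂ⟦X⟧} {n : ℕ} (h : PowerSeries.constantCoeff ψ ≠ 0)
    (hd : PowerSeries.X ^ n ∣ φ * ψ) : PowerSeries.X ^ n ∣ φ := by
  rw [X_pow_dvd_iff_le_order, order_mul_of_constantCoeff_ne_zero h] at hd
  rwa [X_pow_dvd_iff_le_order]

/-- The zero `ζ = -f / f'` of `f + ζ f'`; the order of `ζ` is that of `f`, and up to the order of the
determinant `f g' - g f'` it is also bounded by that of `g`. -/
theorem exists_zero_of_constantCoeff_ne_zero {f f' g g' : ℂ⟦X⟧}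
    (h : PowerSeries.constantCoeff f' ≠ 0) :
    ∃ ζ : ℂ⟦X⟧, f + ζ * f' = 0 ∧ (g + ζ * g').order = (f * g' - g * f').order ∧
      ∀ n : ℕ, (n : ℕ∞) < (f * g' - g * f').order →
        ((n : ℕ∞) < ζ.order ↔ (n : ℕ∞) < f.order ∧ (n : ℕ∞) < g.order) := by
  have hi : f' * f'⁻¹ = 1 := PowerSeries.mul_inv_cancel _ h
  have hζ : f * f'⁻¹ * f' = f := by rw [mul_assoc, mul_comm f'⁻¹, hi, mul_one]
  have hord : (-(f * f'⁻¹)).order = f.order := by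
    rw [PowerSeries.order_neg, order_mul_of_constantCoeff_ne_zero (constantCoeff_inv_ne_zero h)]
  refine ⟨-(f * f'⁻¹), by rw [neg_mul, hζ, add_neg_cancel], ?_, fun n hn => ?_⟩
  · rw [← order_mul_of_constantCoeff_ne_zero h, ← PowerSeries.order_neg]
    congr 1
    linear_combination g' * hζ
  · rw [hord]
    refine ⟨fun hf => ⟨hf, ?_⟩, fun hf => hf.1⟩
    rw [lt_order_iff_dvd] at *
    refine X_pow_dvd_of_mul h ?_
    have := dvd_sub (hf.mul_right g') hn
    rwa [sub_sub_cancel] at this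

/-- In a family of triples `(d₀ (f + ζ f'), d₁ (f + ζ f'), g + ζ g')` depending on the parameter
`ζ`, there is a value of `ζ` for which one member vanishes with nonzero slope; the order of the
others is then the order of the determinant `f g' - g f'`. -/
theorem exists_pencilTriple_eq_zero {d : Fin 2 → ℂ⟦X⟧}
    (hd : ∃ j, PowerSeries.constantCoeff (d j) ≠ 0)
    {f f' g g' : ℂ⟦X⟧}
    (h : PowerSeries.constantCoeff f' ≠ 0 ∨ PowerSeries.constantCoeff g' ≠ 0) :
    ∃ ζ : ℂ⟦X⟧, (∃ i, pencilTriple d (f + ζ * f') (g + ζ * g') i = 0 ∧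
        PowerSeries.constantCoeff (pencilTriple d f' g' i) ≠ 0) ∧
      (∀ i, (f * g' - g * f').order ≤ (pencilTriple d (f + ζ * f') (g + ζ * g') i).order) ∧
      (∃ i, (pencilTriple d (f + ζ * f') (g + ζ * g') i).order = (f * g' - g * f').order) ∧
      ∀ n : ℕ, (n : ℕ∞) < (f * g' - g * f').order →
        ((n : ℕ∞) < ζ.order ↔ (n : ℕ∞) < f.order ∧ (n : ℕ∞) < g.order) := by
  obtain ⟨j, hj⟩ := hd
  rcases h with h | h
  · obtain ⟨ζ, h1, h2, h3⟩ := exists_zero_of_constantCoeff_ne_zero (f := f) (g := g) (g' := g') h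
    refine ⟨ζ, ?_, fun i => ?_, ⟨2, h2⟩, h3⟩
    · rw [h1]
      fin_cases j
      · exact ⟨0, by simp [pencilTriple], by simpa [pencilTriple] using ⟨hj, h⟩⟩
      · exact ⟨1, by simp [pencilTriple], by simpa [pencilTriple] using ⟨hj, h⟩⟩
    · rw [h1, ← h2]
      fin_cases i <;> simp [pencilTriple]
  · obtain ⟨ζ, h1, h2, h3⟩ := exists_zero_of_constantCoeff_ne_zero (f := g) (g := f) (g' := f') h
    have hs : (g * f' - f * g').order = (f * g' - g * f').order := by
      rw [← PowerSeries.order_neg, neg_sub]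
    rw [hs] at h2 h3
    refine ⟨ζ, ⟨2, h1, h⟩, fun i => ?_, ?_, fun n hn => (h3 n hn).trans and_comm⟩
    · rw [h1, ← h2]
      fin_cases i
      · simp [pencilTriple, PowerSeries.order_mul]
      · simp [pencilTriple, PowerSeries.order_mul]
      · simp [pencilTriple]
    · rw [← h2]
      fin_cases j
      · exact ⟨0, by
          simp only [pencilTriple, Matrix.cons_val, mul_comm (d 0)]
          exact order_mul_of_constantCoeff_ne_zero hj⟩
      · exact ⟨1, by
          simp only [pencilTriple, Matrix.cons_val, mul_comm (d 1)]
          exact order_mul_of_constantCoeff_ne_zero hj⟩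

/-! ### Directions at the double point -/

/-- The homogeneous coordinates `(x, y)` of the directions near the direction `t`, as functions of
a parameter.  The direction `s : ℂ` is `(1, s)`, and `∞` is `(0, 1)`. -/
noncomputable def dirPS (t : OnePoint ℂ) : Fin 2 → ℂ⟦X⟧ :=
  t.elim ![PowerSeries.X, 1] (fun s => ![1, PowerSeries.X + PowerSeries.C s])

/-- The coordinates `(x, y)` of the direction `t`. -/
noncomputable def dirPt (t : OnePoint ℂ) : Fin 2 → ℂ :=
  t.elim ![0, 1] (fun s => ![1, s])

/-- The expansion of a binary form near the direction `t`. -/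
noncomputable def expand (t : OnePoint ℂ) : MvPolynomial (Fin 2) ℂ →ₐ[ℂ] ℂ⟦X⟧ := aeval (dirPS t)

theorem constantCoeff_dirPS (t : OnePoint ℂ) (j : Fin 2) :
    PowerSeries.constantCoeff (dirPS t j) = dirPt t j := by
  induction t using OnePoint.rec <;> fin_cases j <;> simp [dirPS, dirPt]

theorem exists_dirPt_ne_zero (t : OnePoint ℂ) : ∃ j, dirPt t j ≠ 0 := by
  induction t using OnePoint.rec
  · exact ⟨1, by simp [dirPt]⟩
  · exact ⟨0, by simp [dirPt]⟩

theorem dirPt_ne_zero (t : OnePoint ℂ) : dirPt t ≠ 0 := fun h => by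
  obtain ⟨j, hj⟩ := exists_dirPt_ne_zero t
  exact hj (congrFun h j)

theorem constantCoeff_dirPoly (t : OnePoint ℂ) (j : Fin 2) :
    constantCoeff (dirPoly t j) = dirPt t j := by
  induction t using OnePoint.rec <;> fin_cases j <;> simp [dirPoly, dirPt]

theorem constantCoeff_aeval {σ : Type*} (f : σ → ℂ⟦X⟧) (p : MvPolynomial σ ℂ) :
    PowerSeries.constantCoeff (aeval f p) = eval (fun j => PowerSeries.constantCoeff (f j)) p := by
  have := comp_aeval_apply (R := ℂ) (f := f)
    (AlgHom.mk (PowerSeries.constantCoeff (R := ℂ)) (fun r => by simp)) p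
  rw [← aeval_eq_eval]
  exact this

theorem constantCoeff_expand (t : OnePoint ℂ) (p : MvPolynomial (Fin 2) ℂ) :
    PowerSeries.constantCoeff (expand t p) = eval (dirPt t) p := by
  rw [expand, constantCoeff_aeval]
  congr 2
  ext j
  exact constantCoeff_dirPS t j

/-- The linear form which vanishes in the direction `t`. -/
noncomputable def dirForm (t : OnePoint ℂ) : MvPolynomial (Fin 2) ℂ :=
  t.elim (X 0) (fun s => X 1 - C s * X 0)

theorem dirForm_ne_zero (t : OnePoint ℂ) : dirForm t ≠ 0 := by
  induction t using OnePoint.rec with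
  | infty => exact X_ne_zero _
  | coe s =>
    intro h
    have := congrArg (eval ![0, 1]) h
    simp [dirForm] at this

theorem dirForm_isHomogeneous (t : OnePoint ℂ) : (dirForm t).IsHomogeneous 1 := by
  induction t using OnePoint.rec with
  | infty => exact isHomogeneous_X _ _
  | coe s => exact (isHomogeneous_X _ _).sub (isHomogeneous_C_mul_X _ _)

open Classical in
theorem order_expand_dirForm (t t' : OnePoint ℂ) :
    (expand t (dirForm t')).order = if t = t' then 1 else 0 := by
  split_ifs with h
  · subst h
    induction t using OnePoint.rec <;> simp [expand, dirForm, dirPS]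
  · refine PowerSeries.order_zero_of_unit (PowerSeries.isUnit_iff_constantCoeff.mpr
      (isUnit_iff_ne_zero.mpr ?_))
    rw [constantCoeff_expand]
    induction t using OnePoint.rec <;> induction t' using OnePoint.rec
    · exact absurd rfl h
    · simp [dirForm, dirPt]
    · simp [dirForm, dirPt]
    · rename_i s s'
      have : s ≠ s' := fun hs => h (by rw [hs])
      simpa [dirForm, dirPt, sub_eq_zero] using this

open Classical in
theorem order_expand_prod (t : OnePoint ℂ) (s : Multiset (OnePoint ℂ)) :
    (expand t (s.map dirForm).prod).order = s.count t := by
  induction s using Multiset.induction with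
  | empty => simp
  | cons a s ih =>
    rw [Multiset.map_cons, Multiset.prod_cons, map_mul, PowerSeries.order_mul, ih,
      order_expand_dirForm, Multiset.count_cons]
    split_ifs <;> push_cast <;> ring

/-- A binary form of positive degree has a root, which is `∞` or a root of the polynomial `p (1, s)`
in one variable. -/
theorem exists_dirForm_dvd {p : MvPolynomial (Fin 2) ℂ} {n : ℕ} (hp : p.IsHomogeneous (n + 1)) :
    ∃ t, dirForm t ∣ p := by
  by_cases h : eval ![0, 1] p = 0
  · refine ⟨OnePoint.infty, ?_⟩
    have := linear_dvd_of_eval_eq_zero hp (v := ![0, 1]) (by simp) h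
    simpa [dirForm] using this
  · have hr : ∃ s : ℂ, eval ![1, s] p = 0 := by
      by_contra! hne
      set q : Polynomial ℂ := aeval ![1, Polynomial.X] p with hq
      have hev : ∀ s : ℂ, q.eval s = eval ![1, s] p := by
        intro s
        have := comp_aeval_apply (R := ℂ) (f := ![1, Polynomial.X])
          (Polynomial.aeval (R := ℂ) s) p
        rw [Polynomial.coe_aeval_eq_eval] at this
        rw [hq, this, ← aeval_eq_eval]
        congr 2
        ext j
        fin_cases j <;> simp
      have hdeg : q.degree = 0 := by
        by_contra hd
        obtain ⟨s, hs⟩ := IsAlgClosed.exists_root q hd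
        exact hne s (by rw [← hev]; exact hs)
      rw [Polynomial.eq_C_of_degree_eq_zero hdeg] at hev
      simp only [Polynomial.eval_C] at hev
      have h0 : p - C (q.coeff 0) * X 0 ^ (n + 1) = 0 := by
        refine eq_zero_of_eval_one_left (n := n + 1) (hp.sub ?_) fun s => ?_
        · have := (isHomogeneous_C (Fin 2) (q.coeff 0)).mul
            ((isHomogeneous_X ℂ (0 : Fin 2)).pow (n + 1))
          simpa using this
        · simp [← hev]
      rw [sub_eq_zero] at h0
      apply h
      rw [h0]
      simp
    obtain ⟨s, hs⟩ := hr
    refine ⟨(s : OnePoint ℂ), ?_⟩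
    have := linear_dvd_of_eval_eq_zero hp (v := ![1, s]) (by simp) hs
    rw [← dvd_neg] at this
    simpa [dirForm] using (neg_dvd.mpr this)

open Classical in
/-- A binary form of degree `n` has `n` roots, with multiplicities. -/
theorem exists_roots (n : ℕ) {p : MvPolynomial (Fin 2) ℂ} (hp : p.IsHomogeneous n) (h0 : p ≠ 0) :
    ∃ s : Multiset (OnePoint ℂ), s.card = n ∧ ∀ t, (expand t p).order = s.count t := by
  induction n generalizing p with
  | zero =>
    refine ⟨0, rfl, fun t => ?_⟩
    rw [totalDegree_eq_zero_iff_eq_C.mp ((totalDegree_zero_iff_isHomogeneous ..).mpr hp)] at h0 ⊢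
    rw [Multiset.count_zero, Nat.cast_zero]
    refine PowerSeries.order_zero_of_unit (PowerSeries.isUnit_iff_constantCoeff.mpr
      (isUnit_iff_ne_zero.mpr ?_))
    rw [constantCoeff_expand, eval_C]
    exact fun h => h0 (by rw [h, C_0])
  | succ n ih =>
    obtain ⟨t, q, rfl⟩ := exists_dirForm_dvd hp
    obtain ⟨s, hs, hsq⟩ := ih
      (IsHomogeneous.of_mul_left (dirForm_isHomogeneous t) (dirForm_ne_zero t) (by rwa [add_comm]))
      (right_ne_zero_of_mul h0)
    refine ⟨t ::ₘ s, by simp [hs], fun t' => ?_⟩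
    rw [map_mul, PowerSeries.order_mul, hsq, order_expand_dirForm, Multiset.count_cons]
    split_ifs <;> push_cast <;> ring

/-! ### Base points away from the double point -/

theorem aeval_form {A : Type*} [CommRing A] [Algebra ℂ A] (T : CubicData) (ζ : A) (d : Fin 2 → A)
    (i : Fin 3) : aeval ![ζ, d 0, d 1] (T.form i) =
      pencilTriple d (aeval d T.b₂ + ζ * aeval d T.b₁) (aeval d T.a₃ + ζ * aeval d T.a₂) i := by
  have hb : ∀ q, aeval ![ζ, d 0, d 1] (bin q) = aeval d q := by
    intro q
    rw [bin, aeval_rename]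
    congr 2
    ext j
    fin_cases j <;> rfl
  have hd : (fun j : Fin 2 => aeval ![ζ, d 0, d 1] (X j.succ : MvPolynomial (Fin 3) ℂ)) = d := by
    ext j
    fin_cases j <;> simp
  change aeval ![ζ, d 0, d 1] (pencilTriple (fun j : Fin 2 => X j.succ) T.conic T.cubic i) = _
  rw [map_pencilTriple, hd, CubicData.conic, CubicData.cubic]
  simp only [map_add, map_mul, aeval_X, hb, Matrix.cons_val, add_comm]

/-- A formal arc in the plane through the centre of an affine chart, in the chart. -/
theorem exists_aeval_chartLin {R : Matrix (Fin 3) (Fin 3) ℂ} (hR : IsUnit R.det)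
    {G : Fin 3 → ℂ⟦X⟧} {c : ℂ} (hc : c ≠ 0)
    (hG : ∀ i, PowerSeries.constantCoeff (G i) = c * R i 0) :
    ∃ (η : Fin 2 → ℂ⟦X⟧) (u : ℂ⟦X⟧), PowerSeries.constantCoeff u ≠ 0 ∧
      (∀ j, PowerSeries.constantCoeff (η j) = 0) ∧ ∀ i, G i = u * aeval η (chartLin R i) := by
  set Λ : Fin 3 → ℂ⟦X⟧ := fun i => ∑ j, PowerSeries.C (R⁻¹ i j) * G j with hΛ
  have hΛc : ∀ i, PowerSeries.constantCoeff (Λ i) = c * (1 : Matrix (Fin 3) (Fin 3) ℂ) i 0 := by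
    intro i
    simp only [hΛ, map_sum, map_mul, PowerSeries.constantCoeff_C, hG]
    rw [← Matrix.nonsing_inv_mul R hR, Matrix.mul_apply, Finset.mul_sum]
    exact Finset.sum_congr rfl fun j _ => by ring
  have hGΛ : ∀ i, G i = ∑ j, PowerSeries.C (R i j) * Λ j := by
    intro i
    simp only [hΛ, Finset.mul_sum]
    rw [Finset.sum_comm]
    have h1 : ∀ k, ∑ j, PowerSeries.C (R i j) * (PowerSeries.C (R⁻¹ j k) * G k) =
        PowerSeries.C ((1 : Matrix (Fin 3) (Fin 3) ℂ) i k) * G k := by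
      intro k
      rw [← Matrix.mul_nonsing_inv R hR, Matrix.mul_apply, map_sum, Finset.sum_mul]
      exact Finset.sum_congr rfl fun j _ => by rw [map_mul, mul_assoc]
    simp only [h1]
    simp [Matrix.one_apply]
  have h0 : PowerSeries.constantCoeff (Λ 0) ≠ 0 := by simpa [hΛc] using hc
  have hinv : Λ 0 * (Λ 0)⁻¹ = 1 := PowerSeries.mul_inv_cancel _ h0
  refine ⟨![Λ 1 * (Λ 0)⁻¹, Λ 2 * (Λ 0)⁻¹], Λ 0, h0, fun j => ?_, fun i => ?_⟩
  · fin_cases j <;> simp [hΛc]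
  · rw [hGΛ, Fin.sum_univ_three, chartLin]
    simp only [map_add, map_mul, aeval_X, aeval_C, Matrix.cons_val]
    change _ = Λ 0 * (PowerSeries.C (R i 0) + PowerSeries.C (R i 1) * (Λ 1 * (Λ 0)⁻¹) +
      PowerSeries.C (R i 2) * (Λ 2 * (Λ 0)⁻¹))
    linear_combination (-PowerSeries.C (R i 1) * Λ 1 - PowerSeries.C (R i 2) * Λ 2) * hinv

theorem aeval_eq_mul_aeval_bind₁ {R : Matrix (Fin 3) (Fin 3) ℂ} {G : Fin 3 → ℂ⟦X⟧}
    {η : Fin 2 → ℂ⟦X⟧} {u : ℂ⟦X⟧} (hG : ∀ i, G i = u * aeval η (chartLin R i))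
    {F : MvPolynomial (Fin 3) ℂ} {n : ℕ} (hF : F.IsHomogeneous n) :
    aeval G F = u ^ n * aeval η (bind₁ (chartLin R) F) := by
  rw [funext hG, IsHomogeneous.aeval_smul hF, aeval_bind₁]

theorem order_aeval_bind₁_chartLin {R : Matrix (Fin 3) (Fin 3) ℂ} {G : Fin 3 → ℂ⟦X⟧}
    {η : Fin 2 → ℂ⟦X⟧} {u : ℂ⟦X⟧} (hu : PowerSeries.constantCoeff u ≠ 0)
    (hG : ∀ i, G i = u * aeval η (chartLin R i))
    {F : MvPolynomial (Fin 3) ℂ} {n : ℕ} (hF : F.IsHomogeneous n) :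
    (aeval η (bind₁ (chartLin R) F)).order = (aeval G F).order := by
  rw [aeval_eq_mul_aeval_bind₁ hG hF, mul_comm, order_mul_of_constantCoeff_ne_zero]
  simpa using fun h => absurd h hu

theorem constantCoeff_bind₁_chartLin (R : Matrix (Fin 3) (Fin 3) ℂ) (F : MvPolynomial (Fin 3) ℂ) :
    constantCoeff (bind₁ (chartLin R) F) = eval (fun i => R i 0) F := by
  rw [← eval_zero, ← aeval_eq_eval, aeval_bind₁, ← aeval_eq_eval]
  congr 2
  ext i
  simp [chartLin]

theorem exists_coeff_single_ne_zero {η : Fin 2 → ℂ⟦X⟧}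
    (hη : ∀ j, PowerSeries.constantCoeff (η j) = 0) {p : LocalPoly}
    (h : PowerSeries.coeff 1 (aeval η p) ≠ 0) : ∃ j, coeff (Finsupp.single j 1) p ≠ 0 := by
  by_contra! hz
  apply h
  rw [(aeval_arc hη p).2]
  simp [hz]

theorem CubicData.form_isHomogeneous (T : CubicData) (i : Fin 3) : (T.form i).IsHomogeneous 3 := by
  have hc : T.conic.IsHomogeneous 2 :=
    ((isHomogeneous_X ℂ (0 : Fin 3)).mul T.hb₁.rename_isHomogeneous).add
      T.hb₂.rename_isHomogeneous
  have hd : T.cubic.IsHomogeneous 3 :=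
    ((isHomogeneous_X ℂ (0 : Fin 3)).mul T.ha₂.rename_isHomogeneous).add
      T.ha₃.rename_isHomogeneous
  fin_cases i
  · exact (isHomogeneous_X ℂ (1 : Fin 3)).mul hc
  · exact (isHomogeneous_X ℂ (2 : Fin 3)).mul hc
  · exact hd

theorem coeff_one_ne_zero_of_order_eq_one {φ : ℂ⟦X⟧} (h : PowerSeries.order φ = 1) :
    PowerSeries.coeff 1 φ ≠ 0 :=
  ((PowerSeries.order_eq_nat (n := 1)).mp h).1

/-- Along the line through a zero `z` of a member, this member is linear in the parameter. -/
theorem pencilTriple_linear (d : Fin 2 → ℂ) (f f' g g' z : ℂ) (i : Fin 3)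
    (h : pencilTriple d (f + z * f') (g + z * g') i = 0) :
    pencilTriple (fun j => PowerSeries.C (d j))
      (PowerSeries.C f + (PowerSeries.C z + PowerSeries.X) * PowerSeries.C f')
      (PowerSeries.C g + (PowerSeries.C z + PowerSeries.X) * PowerSeries.C g') i =
    PowerSeries.C (pencilTriple d f' g' i) * PowerSeries.X := by
  have h1 := congrArg PowerSeries.C h
  rw [map_zero] at h1
  fin_cases i <;> simp [pencilTriple] at h1 ⊢
  · rcases h1 with h1 | h1
    · simp [h1]
    · linear_combination PowerSeries.C (d 0) * h1
  · rcases h1 with h1 | h1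
    · simp [h1]
    · linear_combination PowerSeries.C (d 1) * h1
  · linear_combination h1

/-- The base points of a net in normal form in the direction `t`, if the line in this direction is
not tangent to the net at the double point: they form a chain on a smooth arc through the unique
common zero of the net on this line. -/
theorem CubicData.exists_chain_off (T : CubicData) (t : OnePoint ℂ)
    (h : eval (dirPt t) T.b₁ ≠ 0 ∨ eval (dirPt t) T.a₂ ≠ 0) {m : ℕ}
    (hm : (expand t T.disc).order = m) :
    ∃ z : ℂ, (∀ w, (∀ i, eval ![w, dirPt t 0, dirPt t 1] (T.form i) = 0) → w = z) ∧
      ∀ R : Matrix (Fin 3) (Fin 3) ℂ, IsUnit R.det →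
        ∀ c : ℂ, c ≠ 0 → (∀ i, ![z, dirPt t 0, dirPt t 1] i = c * R i 0) →
        ∃ γ, IsArc γ ∧
          (∀ j < m, mult (iterStrictTransform (arcLabels j γ)
            fun i => bind₁ (chartLin R) (T.form i)) = 1) ∧
          ∀ l, 0 < mult (iterStrictTransform l fun i => bind₁ (chartLin R) (T.form i)) →
            ∃ j < m, l = arcLabels j γ := by
  obtain ⟨j₀, hj₀⟩ := exists_dirPt_ne_zero t
  have hdisc : expand t T.b₂ * expand t T.a₂ - expand t T.a₃ * expand t T.b₁ =
      -expand t T.disc := by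
    simp only [CubicData.disc, map_sub, map_mul]; ring
  obtain ⟨ζ, ⟨i₀, hi₀, hi₀'⟩, hle, heq, -⟩ := exists_pencilTriple_eq_zero (d := dirPS t)
    ⟨j₀, by rwa [constantCoeff_dirPS]⟩
    (f := expand t T.b₂) (f' := expand t T.b₁) (g := expand t T.a₃) (g' := expand t T.a₂)
    (by rwa [constantCoeff_expand, constantCoeff_expand])
  rw [hdisc, PowerSeries.order_neg, hm] at hle heq
  set z := PowerSeries.constantCoeff ζ with hz
  have hcst : pencilTriple (dirPt t) (eval (dirPt t) T.b₂ + z * eval (dirPt t) T.b₁)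
      (eval (dirPt t) T.a₃ + z * eval (dirPt t) T.a₂) i₀ = 0 := by
    have := congrArg PowerSeries.constantCoeff hi₀
    rw [map_pencilTriple] at this
    simpa only [map_add, map_mul, constantCoeff_expand, constantCoeff_dirPS, map_zero] using this
  have hsl : pencilTriple (dirPt t) (eval (dirPt t) T.b₁) (eval (dirPt t) T.a₂) i₀ ≠ 0 := by
    rw [map_pencilTriple] at hi₀'
    simpa only [constantCoeff_expand, constantCoeff_dirPS] using hi₀'
  have hev : ∀ w i, eval ![w, dirPt t 0, dirPt t 1] (T.form i) = pencilTriple (dirPt t)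
      (eval (dirPt t) T.b₂ + w * eval (dirPt t) T.b₁)
      (eval (dirPt t) T.a₃ + w * eval (dirPt t) T.a₂) i := by
    intro w i
    have := aeval_form T w (dirPt t) i
    simpa only [aeval_eq_eval] using this
  refine ⟨z, fun w hw => ?_, fun R hR c hc hRz => ?_⟩
  · have h1 := hw i₀
    rw [hev] at h1
    have h2 : (w - z) *
        pencilTriple (dirPt t) (eval (dirPt t) T.b₁) (eval (dirPt t) T.a₂) i₀ = 0 := by
      have h3 : (w - z) * pencilTriple (dirPt t) (eval (dirPt t) T.b₁) (eval (dirPt t) T.a₂) i₀ =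
          pencilTriple (dirPt t) (eval (dirPt t) T.b₂ + w * eval (dirPt t) T.b₁)
            (eval (dirPt t) T.a₃ + w * eval (dirPt t) T.a₂) i₀ -
          pencilTriple (dirPt t) (eval (dirPt t) T.b₂ + z * eval (dirPt t) T.b₁)
            (eval (dirPt t) T.a₃ + z * eval (dirPt t) T.a₂) i₀ := by
        generalize eval (dirPt t) T.b₁ = x
        generalize eval (dirPt t) T.b₂ = x
        generalize eval (dirPt t) T.a₂ = x
        generalize eval (dirPt t) T.a₃ = x
        fin_cases i₀ <;> simp [pencilTriple] <;> ring
      rw [h3, h1, hcst, sub_zero]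
    exact sub_eq_zero.mp ((mul_eq_zero.mp h2).resolve_right hsl)
  · -- the arc of common zeros of one member of the net, for varying directions
    obtain ⟨γ, u, hu, hγ, hG⟩ := exists_aeval_chartLin hR hc (G := ![ζ, dirPS t 0, dirPS t 1])
      (fun i => by
        rw [← hRz]
        fin_cases i
        · rfl
        · exact constantCoeff_dirPS t 0
        · exact constantCoeff_dirPS t 1)
    have hval : ∀ i, (aeval γ (bind₁ (chartLin R) (T.form i))).order =
        (pencilTriple (dirPS t) (expand t T.b₂ + ζ * expand t T.b₁)
          (expand t T.a₃ + ζ * expand t T.a₂) i).order := by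
      intro i
      rw [order_aeval_bind₁_chartLin hu hG (T.form_isHomogeneous i), aeval_form]; rfl
    have harc : IsArc γ := by
      refine ⟨hγ, ?_⟩
      by_contra! hs
      have h1 : ∀ i, PowerSeries.coeff 1 (![ζ, dirPS t 0, dirPS t 1] i) =
          PowerSeries.coeff 1 u * R i 0 := by
        intro i
        rw [hG, PowerSeries.coeff_mul, Finset.Nat.antidiagonal_succ]
        simp [chartLin, hs, hγ]
      have h2 : ![z, dirPt t 0, dirPt t 1] 1 * PowerSeries.coeff 1 (![ζ, dirPS t 0, dirPS t 1] 2) =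
          ![z, dirPt t 0, dirPt t 1] 2 * PowerSeries.coeff 1 (![ζ, dirPS t 0, dirPS t 1] 1) := by
        rw [h1, h1, hRz, hRz]; ring
      induction t using OnePoint.rec <;> simp [dirPt, dirPS, PowerSeries.coeff_one] at h2
    -- the line through the double point is transversal to this member
    obtain ⟨η, u', hu', hη, hG'⟩ := exists_aeval_chartLin hR hc
      (G := ![PowerSeries.C z + PowerSeries.X, PowerSeries.C (dirPt t 0),
        PowerSeries.C (dirPt t 1)])
      (fun i => by
        rw [← hRz]
        fin_cases i <;> simp)
    have hC : ∀ q, aeval (fun j => PowerSeries.C (dirPt t j)) q =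
        (PowerSeries.C (eval (dirPt t) q) : ℂ⟦X⟧) := by
      intro q
      have := comp_aeval_apply (R := ℂ) (f := dirPt t) (Algebra.ofId ℂ ℂ⟦X⟧) q
      rw [aeval_eq_eval] at this
      exact this.symm
    have hlin : (aeval η (bind₁ (chartLin R) (T.form i₀))).order = 1 := by
      rw [order_aeval_bind₁_chartLin hu' hG' (T.form_isHomogeneous i₀),
        aeval_form T _ (fun j => PowerSeries.C (dirPt t j)), hC, hC, hC, hC,
        pencilTriple_linear _ _ _ _ _ _ _ hcst, mul_comm,
        order_mul_of_constantCoeff_ne_zero (by simpa using hsl),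
        PowerSeries.order_X]
    refine ⟨γ, harc, mult_chain m _ γ harc (fun i => by rw [hval]; exact hle i) ?_ ⟨i₀, ?_, ?_⟩⟩
    · obtain ⟨i, hi⟩ := heq
      exact ⟨i, by rw [hval]; exact hi⟩
    · rw [← PowerSeries.order_eq_top, hval, hi₀, PowerSeries.order_zero]
    · exact exists_coeff_single_ne_zero hη (coeff_one_ne_zero_of_order_eq_one hlin)

/-! ### Base points infinitely near the double point -/

theorem bind₁_chartLin_one_form (T : CubicData) (i : Fin 3) :
    bind₁ (chartLin 1) (T.form i) = pencilTriple X (T.b₂ + T.b₁) (T.a₃ + T.a₂) i := by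
  have h : chartLin 1 = ![1, X 0, X 1] := by
    ext1 i
    fin_cases i <;> simp [chartLin, Matrix.one_apply]
  have := aeval_form T (1 : LocalPoly) X i
  rw [h, bind₁, this]
  simp

theorem mult_eq_of_initial {ι : Type} {g A D : ι → LocalPoly} {n : ℕ} (h : ∀ i, g i = D i + A i)
    (hA : ∀ i, (A i).IsHomogeneous n) (hD : ∀ i, (D i).IsHomogeneous (n + 1)) {i : ι}
    (hi : A i ≠ 0) : mult g = n := by
  obtain ⟨d, hd⟩ := ne_zero_iff.mp hi
  have hdn : d.degree = n := by
    by_contra hne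
    exact hd ((hA i).coeff_eq_zero hne)
  refine mult_eq (fun i e he => ?_) hdn (i₀ := i) ?_
  · rw [h, coeff_add, (hA i).coeff_eq_zero (by omega), (hD i).coeff_eq_zero (by omega), add_zero]
  · rwa [h, coeff_add, (hD i).coeff_eq_zero (by omega), zero_add]

theorem isHomogeneous_pencilTriple {f g : LocalPoly} {n : ℕ} (hf : f.IsHomogeneous n)
    (hg : g.IsHomogeneous (n + 1)) (i : Fin 3) :
    (pencilTriple (X : Fin 2 → LocalPoly) f g i).IsHomogeneous (n + 1) := by
  rw [add_comm] at hg ⊢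
  fin_cases i
  · exact (isHomogeneous_X ℂ (0 : Fin 2)).mul hf
  · exact (isHomogeneous_X ℂ (1 : Fin 2)).mul hf
  · exact hg

theorem pencilTriple_add {A : Type*} [CommRing A] (d : Fin 2 → A) (f f' g g' : A) (i : Fin 3) :
    pencilTriple d (f + f') (g + g') i = pencilTriple d f g i + pencilTriple d f' g' i := by
  fin_cases i <;> simp [pencilTriple, mul_add]

theorem CubicData.mult_double (T : CubicData) :
    mult (fun i => bind₁ (chartLin 1) (T.form i)) = 2 := by
  have hA : ∃ i, pencilTriple (X : Fin 2 → LocalPoly) T.b₁ T.a₂ i ≠ 0 := by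
    by_contra! h
    have h1 : T.b₁ = 0 := (mul_eq_zero.mp (h 0)).resolve_left (X_ne_zero _)
    have h2 : T.a₂ = 0 := h 2
    exact T.disc_ne_zero (by rw [h1, h2]; ring)
  obtain ⟨i, hi⟩ := hA
  exact mult_eq_of_initial (A := pencilTriple X T.b₁ T.a₂) (D := pencilTriple X T.b₂ T.a₃)
    (fun i => by rw [bind₁_chartLin_one_form, pencilTriple_add])
    (isHomogeneous_pencilTriple T.hb₁ T.ha₂) (isHomogeneous_pencilTriple T.hb₂ T.ha₃) hi

theorem CubicData.strictTransform_double (T : CubicData) (t : OnePoint ℂ) :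
    strictTransform t (fun i => bind₁ (chartLin 1) (T.form i)) =
      pencilTriple (dirPoly t) (aeval (dirPoly t) T.b₁ + X 0 * aeval (dirPoly t) T.b₂)
        (aeval (dirPoly t) T.a₂ + X 0 * aeval (dirPoly t) T.a₃) := by
  ext1 i
  refine strictTransform_eq T.mult_double ?_
  rw [bind₁_chartLin_one_form, map_pencilTriple]
  have h : ∀ {q : LocalPoly} {n : ℕ}, q.IsHomogeneous n →
      bind₁ (blowUpChart t) q = X 0 ^ n * aeval (dirPoly t) q := by
    intro q n hq
    rw [bind₁, show blowUpChart t = fun j => X 0 * dirPoly t j from funext (blowUpChart_eq t),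
      IsHomogeneous.aeval_smul hq]
  simp only [map_add, h T.hb₁, h T.hb₂, h T.ha₂, h T.ha₃, bind₁_X_right, blowUpChart_eq]
  fin_cases i <;> simp [pencilTriple] <;> ring

/-- No base point is infinitely near the double point in a direction which is not tangent. -/
theorem CubicData.mult_double_eq_zero (T : CubicData) {t : OnePoint ℂ}
    (h : eval (dirPt t) T.b₁ ≠ 0 ∨ eval (dirPt t) T.a₂ ≠ 0) (l : List (OnePoint ℂ)) :
    mult (iterStrictTransform (t :: l) fun i => bind₁ (chartLin 1) (T.form i)) = 0 := by
  change mult (iterStrictTransform l (strictTransform t _)) = 0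
  rw [T.strictTransform_double t]
  have hq : ∀ q, constantCoeff (aeval (dirPoly t) q) = eval (dirPt t) q := by
    intro q
    rw [← eval_zero, ← aeval_eq_eval, ← AlgHom.comp_apply, ← aeval_eq_eval]
    congr 1
    ext j
    simp [← constantCoeff_dirPoly, constantCoeff_eq, aeval_eq_eval]
  have hc : ∀ i, constantCoeff (pencilTriple (dirPoly t)
      (aeval (dirPoly t) T.b₁ + X 0 * aeval (dirPoly t) T.b₂)
      (aeval (dirPoly t) T.a₂ + X 0 * aeval (dirPoly t) T.a₃) i) =
      pencilTriple (dirPt t) (eval (dirPt t) T.b₁) (eval (dirPt t) T.a₂) i := by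
    intro i
    rw [map_pencilTriple]
    simp only [map_add, map_mul, constantCoeff_X, zero_mul, add_zero, hq, constantCoeff_dirPoly]
  obtain ⟨j, hj⟩ := exists_dirPt_ne_zero t
  have hi : ∃ i, pencilTriple (dirPt t) (eval (dirPt t) T.b₁) (eval (dirPt t) T.a₂) i ≠ 0 := by
    rcases h with h | h
    · fin_cases j
      exacts [⟨0, mul_ne_zero hj h⟩, ⟨1, mul_ne_zero hj h⟩]
    · exact ⟨2, h⟩
  obtain ⟨i, hi⟩ := hi
  exact mult_iterStrictTransform_eq_zero (i := i) (by rwa [hc]) l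

/-- The base points infinitely near the double point in a tangent direction form a chain on a
smooth arc, which is tangent to the exceptional curve to the order of contact of the tangent cones
with the direction. -/
theorem CubicData.exists_chain_on (T : CubicData) (t : OnePoint ℂ)
    (h₁ : eval (dirPt t) T.b₁ = 0) (h₂ : eval (dirPt t) T.a₂ = 0) {m : ℕ}
    (hm : (expand t T.disc).order = m) :
    ∃ γ, IsArc γ ∧
      (∀ j < m, mult (iterStrictTransform (t :: arcLabels j γ)
        fun i => bind₁ (chartLin 1) (T.form i)) = 1) ∧
      (∀ l, 0 < mult (iterStrictTransform (t :: l) fun i => bind₁ (chartLin 1) (T.form i)) →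
        ∃ j < m, l = arcLabels j γ) ∧
      ∀ n < m, ((n : ℕ∞) < (γ 0).order ↔
        (n : ℕ∞) < (expand t T.b₁).order ∧ (n : ℕ∞) < (expand t T.a₂).order) := by
  obtain ⟨j₀, hj₀⟩ := exists_dirPt_ne_zero t
  have hdisc : expand t T.b₁ * expand t T.a₃ - expand t T.a₂ * expand t T.b₂ =
      expand t T.disc := by
    simp only [CubicData.disc, map_sub, map_mul]; ring
  have hnz : PowerSeries.constantCoeff (expand t T.b₂) ≠ 0 ∨
      PowerSeries.constantCoeff (expand t T.a₃) ≠ 0 := by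
    rw [constantCoeff_expand, constantCoeff_expand]
    by_contra! hz
    exact T.no_common_zero (dirPt t) (dirPt_ne_zero t) h₁ hz.1 h₂ hz.2
  obtain ⟨ζ, ⟨i₀, hi₀, hi₀'⟩, hle, heq, hζ⟩ := exists_pencilTriple_eq_zero (d := dirPS t)
    ⟨j₀, by rwa [constantCoeff_dirPS]⟩
    (f := expand t T.b₁) (f' := expand t T.b₂) (g := expand t T.a₂) (g' := expand t T.a₃) hnz
  rw [hdisc, hm] at hle heq hζ
  have hm0 : 0 < m := by
    have h1 : ((0 : ℕ) : ℕ∞) < (expand t T.disc).order := cast_zero_lt_order (by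
      rw [constantCoeff_expand, CubicData.disc]
      simp [h₁, h₂])
    rw [hm] at h1
    exact_mod_cast h1
  have hζ0 : PowerSeries.constantCoeff ζ = 0 := by
    refine PowerSeries.order_ne_zero_iff_constCoeff_eq_zero.mp ?_
    have := (hζ 0 (by exact_mod_cast hm0)).mpr ⟨cast_zero_lt_order (by rwa [constantCoeff_expand]),
      cast_zero_lt_order (by rwa [constantCoeff_expand])⟩
    exact (ne_of_lt (by simpa using this)).symm
  have harc : IsArc ![ζ, PowerSeries.X] :=
    ⟨fun j => by fin_cases j <;> simp [hζ0], 1, by simp⟩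
  have hdir : ∀ (ψ : ℂ⟦X⟧) (j : Fin 2), aeval ![ψ, PowerSeries.X] (dirPoly t j) = dirPS t j := by
    intro ψ j
    induction t using OnePoint.rec <;> fin_cases j <;> simp [dirPoly, dirPS]
  have hval : ∀ (v : Fin 2 → ℂ⟦X⟧) i, aeval v
      (strictTransform t (fun i => bind₁ (chartLin 1) (T.form i)) i) =
      pencilTriple (fun j => aeval v (dirPoly t j))
        (aeval (fun j => aeval v (dirPoly t j)) T.b₁ +
          v 0 * aeval (fun j => aeval v (dirPoly t j)) T.b₂)
        (aeval (fun j => aeval v (dirPoly t j)) T.a₂ +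
          v 0 * aeval (fun j => aeval v (dirPoly t j)) T.a₃) i := by
    intro v i
    have hc : ∀ q, aeval v (aeval (dirPoly t) q) = aeval (fun j => aeval v (dirPoly t j)) q :=
      fun q => comp_aeval_apply (f := dirPoly t) (aeval v) q
    rw [T.strictTransform_double t, map_pencilTriple]
    simp only [map_add, map_mul, aeval_X, hc]
  have hvalγ : ∀ i, aeval ![ζ, PowerSeries.X]
      (strictTransform t (fun i => bind₁ (chartLin 1) (T.form i)) i) =
      pencilTriple (dirPS t) (expand t T.b₁ + ζ * expand t T.b₂)
        (expand t T.a₂ + ζ * expand t T.a₃) i := by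
    intro i
    rw [hval]
    simp only [hdir, Matrix.cons_val]
    rfl
  have hsl : pencilTriple (dirPt t) (eval (dirPt t) T.b₂) (eval (dirPt t) T.a₃) i₀ ≠ 0 := by
    rw [map_pencilTriple] at hi₀'
    simpa only [constantCoeff_expand, constantCoeff_dirPS] using hi₀'
  -- the fibre over the direction `t` is transversal to the member which contains the arc
  have hη : ∀ j, PowerSeries.constantCoeff ((![PowerSeries.X, 0] : Fin 2 → ℂ⟦X⟧) j) = 0 := by
    intro j
    fin_cases j <;> simp
  have hlin : aeval ![PowerSeries.X, 0]
      (strictTransform t (fun i => bind₁ (chartLin 1) (T.form i)) i₀) =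
      PowerSeries.C (pencilTriple (dirPt t) (eval (dirPt t) T.b₂) (eval (dirPt t) T.a₃) i₀) *
        PowerSeries.X := by
    have hd : ∀ j, aeval ![PowerSeries.X, 0] (dirPoly t j) =
        (PowerSeries.C (dirPt t j) : ℂ⟦X⟧) := by
      intro j
      induction t using OnePoint.rec <;> fin_cases j <;> simp [dirPoly, dirPt]
    have hC : ∀ q, aeval (fun j => PowerSeries.C (dirPt t j)) q =
        (PowerSeries.C (eval (dirPt t) q) : ℂ⟦X⟧) := by
      intro q
      have := comp_aeval_apply (R := ℂ) (f := dirPt t) (Algebra.ofId ℂ ℂ⟦X⟧) q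
      rw [aeval_eq_eval] at this
      exact this.symm
    rw [hval]
    simp only [hd, hC, h₁, h₂, Matrix.cons_val]
    fin_cases i₀ <;> simp [pencilTriple] <;> ring
  obtain ⟨hc1, hc2⟩ := mult_chain m (strictTransform t fun i => bind₁ (chartLin 1) (T.form i))
    ![ζ, PowerSeries.X] harc (fun i => by rw [hvalγ]; exact hle i)
    (by obtain ⟨i, hi⟩ := heq; exact ⟨i, by rw [hvalγ]; exact hi⟩)
    ⟨i₀, by rw [hvalγ, hi₀], exists_coeff_single_ne_zero hη (by
      rw [hlin]; simpa using hsl)⟩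
  exact ⟨_, harc, hc1, hc2, fun n hn => hζ n (by exact_mod_cast hn)⟩

/-! ### The base points of a map in normal form -/

variable {φ : PlaneCremonaMap} {T : CubicData} {P : ℙ ℂ (Fin 3 → ℂ)}
  {Q M : Matrix (Fin 3) (Fin 3) ℂ}

theorem bind₁_chartLin_linSub (S A : Matrix (Fin 3) (Fin 3) ℂ) (p : MvPolynomial (Fin 3) ℂ) :
    bind₁ (chartLin A) (bind₁ (linSub S) p) = bind₁ (chartLin (S * A)) p := by
  rw [bind₁_bind₁]
  congr 2
  ext1 i
  simp only [linSub, map_sum, map_mul, bind₁_C_right, bind₁_X_right, chartLin, Matrix.mul_apply]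
  simp only [Fin.sum_univ_three]
  ring

theorem IsNormalFrame.multAt_eq (h : IsNormalFrame φ T P Q M) (p : BubblePoint)
    {A : Matrix (Fin 3) (Fin 3) ℂ} (hA : affineChart p.base = chartLin A) :
    φ.multAt p = mult (iterStrictTransform p.labels
      fun i => bind₁ (chartLin (Q * A)) (T.form i)) := by
  obtain ⟨B, hB, hf⟩ := h.form
  have h1 : (fun i => bind₁ (affineChart p.base) (φ.form i)) =
      matAct B fun i => bind₁ (chartLin (Q * A)) (T.form i) := by
    ext1 i
    rw [hA, hf, map_sum, matAct]
    refine Finset.sum_congr rfl fun j _ => ?_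
    rw [map_mul, bind₁_C_right, bind₁_chartLin_linSub]
  rw [PlaneCremonaMap.multAt, PlaneCremonaMap.netAt, h1, iterStrictTransform_matAct hB,
    mult_matAct hB]

theorem IsNormalFrame.multAt_base (h : IsNormalFrame φ T P Q M) (l : List (OnePoint ℂ)) :
    φ.multAt ⟨P, l⟩ = mult (iterStrictTransform l fun i => bind₁ (chartLin 1) (T.form i)) := by
  rw [h.multAt_eq ⟨P, l⟩ h.chart, h.mul_eq_one]

theorem IsNormalFrame.multAt_double (h : IsNormalFrame φ T P Q M) : φ.multAt ⟨P, []⟩ = 2 := by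
  rw [h.multAt_base]
  exact T.mult_double

/-- The coordinates of a proper point in the normal form. -/
noncomputable def frameCoord (Q : Matrix (Fin 3) (Fin 3) ℂ) (p : ℙ ℂ (Fin 3 → ℂ)) : Fin 3 → ℂ :=
  Q.mulVec p.rep

/-- The point `p` is in direction `t` from the double point `P`: it is on the line through `P` in
this direction, or infinitely near `P` in this direction. -/
def InDirection (Q : Matrix (Fin 3) (Fin 3) ℂ) (P : ℙ ℂ (Fin 3 → ℂ)) (t : OnePoint ℂ)
    (p : BubblePoint) : Prop :=
  (p.base ≠ P ∧ frameCoord Q p.base 1 * dirPt t 1 = frameCoord Q p.base 2 * dirPt t 0) ∨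
    (p.base = P ∧ ∃ l, p.labels = t :: l)

theorem InDirection.of_proximate {t : OnePoint ℂ} {p q : BubblePoint} (hp : InDirection Q P t p)
    (h : Proximate q p) : InDirection Q P t q := by
  obtain ⟨hb, s, l, hl, -⟩ := h
  rcases hp with ⟨h1, h2⟩ | ⟨h1, l', h2⟩
  · exact Or.inl (by rw [hb]; exact ⟨h1, h2⟩)
  · exact Or.inr ⟨hb.trans h1, l' ++ s :: l, by rw [hl, h2]; rfl⟩

theorem exists_dirPt_proportional (x y : ℂ) :
    ∃ t, x * dirPt t 1 = y * dirPt t 0 := by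
  by_cases hx : x = 0
  · exact ⟨OnePoint.infty, by simp [dirPt, hx]⟩
  · exact ⟨((y / x : ℂ) : OnePoint ℂ), by simp [dirPt]; field_simp⟩

theorem exists_smul_dirPt {x y : ℂ} (h : x ≠ 0 ∨ y ≠ 0) {t : OnePoint ℂ}
    (ht : x * dirPt t 1 = y * dirPt t 0) : ∃ μ ≠ 0, x = μ * dirPt t 0 ∧ y = μ * dirPt t 1 := by
  induction t using OnePoint.rec with
  | infty =>
    simp only [dirPt, OnePoint.elim_infty, Matrix.cons_val, mul_one, mul_zero] at ht ⊢
    exact ⟨y, h.resolve_left (not_not.mpr ht), ht, rfl⟩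
  | coe s =>
    simp only [dirPt, OnePoint.elim_some, Matrix.cons_val, mul_one] at ht ⊢
    refine ⟨x, ?_, rfl, ht.symm⟩
    rintro rfl
    rw [zero_mul] at ht
    rcases h with h | h
    exacts [h rfl, h ht.symm]

theorem dirPt_injective {x y : ℂ} (h : x ≠ 0 ∨ y ≠ 0) {t t' : OnePoint ℂ}
    (ht : x * dirPt t 1 = y * dirPt t 0) (ht' : x * dirPt t' 1 = y * dirPt t' 0) : t = t' := by
  induction t using OnePoint.rec <;> induction t' using OnePoint.rec <;>
    simp [dirPt] at ht ht' ⊢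
  · subst ht
    exact h.elim (fun h => h rfl) (fun h => h (by simpa using ht'.symm))
  · subst ht'
    exact h.elim (fun h => h rfl) (fun h => h (by simpa using ht.symm))
  · have hx : x ≠ 0 := by
      rintro rfl
      rw [zero_mul] at ht
      exact h.elim (fun h => h rfl) (fun h => h ht.symm)
    exact mul_left_cancel₀ hx (ht.trans ht'.symm)

theorem IsNormalFrame.mulVec_frameCoord (h : IsNormalFrame φ T P Q M) (p : ℙ ℂ (Fin 3 → ℂ)) :
    M.mulVec (frameCoord Q p) = p.rep := by
  rw [frameCoord, Matrix.mulVec_mulVec, mul_eq_one_comm.mp h.mul_eq_one, Matrix.one_mulVec]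

theorem eq_of_rep_eq_smul {p q : ℙ ℂ (Fin 3 → ℂ)} {a : ℂ} (h : p.rep = a • q.rep) : p = q := by
  rw [← p.mk_rep, ← q.mk_rep]
  exact (Projectivization.mk_eq_mk_iff' ..).mpr ⟨a, h.symm⟩

theorem IsNormalFrame.frameCoord_base (h : IsNormalFrame φ T P Q M) :
    frameCoord Q P 1 = 0 ∧ frameCoord Q P 2 = 0 := by
  obtain ⟨c, hc, hr⟩ := h.rep
  have h1 : ∀ i, frameCoord Q P i = c * (1 : Matrix (Fin 3) (Fin 3) ℂ) i 0 := by
    intro i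
    rw [← h.mul_eq_one, frameCoord, Matrix.mulVec, dotProduct, Matrix.mul_apply, Finset.mul_sum]
    exact Finset.sum_congr rfl fun j _ => by rw [hr]; ring
  exact ⟨by rw [h1]; simp, by rw [h1]; simp⟩

theorem IsNormalFrame.frameCoord_ne (h : IsNormalFrame φ T P Q M) {p : ℙ ℂ (Fin 3 → ℂ)}
    (hp : p ≠ P) : frameCoord Q p 1 ≠ 0 ∨ frameCoord Q p 2 ≠ 0 := by
  by_contra! hz
  obtain ⟨c, hc, hr⟩ := h.rep
  apply hp
  refine eq_of_rep_eq_smul (a := frameCoord Q p 0 / c) ?_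
  rw [← h.mulVec_frameCoord p]
  ext i
  rw [Matrix.mulVec, dotProduct, Fin.sum_univ_three, hz.1, hz.2, Pi.smul_apply, hr, smul_eq_mul]
  field_simp
  ring

theorem exists_inDirection {p : BubblePoint}
    (hp : p ≠ ⟨P, []⟩) : ∃ t, InDirection Q P t p := by
  by_cases hb : p.base = P
  · rcases hl : p.labels with - | ⟨t, l⟩
    · exact absurd (BubblePoint.ext hb hl) hp
    · exact ⟨t, Or.inr ⟨hb, l, hl⟩⟩
  · obtain ⟨t, ht⟩ := exists_dirPt_proportional (frameCoord Q p.base 1)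
      (frameCoord Q p.base 2)
    exact ⟨t, Or.inl ⟨hb, ht⟩⟩

theorem IsNormalFrame.inDirection_unique (h : IsNormalFrame φ T P Q M) {p : BubblePoint}
    {t t' : OnePoint ℂ} (ht : InDirection Q P t p) (ht' : InDirection Q P t' p) : t = t' := by
  rcases ht with ⟨h1, h2⟩ | ⟨h1, l, h2⟩ <;> rcases ht' with ⟨h1', h2'⟩ | ⟨h1', l', h2'⟩
  · exact dirPt_injective (h.frameCoord_ne h1) h2 h2'
  · exact absurd h1' h1
  · exact absurd h1 h1'
  · exact (List.cons.inj (h2.symm.trans h2')).1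

theorem IsNormalFrame.det_isUnit (h : IsNormalFrame φ T P Q M) : IsUnit Q.det :=
  IsUnit.of_mul_eq_one M.det (by rw [← Matrix.det_mul, h.mul_eq_one, Matrix.det_one])

theorem frameCoord_eq {p : ℙ ℂ (Fin 3 → ℂ)} {A : Matrix (Fin 3) (Fin 3) ℂ} {c : ℂ}
    (hA : ∀ i, p.rep i = c * A i 0) (i : Fin 3) : frameCoord Q p i = c * (Q * A) i 0 := by
  rw [frameCoord, Matrix.mulVec, dotProduct, Matrix.mul_apply, Finset.mul_sum]
  exact Finset.sum_congr rfl fun j _ => by rw [hA]; ring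

theorem eval_smul_eq_zero {F : MvPolynomial (Fin 3) ℂ} {n : ℕ} (hF : F.IsHomogeneous n) (c : ℂ)
    {v : Fin 3 → ℂ} (h : eval v F = 0) : eval (fun i => c * v i) F = 0 := by
  have := IsHomogeneous.aeval_smul hF c v
  rw [aeval_eq_eval, aeval_eq_eval] at this
  rw [this, h, mul_zero]

/-- A proper base point is a common zero of the forms. -/
theorem IsNormalFrame.exists_of_multAt_pos (h : IsNormalFrame φ T P Q M) {t : OnePoint ℂ}
    {p : BubblePoint} (hp : p.base ≠ P)
    (ht : frameCoord Q p.base 1 * dirPt t 1 = frameCoord Q p.base 2 * dirPt t 0)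
    (hpos : 0 < φ.multAt p) :
    ∃ w, (∀ i, eval ![w, dirPt t 0, dirPt t 1] (T.form i) = 0) ∧ ∃ μ : ℂ,
      p.base.rep = μ • M.mulVec ![w, dirPt t 0, dirPt t 1] := by
  obtain ⟨μ, hμ, h1, h2⟩ := exists_smul_dirPt (h.frameCoord_ne hp) ht
  obtain ⟨A, -, hA, c, hc, hr⟩ := exists_chartLin_eq p.base
  have hw : ![frameCoord Q p.base 0 / μ, dirPt t 0, dirPt t 1] =
      fun i => μ⁻¹ * frameCoord Q p.base i := by
    ext i
    fin_cases i
    · simp [div_eq_inv_mul]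
    · simp [h1, hμ]
    · simp [h2, hμ]
  refine ⟨frameCoord Q p.base 0 / μ, fun i => ?_, μ, ?_⟩
  · have h3 : eval (fun i => (Q * A) i 0) (T.form i) = 0 := by
      by_contra hne
      rw [← constantCoeff_bind₁_chartLin] at hne
      rw [h.multAt_eq p hA, mult_iterStrictTransform_eq_zero (i := i) hne] at hpos
      exact lt_irrefl 0 hpos
    rw [hw]
    refine eval_smul_eq_zero (T.form_isHomogeneous i) _ ?_
    rw [show frameCoord Q p.base = fun i => c * (Q * A) i 0 from funext (frameCoord_eq hr)]
    exact eval_smul_eq_zero (T.form_isHomogeneous i) _ h3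
  · rw [← h.mulVec_frameCoord p.base, ← Matrix.mulVec_smul]
    congr 1
    rw [hw]
    ext i
    simp [hμ]

/-- The base points in the direction `t` form a chain. -/
theorem IsNormalFrame.exists_chain (h : IsNormalFrame φ T P Q M) (t : OnePoint ℂ) {m : ℕ}
    (hm : (expand t T.disc).order = m) :
    ∃ c : ℕ → BubblePoint,
      (∀ p, InDirection Q P t p → 0 < φ.multAt p → ∃ i < m, p = c i) ∧
      (∀ i < m, φ.multAt (c i) = 1 ∧ InDirection Q P t (c i)) ∧
      (∀ i j, Proximate (c i) (c j) ↔ i = j + 1) ∧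
      ∀ i < m, (Proximate (c i) ⟨P, []⟩ ↔
        (i : ℕ∞) < (expand t T.b₁).order ∧ (i : ℕ∞) < (expand t T.a₂).order) := by
  by_cases hκ : eval (dirPt t) T.b₁ = 0 ∧ eval (dirPt t) T.a₂ = 0
  · obtain ⟨γ, hγ, hm1, hm2, hk⟩ := T.exists_chain_on t hκ.1 hκ.2 hm
    refine ⟨fun i => ⟨P, [t] ++ arcLabels i γ⟩, fun p hp hpos => ?_, fun i hi => ⟨?_, ?_⟩,
      proximate_arcLabels_iff P [t] hγ, fun i hi => ?_⟩
    · rcases hp with ⟨hb, ht⟩ | ⟨hb, l, hl⟩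
      · exfalso
        obtain ⟨w, hw, -⟩ := h.exists_of_multAt_pos hb ht hpos
        have hev : ∀ i,
            pencilTriple (dirPt t) (eval (dirPt t) T.b₂) (eval (dirPt t) T.a₃) i = 0 := by
          intro i
          have h1 := aeval_form T w (dirPt t) i
          simp only [aeval_eq_eval] at h1
          rw [hw, hκ.1, hκ.2] at h1
          simpa using h1.symm
        have hb₂ : eval (dirPt t) T.b₂ = 0 := by
          obtain ⟨j, hj⟩ := exists_dirPt_ne_zero t
          fin_cases j
          · exact (mul_eq_zero.mp (hev 0)).resolve_left hj
          · exact (mul_eq_zero.mp (hev 1)).resolve_left hj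
        exact T.no_common_zero _ (dirPt_ne_zero t) hκ.1 hb₂ hκ.2 (hev 2)
      · obtain ⟨b, ls⟩ := p
        simp only at hb hl
        subst hb hl
        rw [h.multAt_base] at hpos
        obtain ⟨j, hj, rfl⟩ := hm2 l hpos
        exact ⟨j, hj, rfl⟩
    · rw [h.multAt_base]
      exact hm1 i hi
    · exact Or.inr ⟨rfl, _, rfl⟩
    · rw [proximate_cons_arcLabels_iff P t hγ, hk i hi]
  · have hκ' : eval (dirPt t) T.b₁ ≠ 0 ∨ eval (dirPt t) T.a₂ ≠ 0 := by
      by_contra! hz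
      exact hκ hz
    obtain ⟨z, hz, hchain⟩ := T.exists_chain_off t hκ' hm
    have hw0 : M.mulVec ![z, dirPt t 0, dirPt t 1] ≠ 0 := by
      intro h0
      have h1 := congrArg Q.mulVec h0
      rw [Matrix.mulVec_mulVec, h.mul_eq_one, Matrix.one_mulVec, Matrix.mulVec_zero] at h1
      obtain ⟨j, hj⟩ := exists_dirPt_ne_zero t
      fin_cases j
      exacts [hj (congrFun h1 1), hj (congrFun h1 2)]
    set p' : ℙ ℂ (Fin 3 → ℂ) := Projectivization.mk ℂ _ hw0 with hp'
    obtain ⟨a, ha⟩ := Projectivization.exists_smul_eq_mk_rep ℂ _ hw0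
    have hrep : p'.rep = (a : ℂ) • M.mulVec ![z, dirPt t 0, dirPt t 1] := ha.symm
    have hfc : frameCoord Q p' = (a : ℂ) • ![z, dirPt t 0, dirPt t 1] := by
      rw [frameCoord, hrep, Matrix.mulVec_smul, Matrix.mulVec_mulVec, h.mul_eq_one,
        Matrix.one_mulVec]
    obtain ⟨A, hAdet, hA, c, hc, hr⟩ := exists_chartLin_eq p'
    obtain ⟨γ, hγ, hm1, hm2⟩ := hchain (Q * A) (by
      rw [Matrix.det_mul]; exact h.det_isUnit.mul hAdet) (c / a) (div_ne_zero hc a.ne_zero)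
      (fun i => by
        have h1 := frameCoord_eq (Q := Q) hr i
        rw [hfc, Pi.smul_apply, smul_eq_mul] at h1
        rw [div_mul_eq_mul_div, ← h1, mul_div_cancel_left₀ _ a.ne_zero])
    have hp'P : p' ≠ P := by
      intro hP
      have h1 := h.frameCoord_base
      rw [← hP, hfc] at h1
      obtain ⟨j, hj⟩ := exists_dirPt_ne_zero t
      fin_cases j
      exacts [mul_ne_zero a.ne_zero hj h1.1, mul_ne_zero a.ne_zero hj h1.2]
    refine ⟨fun i => ⟨p', arcLabels i γ⟩, fun p hp hpos => ?_, fun i hi => ⟨?_, ?_⟩,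
      proximate_arcLabels_iff p' [] hγ, fun i hi => ?_⟩
    · rcases hp with ⟨hb, ht⟩ | ⟨hb, l, hl⟩
      · obtain ⟨w, hw, μ, hμ⟩ := h.exists_of_multAt_pos hb ht hpos
        have hbase : p.base = p' := by
          refine eq_of_rep_eq_smul (a := μ / a) ?_
          rw [hμ, hrep, hz w hw, smul_smul, div_mul_cancel₀ _ a.ne_zero]
        obtain ⟨b, ls⟩ := p
        simp only at hbase
        subst hbase
        rw [h.multAt_eq _ hA] at hpos
        obtain ⟨j, hj, rfl⟩ := hm2 ls hpos
        exact ⟨j, hj, rfl⟩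
      · exfalso
        obtain ⟨b, ls⟩ := p
        simp only at hb hl
        subst hb hl
        rw [h.multAt_base, T.mult_double_eq_zero hκ'] at hpos
        exact lt_irrefl 0 hpos
    · rw [h.multAt_eq _ hA]
      exact hm1 i hi
    · refine Or.inl ⟨hp'P, ?_⟩
      change frameCoord Q p' 1 * _ = frameCoord Q p' 2 * _
      rw [hfc]
      simp only [Pi.smul_apply, smul_eq_mul, Matrix.cons_val]
      ring
    · refine ⟨fun hpr => absurd hpr.1 hp'P, fun ⟨h1, h2⟩ => absurd ?_ hκ⟩
      rw [← constantCoeff_expand, ← constantCoeff_expand]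
      refine ⟨PowerSeries.order_ne_zero_iff_constCoeff_eq_zero.mp ?_,
        PowerSeries.order_ne_zero_iff_constCoeff_eq_zero.mp ?_⟩
      exacts [(pos_of_gt h1).ne', (pos_of_gt h2).ne']

/-! ### Graphs made of chains -/

/-- The graph which consists of a vertex `none` of weight two and, for each `t`, of a chain of
`m t` vertices of weight one, each with an arrow to its predecessor, of which the first `k t` have
an arrow to `none`. -/
def chainGraph {α : Type} (m k : α → ℕ) : WeightedDigraph where
  Vertex := Option (Σ t, Fin (m t))
  graph :=
    { Adj := fun u v => u.elim False fun x => v.elim (x.2.val < k x.1)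
        fun y => x.1 = y.1 ∧ x.2.val = y.2.val + 1 }
  weight := fun u => u.elim 2 fun _ => 1

/-- The chains of the graphs of the list, as pairs `(m, k)`. -/
def cubicChains : Fin 21 → List (ℕ × ℕ) :=
  ![[(4, 2)], [(2, 2), (2, 0)], [(3, 2), (1, 0)], [(2, 1), (2, 1)], [(1, 1), (3, 1)], [(4, 1)],
    [(2, 2), (1, 0), (1, 0)], [(1, 1), (2, 1), (1, 0)], [(1, 1), (1, 1), (2, 0)],
    [(3, 1), (1, 0)], [(2, 1), (2, 0)], [(1, 1), (3, 0)], [(4, 0)],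
    [(1, 1), (1, 1), (1, 0), (1, 0)], [(2, 1), (1, 0), (1, 0)], [(1, 1), (1, 0), (2, 0)],
    [(2, 0), (2, 0)], [(1, 0), (3, 0)], [(1, 1), (1, 0), (1, 0), (1, 0)],
    [(1, 0), (1, 0), (2, 0)], [(1, 0), (1, 0), (1, 0), (1, 0)]]

/-- The numbering of the vertices of a graph of chains, one chain after the other. -/
def chainNumber (n : Fin 21) :
    Option (Σ i : Fin (cubicChains n).length, Fin ((cubicChains n)[i]).1) → Fin 5
  | none => 0
  | some x => Fin.ofNat 5 (1 + (((cubicChains n).take x.1).map Prod.fst).sum + x.2)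

theorem chainNumber_bijective (n : Fin 21) : Function.Bijective (chainNumber n) := by
  revert n
  unfold Function.Bijective Function.Injective Function.Surjective
  decide +kernel

theorem adj_chainNumber (n : Fin 21) :
    ∀ u v : Option (Σ i : Fin (cubicChains n).length, Fin ((cubicChains n)[i]).1),
      (u.elim False fun x => v.elim (x.2.val < ((cubicChains n)[x.1]).2)
        fun y => x.1 = y.1 ∧ x.2.val = y.2.val + 1) ↔
      (chainNumber n u, chainNumber n v) ∈ cubicArrows n := by
  have h : ∀ n (u v : Option (Σ i : Fin (cubicChains n).length, Fin ((cubicChains n)[i]).1)),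
      (u.elim false fun x => v.elim (decide (x.2.val < ((cubicChains n)[x.1]).2))
        fun y => decide (x.1 = y.1 ∧ x.2.val = y.2.val + 1)) =
      decide ((chainNumber n u, chainNumber n v) ∈ cubicArrows n) := by
    decide +kernel
  intro u v
  rw [← decide_eq_true_iff (p := _ ∈ _), ← h]
  cases u <;> cases v <;> simp

theorem chainGraph_cubicChains (n : Fin 21) :
    (chainGraph (fun i : Fin (cubicChains n).length => ((cubicChains n)[i]).1)
      (fun i => ((cubicChains n)[i]).2)).Isomorphic (cubicGraph n) := by
  refine ⟨Equiv.ofBijective _ (chainNumber_bijective n), adj_chainNumber n, fun v => ?_⟩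
  have h0 : chainNumber n none = 0 := rfl
  change _ = if chainNumber n v = 0 then 2 else 1
  rcases v with - | v
  · rfl
  · rw [if_neg]
    · rfl
    · rw [← h0]
      exact fun h => Option.some_ne_none v ((chainNumber_bijective n).injective h)

/-- Empty chains do not matter. -/
theorem chainGraph_comp {α β : Type} {m k : α → ℕ} {r : β → α} (hr : Function.Injective r)
    (h0 : ∀ t, t ∉ Set.range r → m t = 0) :
    (chainGraph (fun i => m (r i)) fun i => k (r i)).Isomorphic (chainGraph m k) := by
  let f : Option (Σ i, Fin (m (r i))) → Option (Σ t, Fin (m t)) :=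
    Option.map fun x => ⟨r x.1, x.2⟩
  have hinj : Function.Injective fun x : Σ i, Fin (m (r i)) => (⟨r x.1, x.2⟩ : Σ t, Fin (m t)) := by
    rintro ⟨i, a⟩ ⟨j, b⟩ h
    obtain ⟨h1, h2⟩ := Sigma.mk.inj h
    obtain rfl := hr h1
    exact congrArg _ (eq_of_heq h2)
  have hf : Function.Bijective f := by
    refine ⟨Option.map_injective hinj, ?_⟩
    rintro (- | ⟨t, a⟩)
    · exact ⟨none, rfl⟩
    · by_cases ht : t ∈ Set.range r
      · obtain ⟨i, rfl⟩ := ht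
        exact ⟨some ⟨i, a⟩, rfl⟩
      · exact absurd a.2 (by simp [h0 t ht])
  refine ⟨Equiv.ofBijective f hf, ?_, ?_⟩
  · rintro (- | ⟨i, a⟩) (- | ⟨j, b⟩)
    · exact Iff.rfl
    · exact Iff.rfl
    · exact Iff.rfl
    · change i = j ∧ _ ↔ r i = r j ∧ _
      rw [hr.eq_iff]
  · rintro (- | ⟨i, a⟩) <;> rfl

theorem chainGraph_isomorphic_cubicGraph {α : Type} {m k : α → ℕ} (n : Fin 21)
    {r : Fin (cubicChains n).length → α} (hr : Function.Injective r)
    (h0 : ∀ t, t ∉ Set.range r → m t = 0) (h : ∀ i, (m (r i), k (r i)) = (cubicChains n)[i]) :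
    (chainGraph m k).Isomorphic (cubicGraph n) := by
  have h1 := chainGraph_cubicChains n
  simp only [← h] at h1
  exact WeightedDigraph.setoid.iseqv.trans
    (WeightedDigraph.setoid.iseqv.symm (chainGraph_comp (m := m) (k := k) hr h0)) h1

/-- The possible chains: four vertices in all, of which at most two have arrows to the vertex of
weight two. -/
theorem exists_perm_cubicChains (p : List (ℕ × ℕ)) (h1 : ∀ x ∈ p, 1 ≤ x.1 ∧ x.2 ≤ x.1)
    (h2 : (p.map Prod.fst).sum = 4) (h3 : (p.map Prod.snd).sum ≤ 2) :
    ∃ n, (cubicChains n).Perm p := by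
  match p, h1, h2, h3 with
  | [], _, h2, _ => simp at h2
  | [(a, b)], h1, h2, h3 =>
    simp at h1 h2 h3
    subst h2
    interval_cases b <;> decide +kernel
  | [(a, b), (c, d)], h1, h2, h3 =>
    simp at h1 h2 h3
    have ha : a ≤ 3 := by omega
    have hb : b ≤ 2 := by omega
    have hd : d ≤ 2 - b := by omega
    obtain rfl : c = 4 - a := by omega
    have ha1 := h1.1.1
    interval_cases a <;> interval_cases b <;> interval_cases d <;>
      first | (exfalso; omega) | decide +kernel
  | [(a, b), (c, d), (e, f)], h1, h2, h3 =>
    simp at h1 h2 h3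
    have ha : a ≤ 2 := by omega
    have hc : c ≤ 3 - a := by omega
    have hb : b ≤ 2 := by omega
    have hd : d ≤ 2 - b := by omega
    have hf : f ≤ 2 - b - d := by omega
    obtain rfl : e = 4 - a - c := by omega
    have ha1 := h1.1.1
    have hc1 := h1.2.1.1
    interval_cases a <;> interval_cases c <;> interval_cases b <;> interval_cases d <;>
      interval_cases f <;> first | (exfalso; omega) | decide +kernel
  | [(a, b), (c, d), (e, f), (g, i)], h1, h2, h3 =>
    simp at h1 h2 h3
    obtain rfl : a = 1 := by omega
    obtain rfl : c = 1 := by omega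
    obtain rfl : e = 1 := by omega
    obtain rfl : g = 1 := by omega
    have hb : b ≤ 1 := by omega
    have hd : d ≤ 1 := by omega
    have hf : f ≤ 1 := by omega
    have hi : i ≤ 1 := by omega
    interval_cases b <;> interval_cases d <;> interval_cases f <;>
      interval_cases i <;> first | (exfalso; omega) | decide +kernel
  | (a, b) :: (c, d) :: (e, f) :: (g, i) :: (j, k) :: l, h1, h2, h3 =>
    simp at h1 h2
    omega

open Classical in
theorem exists_isomorphic_cubicGraph {α : Type} (s s' : Multiset α) (hs : s.card = 4)
    (hs' : s'.card ≤ 2) {k : α → ℕ} (hk : ∀ t, k t ≤ s.count t) (hk' : ∀ t, k t ≤ s'.count t) :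
    ∃ n, (chainGraph (fun t => s.count t) k).Isomorphic (cubicGraph n) := by
  obtain ⟨n, hn⟩ := exists_perm_cubicChains
    (s.toFinset.toList.map fun t => (s.count t, k t)) (by
      simp only [List.mem_map, Finset.mem_toList, Multiset.mem_toFinset]
      rintro _ ⟨t, ht, rfl⟩
      exact ⟨Multiset.one_le_count_iff_mem.mpr ht, hk t⟩) (by
      rw [List.map_map]
      change (s.toFinset.toList.map fun t => s.count t).sum = 4
      rw [Finset.sum_map_toList, Multiset.toFinset_sum_count_eq, hs]) (by
      rw [List.map_map]
      change (s.toFinset.toList.map fun t => k t).sum ≤ 2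
      rw [Finset.sum_map_toList]
      refine le_trans ?_ hs'
      calc ∑ t ∈ s.toFinset, k t ≤ ∑ t ∈ s.toFinset, s'.count t :=
          Finset.sum_le_sum fun t _ => hk' t
        _ ≤ ∑ t ∈ s.toFinset ∪ s'.toFinset, s'.count t :=
          Finset.sum_le_sum_of_subset Finset.subset_union_left
        _ = s'.card := Multiset.sum_count_eq_card fun t ht =>
          Finset.mem_union_right _ (Multiset.mem_toFinset.mpr ht))
  obtain ⟨d, hd, hdp⟩ := List.perm_comp_forall₂ (r := fun x t => (s.count t, k t) = x) hn
    (List.forall₂_map_left_iff.mpr (List.forall₂_same.mpr fun _ _ => rfl))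
  refine ⟨n, chainGraph_isomorphic_cubicGraph n
    (r := fun i => d[i.val]'(hd.length_eq ▸ i.2)) ?_ ?_ ?_⟩
  · intro i j hij
    have hnd : d.Nodup := hdp.nodup_iff.mpr (Finset.nodup_toList _)
    exact Fin.ext ((hnd.getElem_inj_iff).mp hij)
  · intro t ht
    rw [Multiset.count_eq_zero]
    intro hts
    apply ht
    have htd : t ∈ d := hdp.mem_iff.mpr (Finset.mem_toList.mpr (Multiset.mem_toFinset.mpr hts))
    obtain ⟨i, hi, rfl⟩ := List.mem_iff_getElem.mp htd
    exact ⟨⟨i, hd.length_eq ▸ hi⟩, rfl⟩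
  · intro i
    exact (List.forall₂_iff_get.mp hd).2 i i.2 (hd.length_eq ▸ i.2)

/-! ### The proximity graph of a map in normal form -/

/-- The base points are the double point and the chains in all directions. -/
theorem IsNormalFrame.proximityGraph_isomorphic {φ : PlaneCremonaMap} {T : CubicData}
    {P : ℙ ℂ (Fin 3 → ℂ)} {Q M : Matrix (Fin 3) (Fin 3) ℂ} (h : IsNormalFrame φ T P Q M)
    {m k : OnePoint ℂ → ℕ} (hm : ∀ t, (expand t T.disc).order = m t)
    (hk : ∀ t, ∀ i < m t, (i < k t ↔
      (i : ℕ∞) < (expand t T.b₁).order ∧ (i : ℕ∞) < (expand t T.a₂).order)) :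
    φ.proximityGraph.Isomorphic (chainGraph m k) := by
  choose c hc1 hc2 hc3 hc4 using fun t => h.exists_chain t (hm t)
  have hv0 : φ.IsBasePoint ⟨P, []⟩ := by
    rw [PlaneCremonaMap.IsBasePoint, h.multAt_double]; exact two_pos
  have hv : ∀ t (i : Fin (m t)), φ.IsBasePoint (c t i) := fun t i => by
    rw [PlaneCremonaMap.IsBasePoint, (hc2 t i i.2).1]; exact one_pos
  have hne : ∀ t (i : Fin (m t)), c t i ≠ ⟨P, []⟩ := fun t i he => by
    have := (hc2 t i i.2).1
    rw [he, h.multAt_double] at this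
    exact absurd this (by norm_num)
  let f : Option (Σ t, Fin (m t)) → {p : BubblePoint // φ.IsBasePoint p} := fun u =>
    u.elim ⟨⟨P, []⟩, hv0⟩ fun x => ⟨c x.1 x.2, hv x.1 x.2⟩
  have hf : Function.Bijective f := by
    constructor
    · rintro (- | ⟨t, i⟩) (- | ⟨t', j⟩) he
      · rfl
      · exact absurd (Subtype.ext_iff.mp he).symm (hne t' j)
      · exact absurd (Subtype.ext_iff.mp he) (hne t i)
      · have he' : c t i = c t' j := Subtype.ext_iff.mp he
        have h1 := (hc2 t i i.2).2
        rw [he'] at h1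
        obtain rfl := h.inDirection_unique h1 (hc2 t' j j.2).2
        have h2 := (hc3 t (i + 1) i).mpr rfl
        rw [he', hc3] at h2
        rw [Fin.ext (Nat.succ.inj h2)]
    · rintro ⟨p, hp⟩
      by_cases hpP : p = ⟨P, []⟩
      · exact ⟨none, Subtype.ext hpP.symm⟩
      · obtain ⟨t, ht⟩ := exists_inDirection (Q := Q) hpP
        obtain ⟨i, hi, he⟩ := hc1 t p ht hp
        exact ⟨some ⟨t, i, hi⟩, Subtype.ext he.symm⟩
  refine WeightedDigraph.setoid.iseqv.symm ⟨Equiv.ofBijective f hf, ?_, ?_⟩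
  · have hbase : ∀ q, ¬ Proximate ⟨P, []⟩ q := by
      rintro q ⟨-, t, l, hl, -⟩
      simp at hl
    rintro (- | ⟨t, i⟩) (- | ⟨t', j⟩)
    · exact iff_of_false id (hbase _)
    · exact iff_of_false id (hbase _)
    · change i.val < k t ↔ Proximate (c t i) ⟨P, []⟩
      rw [hc4 t i i.2, hk t i i.2]
    · change t = t' ∧ i.val = j.val + 1 ↔ Proximate (c t i) (c t' j)
      constructor
      · rintro ⟨rfl, hij⟩
        exact (hc3 t i j).mpr hij
      · intro hp
        obtain rfl := h.inDirection_unique ((hc2 t' j j.2).2.of_proximate hp) (hc2 t i i.2).2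
        exact ⟨rfl, (hc3 _ i j).mp hp⟩
  · rintro (- | ⟨t, i⟩)
    · exact h.multAt_double.symm
    · exact (hc2 t i i.2).1.symm

theorem CubicData.disc_isHomogeneous (T : CubicData) : T.disc.IsHomogeneous 4 :=
  (T.hb₁.mul T.ha₃).sub (T.hb₂.mul T.ha₂)

/-- The proximity graph of a cubic map is in the list. -/
theorem exists_isomorphic_of_degree_eq_three (φ : PlaneCremonaMap) (hφ : φ.degree = 3) :
    ∃ n, φ.proximityGraph.Isomorphic (cubicGraph n) := by
  classical
  obtain ⟨T, P, Q, M, h⟩ := exists_isNormalFrame φ hφ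
  obtain ⟨s, hs, hsd⟩ := exists_roots 4 T.disc_isHomogeneous T.disc_ne_zero
  -- the linear form `b₁` or the quadratic form `a₂` bounds the number of points proximate to `P`
  obtain ⟨s', hs', hsd'⟩ : ∃ s' : Multiset (OnePoint ℂ), s'.card ≤ 2 ∧
      ∀ t, min (expand t T.b₁).order (expand t T.a₂).order ≤ s'.count t := by
    by_cases hb : T.b₁ = 0
    · have ha : T.a₂ ≠ 0 := fun ha => T.disc_ne_zero (by rw [hb, ha]; ring)
      obtain ⟨s', hs', h'⟩ := exists_roots 2 T.ha₂ ha
      exact ⟨s', hs'.le, fun t => by rw [← h']; exact min_le_right _ _⟩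
    · obtain ⟨s', hs', h'⟩ := exists_roots 1 T.hb₁ hb
      exact ⟨s', by omega, fun t => by rw [← h']; exact min_le_left _ _⟩
  let κ : OnePoint ℂ → ℕ∞ := fun t => min (expand t T.b₁).order (expand t T.a₂).order
  have hκ : ∀ t, κ t ≠ ⊤ := fun t ht => by
    have := hsd' t
    rw [show min _ _ = κ t from rfl, ht, top_le_iff] at this
    exact ENat.natCast_ne_top _ this
  have hκ' : ∀ t, ((κ t).toNat : ℕ∞) = κ t := fun t => ENat.natCast_toNat (hκ t)
  obtain ⟨n, hn⟩ := exists_isomorphic_cubicGraph s s' hs hs'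
    (k := fun t => min (s.count t) (κ t).toNat) (fun t => min_le_left _ _) (fun t => by
      refine (min_le_right _ _).trans ?_
      have := hsd' t
      rw [show min _ _ = κ t from rfl, ← hκ'] at this
      exact_mod_cast this)
  refine ⟨n, WeightedDigraph.setoid.iseqv.trans
    (h.proximityGraph_isomorphic hsd fun t i hi => ?_) hn⟩
  rw [lt_min_iff, ← lt_min_iff (a := (i : ℕ∞)), show min _ _ = κ t from rfl, ← hκ' t,
    Nat.cast_lt]
  exact and_iff_right hi

/-! ### Construction of cubic maps -/

theorem CubicData.finSuccEquiv_conic (T : CubicData) :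
    finSuccEquiv ℂ 2 T.conic = Polynomial.X * Polynomial.C T.b₁ + Polynomial.C T.b₂ := by
  rw [CubicData.conic, map_add, map_mul, finSuccEquiv_X_zero, finSuccEquiv_bin, finSuccEquiv_bin]

theorem CubicData.finSuccEquiv_cubic (T : CubicData) :
    finSuccEquiv ℂ 2 T.cubic = Polynomial.X * Polynomial.C T.a₂ + Polynomial.C T.a₃ := by
  rw [CubicData.cubic, map_add, map_mul, finSuccEquiv_X_zero, finSuccEquiv_bin, finSuccEquiv_bin]

theorem dirForm_dirPt (t : OnePoint ℂ) : eval (dirPt t) (dirForm t) = 0 := by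
  induction t using OnePoint.rec <;> simp [dirForm, dirPt]

/-- A common factor `q` of the net divides `x * disc`, by elimination of `w`, so that it is a binary
form; a root of it is a common root of `b₁`, `b₂`, `a₂`, `a₃`. -/
theorem CubicData.no_common_factor (T : CubicData) (q : MvPolynomial (Fin 3) ℂ)
    (hq : ∀ i, q ∣ T.form i) : IsUnit q := by
  have hE : ∀ j : Fin 2, finSuccEquiv ℂ 2 q ∣ Polynomial.C (X j) *
      (Polynomial.X * Polynomial.C T.b₁ + Polynomial.C T.b₂) := by
    intro j
    have h1 : q ∣ X j.succ * T.conic := by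
      fin_cases j
      exacts [hq 0, hq 1]
    have := map_dvd (finSuccEquiv ℂ 2) h1
    rwa [map_mul, finSuccEquiv_X_succ, T.finSuccEquiv_conic] at this
  have hD : finSuccEquiv ℂ 2 q ∣ Polynomial.X * Polynomial.C T.a₂ + Polynomial.C T.a₃ := by
    rw [← T.finSuccEquiv_cubic]
    exact map_dvd _ (hq 2)
  have hΔ : finSuccEquiv ℂ 2 q ∣ Polynomial.C (X 0 * T.disc) := by
    have := dvd_sub (hD.mul_left (Polynomial.C (X 0 * T.b₁))) ((hE 0).mul_left (Polynomial.C T.a₂))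
    convert this using 1
    simp only [CubicData.disc, map_mul, map_sub]
    ring
  have h0 : (X 0 : MvPolynomial (Fin 2) ℂ) * T.disc ≠ 0 := mul_ne_zero (X_ne_zero _) T.disc_ne_zero
  have hdeg : (finSuccEquiv ℂ 2 q).natDegree = 0 := by
    have := Polynomial.natDegree_le_of_dvd hΔ (Polynomial.C_ne_zero.mpr h0)
    rwa [Polynomial.natDegree_C, Nat.le_zero] at this
  obtain ⟨r, hr⟩ := Polynomial.natDegree_eq_zero.mp hdeg
  rw [← hr] at hE hD hΔ
  have hΔ' : r ∣ X 0 * T.disc := by simpa using (Polynomial.C_dvd_iff_dvd_coeff _ _).mp hΔ 0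
  have hb₁ : ∀ j, r ∣ X j * T.b₁ := fun j => by
    simpa using (Polynomial.C_dvd_iff_dvd_coeff _ _).mp (hE j) 1
  have hb₂ : ∀ j, r ∣ X j * T.b₂ := fun j => by
    simpa using (Polynomial.C_dvd_iff_dvd_coeff _ _).mp (hE j) 0
  have ha₂ : r ∣ T.a₂ := by
    simpa using (Polynomial.C_dvd_iff_dvd_coeff _ _).mp hD 1
  have ha₃ : r ∣ T.a₃ := by
    simpa using (Polynomial.C_dvd_iff_dvd_coeff _ _).mp hD 0
  obtain ⟨r', hr'⟩ := hΔ'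
  obtain ⟨a, b, -, hra, -⟩ := IsHomogeneous.factor
    (hr' ▸ (isHomogeneous_X ℂ (0 : Fin 2)).mul T.disc_isHomogeneous) (hr' ▸ h0)
  cases a with
  | zero =>
    rw [totalDegree_eq_zero_iff_eq_C.mp ((totalDegree_zero_iff_isHomogeneous ..).mpr hra)] at hr hr'
    have hu : IsUnit (finSuccEquiv ℂ 2 q) := by
      rw [← hr]
      refine Polynomial.isUnit_C.mpr (IsUnit.map C (isUnit_iff_ne_zero.mpr fun hz => h0 ?_))
      rw [hr', hz, C_0, zero_mul]
    exact (MulEquiv.isUnit_map (finSuccEquiv ℂ 2)).mp hu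
  | succ a =>
    obtain ⟨t, ht⟩ := exists_dirForm_dvd hra
    have hev : ∀ {p}, r ∣ p → eval (dirPt t) p = 0 := fun hp => by
      obtain ⟨p', rfl⟩ := ht.trans hp
      rw [map_mul, dirForm_dirPt, zero_mul]
    obtain ⟨j, hj⟩ := exists_dirPt_ne_zero t
    have h1 := hev (hb₁ j)
    have h2 := hev (hb₂ j)
    rw [map_mul, eval_X] at h1 h2
    exact absurd (hev ha₃) (T.no_common_zero _ (dirPt_ne_zero t)
      ((mul_eq_zero.mp h1).resolve_left hj)
      ((mul_eq_zero.mp h2).resolve_left hj) (hev ha₂))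

theorem CubicData.conic_ne_zero (T : CubicData) : T.conic ≠ 0 := fun h => by
  have h1 := T.finSuccEquiv_conic
  rw [h, map_zero] at h1
  have h2 := congrArg (fun p => p.coeff 0) h1
  have h3 := congrArg (fun p => p.coeff 1) h1
  simp at h2 h3
  exact T.disc_ne_zero (by rw [← h2, ← h3]; ring)

/-- Binary forms in the first two homogeneous coordinates of the target plane. -/
noncomputable abbrev binTarget : MvPolynomial (Fin 2) ℂ →ₐ[ℂ] MvPolynomial (Fin 3) ℂ :=
  rename Fin.castSucc

/-- The inverse of the map in normal form: the image of `(w, x, y)` is `(X, Y, W)` with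
`x : y = X : Y` and `W C = D`, which is linear in `w`. -/
noncomputable def CubicData.inverseForm (T : CubicData) : Triple :=
  ![X 2 * binTarget T.b₂ - binTarget T.a₃, X 0 * (binTarget T.a₂ - X 2 * binTarget T.b₁),
    X 1 * (binTarget T.a₂ - X 2 * binTarget T.b₁)]

theorem CubicData.inverseForm_isHomogeneous (T : CubicData) (i : Fin 3) :
    (T.inverseForm i).IsHomogeneous 3 := by
  have h1 : (binTarget T.a₂ - X 2 * binTarget T.b₁).IsHomogeneous 2 :=
    T.ha₂.rename_isHomogeneous.sub ((isHomogeneous_X ℂ (2 : Fin 3)).mul T.hb₁.rename_isHomogeneous)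
  fin_cases i
  · exact ((isHomogeneous_X ℂ (2 : Fin 3)).mul T.hb₂.rename_isHomogeneous).sub
      T.ha₃.rename_isHomogeneous
  · exact (isHomogeneous_X ℂ (0 : Fin 3)).mul h1
  · exact (isHomogeneous_X ℂ (1 : Fin 3)).mul h1

theorem CubicData.inverseForm_factor_ne_zero (T : CubicData) :
    binTarget T.a₂ - X 2 * binTarget T.b₁ ≠ 0 := fun h => by
  have hb : ∀ (c : MvPolynomial (Fin 2) ℂ) q, aeval ![X 0, X 1, c] (binTarget q) = q := by
    intro c q
    rw [binTarget, aeval_rename]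
    conv_rhs => rw [← aeval_X_left_apply q]
    congr 2
    ext1 j
    fin_cases j <;> rfl
  have h0 := congrArg (aeval ![X 0, X 1, (0 : MvPolynomial (Fin 2) ℂ)]) h
  have h1 := congrArg (aeval ![X 0, X 1, (1 : MvPolynomial (Fin 2) ℂ)]) h
  simp only [map_sub, map_mul, hb, aeval_X, map_zero, Matrix.cons_val, zero_mul, sub_zero,
    one_mul] at h0 h1
  rw [h0, zero_sub, neg_eq_zero] at h1
  exact T.disc_ne_zero (by rw [h0, h1]; ring)

theorem rename_eq_aeval {σ τ : Type*} (f : σ → τ) (q : MvPolynomial σ ℂ) :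
    rename f q = aeval (fun j => (X (f j) : MvPolynomial τ ℂ)) q := by
  conv_lhs => rw [← aeval_X_left_apply q]
  rw [comp_aeval_apply]
  simp only [rename_X]

theorem CubicData.compIsId_inverse (T : CubicData) : CompIsId T.inverseForm T.form := by
  refine ⟨-(T.conic ^ 2 * bin T.disc), neg_ne_zero.mpr (mul_ne_zero (pow_ne_zero 2 T.conic_ne_zero)
    ?_), fun i => ?_⟩
  · exact (map_ne_zero_iff _ (rename_injective _ (Fin.succ_injective 2))).mpr T.disc_ne_zero
  · have hb : ∀ {q : MvPolynomial (Fin 2) ℂ} {n : ℕ}, q.IsHomogeneous n →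
        bind₁ T.form (binTarget q) = T.conic ^ n * bin q := by
      intro q n hq
      rw [bind₁, binTarget, aeval_rename, rename_eq_aeval, ← IsHomogeneous.aeval_smul hq]
      congr 2
      ext1 j
      fin_cases j
      · exact mul_comm _ _
      · exact mul_comm _ _
    have hf0 : T.form 0 = X 1 * T.conic := rfl
    have hf1 : T.form 1 = X 2 * T.conic := rfl
    have hf2 : T.form 2 = T.cubic := rfl
    have hc : T.conic = X 0 * bin T.b₁ + bin T.b₂ := rfl
    have hd : T.cubic = X 0 * bin T.a₂ + bin T.a₃ := rfl
    have hΔ : bin T.disc = bin T.b₁ * bin T.a₃ - bin T.b₂ * bin T.a₂ := by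
      rw [CubicData.disc, map_sub, map_mul, map_mul]
    have key1 : T.cubic * bin T.b₂ - T.conic * bin T.a₃ = -(X 0 * bin T.disc) := by
      rw [hc, hd, hΔ]; ring
    have key2 : T.conic * bin T.a₂ - T.cubic * bin T.b₁ = -bin T.disc := by
      rw [hc, hd, hΔ]; ring
    fin_cases i
    · simp only [inverseForm, Fin.zero_eta, Matrix.cons_val, map_sub, map_mul, bind₁_X_right,
        hb T.hb₂, hb T.ha₃, hf2]
      linear_combination T.conic ^ 2 * key1
    · simp only [inverseForm, Fin.mk_one, Matrix.cons_val, map_sub, map_mul, bind₁_X_right,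
        hb T.hb₁, hb T.ha₂, hf2, hf0]
      linear_combination X 1 * T.conic ^ 2 * key2
    · simp only [inverseForm, Fin.reduceFinMk, Matrix.cons_val, map_sub, map_mul, bind₁_X_right,
        hb T.hb₁, hb T.ha₂, hf2, hf1]
      linear_combination X 2 * T.conic ^ 2 * key2

theorem CubicData.inverse_compIsId (T : CubicData) : CompIsId T.form T.inverseForm := by
  set E := binTarget T.a₂ - X 2 * binTarget T.b₁ with hE
  refine ⟨-(E ^ 2 * binTarget T.disc), neg_ne_zero.mpr (mul_ne_zero (pow_ne_zero 2
    T.inverseForm_factor_ne_zero) ?_), fun i => ?_⟩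
  · exact (map_ne_zero_iff _ (rename_injective _ (Fin.castSucc_injective 2))).mpr T.disc_ne_zero
  · have hb : ∀ {q : MvPolynomial (Fin 2) ℂ} {n : ℕ}, q.IsHomogeneous n →
        bind₁ T.inverseForm (bin q) = E ^ n * binTarget q := by
      intro q n hq
      rw [bind₁_bin, rename_eq_aeval, ← IsHomogeneous.aeval_smul hq]
      congr 2
      ext1 j
      fin_cases j
      · exact mul_comm _ _
      · exact mul_comm _ _
    have hf0 : T.inverseForm 0 = X 2 * binTarget T.b₂ - binTarget T.a₃ := rfl
    have hf1 : T.inverseForm 1 = X 0 * E := rfl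
    have hf2 : T.inverseForm 2 = X 1 * E := rfl
    have hΔ : binTarget T.disc = binTarget T.b₁ * binTarget T.a₃ -
        binTarget T.b₂ * binTarget T.a₂ := by
      rw [CubicData.disc, map_sub, map_mul, map_mul]
    fin_cases i
    · simp only [form, conic, Fin.zero_eta, Matrix.cons_val, map_add, map_mul, bind₁_X_right,
        hb T.hb₁, hb T.hb₂, hf0, hf1, hΔ]
      linear_combination X 0 * E ^ 2 * binTarget T.b₂ * hE
    · simp only [form, conic, Fin.mk_one, Matrix.cons_val, map_add, map_mul, bind₁_X_right,
        hb T.hb₁, hb T.hb₂, hf0, hf2, hΔ]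
      linear_combination X 1 * E ^ 2 * binTarget T.b₂ * hE
    · simp only [form, cubic, Fin.reduceFinMk, Matrix.cons_val, map_add, map_mul, bind₁_X_right,
        hb T.ha₂, hb T.ha₃, hf0, hΔ]
      linear_combination E ^ 2 * binTarget T.a₃ * hE

/-- The cubic plane Cremona map with a given normal form. -/
noncomputable def CubicData.toMap (T : CubicData) : PlaneCremonaMap where
  degree := 3
  form := T.form
  isHomogeneous := T.form_isHomogeneous
  no_common_factor := T.no_common_factor
  birational := ⟨3, T.inverseForm, T.inverseForm_isHomogeneous, T.compIsId_inverse,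
    T.inverse_compIsId⟩

theorem CubicData.exists_isNormalFrame_toMap (T : CubicData) :
    ∃ P, IsNormalFrame T.toMap T P 1 1 := by
  have hv : (![1, 0, 0] : Fin 3 → ℂ) ≠ 0 := fun h => one_ne_zero (congrFun h 0)
  obtain ⟨a, ha⟩ := Projectivization.exists_smul_eq_mk_rep ℂ _ hv
  have hr : ∀ i, (Projectivization.mk ℂ _ hv).rep i = a * (1 : Matrix (Fin 3) (Fin 3) ℂ) i 0 := by
    intro i
    rw [← ha, Pi.smul_apply, Units.smul_def, smul_eq_mul]
    fin_cases i <;> simp [Matrix.one_apply]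
  refine ⟨Projectivization.mk ℂ _ hv, one_mul 1, ?_, ⟨a, a.ne_zero, hr⟩, 1, by simp, fun i => ?_⟩
  · have h1 : (Projectivization.mk ℂ _ hv).rep 1 = 0 := by rw [hr]; simp
    have h2 : (Projectivization.mk ℂ _ hv).rep 2 = 0 := by rw [hr]; simp
    ext1 i
    simp only [affineChart, h1, h2, ne_eq, not_true_eq_false, if_false]
    fin_cases i <;> simp [chartLin, Matrix.one_apply]
  · rw [linSub_one]
    have h1 : ∀ p : MvPolynomial (Fin 3) ℂ, bind₁ X p = p := fun p => by rw [bind₁_X_left]; rfl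
    simp only [h1, Matrix.one_apply]
    simp [CubicData.toMap]

theorem prod_dirForm_isHomogeneous (s : Multiset (OnePoint ℂ)) :
    (s.map dirForm).prod.IsHomogeneous s.card := by
  induction s using Multiset.induction with
  | empty => exact isHomogeneous_one _ _
  | cons t s ih =>
    rw [Multiset.map_cons, Multiset.prod_cons, Multiset.card_cons, add_comm]
    exact (dirForm_isHomogeneous t).mul ih

theorem prod_dirForm_ne_zero (s : Multiset (OnePoint ℂ)) : (s.map dirForm).prod ≠ 0 := by
  rw [Ne, Multiset.prod_eq_zero_iff, Multiset.mem_map]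
  rintro ⟨t, -, ht⟩
  exact dirForm_ne_zero t ht

theorem eval_prod_dirForm_ne_zero {s : Multiset (OnePoint ℂ)} (hs : OnePoint.infty ∉ s)
    {v : Fin 2 → ℂ} (hv : v ≠ 0) (h0 : v 0 = 0) : eval v (s.map dirForm).prod ≠ 0 := by
  rw [map_multiset_prod, Ne, Multiset.prod_eq_zero_iff]
  simp only [Multiset.mem_map]
  rintro ⟨_, ⟨t, ht, rfl⟩, h⟩
  induction t using OnePoint.rec with
  | infty => exact hs ht
  | coe s =>
    apply hv
    ext j
    fin_cases j
    · exact h0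
    · simpa [dirForm, h0] using h

open Classical in
/-- For any four directions `U + V`, of which at most two are in `U`, there is a net whose simple base
points lie in the directions `U + V`, and for which those in the directions `U` are proximate to the
double point.  The shape of the forms depends on the number of elements of `U`, which is the degree
of the greatest common divisor of `b₁` and `a₂`. -/
theorem exists_cubicData_of_multiset (U V : Multiset (OnePoint ℂ)) (hcard : (U + V).card = 4)
    (hU : U.card ≤ 2) (hinf : OnePoint.infty ∉ U + V) :
    ∃ T : CubicData, (∀ t, (expand t T.disc).order = (U + V).count t) ∧
      ∀ t, min (expand t T.b₁).order (expand t T.a₂).order = U.count t := by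
  rw [Multiset.card_add] at hcard
  have hV : OnePoint.infty ∉ V := fun h => hinf (Multiset.mem_add.mpr (Or.inr h))
  have hU' : OnePoint.infty ∉ U := fun h => hinf (Multiset.mem_add.mpr (Or.inl h))
  have hUV : ∀ t, (expand t ((U.map dirForm).prod * (V.map dirForm).prod)).order =
      (U + V).count t := fun t => by
    rw [map_mul, PowerSeries.order_mul, order_expand_prod, order_expand_prod, Multiset.count_add,
      Nat.cast_add]
  have hne := mul_ne_zero (prod_dirForm_ne_zero U) (prod_dirForm_ne_zero V)
  obtain hU2 | hU1 | hU0 : U.card = 2 ∨ U.card = 1 ∨ U.card = 0 := by omega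
  · have hd : 0 * X 0 ^ 3 - -(V.map dirForm).prod * (U.map dirForm).prod =
        (U.map dirForm).prod * (V.map dirForm).prod := by ring
    refine ⟨⟨0, -(V.map dirForm).prod, (U.map dirForm).prod, X 0 ^ 3, isHomogeneous_zero _ _ _, ?_,
      ?_, ?_, by rwa [hd], ?_⟩, fun t => ?_, fun t => ?_⟩
    · have := prod_dirForm_isHomogeneous V
      rw [show V.card = 2 by omega] at this
      exact this.neg
    · have := prod_dirForm_isHomogeneous U
      rwa [hU2] at this
    · simpa using (isHomogeneous_X ℂ (0 : Fin 2)).pow 3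
    · intro v hv _ _ h h3
      refine eval_prod_dirForm_ne_zero hU' hv ?_ h
      simpa using h3
    · exact (congrArg (fun p => (expand t p).order) hd).trans (hUV t)
    · simp [order_expand_prod]
  · have hd : (U.map dirForm).prod * (V.map dirForm).prod - X 0 ^ 2 * 0 =
        (U.map dirForm).prod * (V.map dirForm).prod := by ring
    refine ⟨⟨(U.map dirForm).prod, X 0 ^ 2, 0, (V.map dirForm).prod, ?_, ?_,
      isHomogeneous_zero _ _ _, ?_, by rwa [hd], ?_⟩, fun t => ?_, fun t => ?_⟩
    · have := prod_dirForm_isHomogeneous U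
      rwa [hU1] at this
    · simpa using (isHomogeneous_X ℂ (0 : Fin 2)).pow 2
    · have := prod_dirForm_isHomogeneous V
      rwa [show V.card = 3 by omega] at this
    · intro v hv _ h _
      exact eval_prod_dirForm_ne_zero hV hv (by simpa using h)
    · exact (congrArg (fun p => (expand t p).order) hd).trans (hUV t)
    · simp [order_expand_prod]
  · have hV4 : V.card = 4 := by omega
    rw [Multiset.card_eq_zero] at hU0
    subst hU0
    obtain ⟨t₀, W, rfl⟩ : ∃ t₀ W, V = t₀ ::ₘ W := by
      obtain ⟨t₀, ht₀⟩ := Multiset.card_pos_iff_exists_mem.mp (show 0 < V.card by omega)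
      obtain ⟨W, hW⟩ := Multiset.exists_cons_of_mem ht₀
      exact ⟨t₀, W, hW⟩
    have ht₀ : t₀ ≠ OnePoint.infty := fun h => hV (by simp [h])
    have hd : dirForm t₀ * (W.map dirForm).prod - 0 * dirForm OnePoint.infty ^ 2 =
        ((0 : Multiset (OnePoint ℂ)).map dirForm).prod * ((t₀ ::ₘ W).map dirForm).prod := by
      rw [Multiset.map_zero, Multiset.prod_zero, Multiset.map_cons, Multiset.prod_cons]; ring
    refine ⟨⟨dirForm t₀, 0, dirForm OnePoint.infty ^ 2, (W.map dirForm).prod,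
      dirForm_isHomogeneous _, isHomogeneous_zero _ _ _, ?_, ?_, by rwa [hd], ?_⟩, fun t => ?_,
      fun t => ?_⟩
    · simpa using (dirForm_isHomogeneous OnePoint.infty).pow 2
    · have := prod_dirForm_isHomogeneous W
      rw [Multiset.card_cons] at hV4
      rwa [show W.card = 3 by omega] at this
    · intro v hv h1 _ h2
      have h0 : v 0 = 0 := by simpa [dirForm] using h2
      have := eval_prod_dirForm_ne_zero (s := {t₀}) (by simpa using ht₀.symm) hv h0
      exact absurd h1 (by simpa using this)
    · exact (congrArg (fun p => (expand t p).order) hd).trans (hUV t)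
    · rw [map_pow, PowerSeries.order_pow, order_expand_dirForm, order_expand_dirForm]
      by_cases h : t = OnePoint.infty
      · subst h
        simp [ht₀.symm]
      · simp [h]

theorem cubicChains_sum (n : Fin 21) :
    ∑ i : Fin (cubicChains n).length, ((cubicChains n)[i]).2 +
      ∑ i : Fin (cubicChains n).length, (((cubicChains n)[i]).1 - ((cubicChains n)[i]).2) = 4 ∧
    ∑ i : Fin (cubicChains n).length, ((cubicChains n)[i]).2 ≤ 2 ∧
    ∀ i : Fin (cubicChains n).length, ((cubicChains n)[i]).2 ≤ ((cubicChains n)[i]).1 := by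
  revert n
  decide +kernel

/-- Each graph of the list is realized by a cubic map. -/
theorem exists_map_isomorphic_cubicGraph (n : Fin 21) :
    ∃ φ : PlaneCremonaMap, φ.degree = 3 ∧ φ.proximityGraph.Isomorphic (cubicGraph n) := by
  classical
  let r : Fin (cubicChains n).length → OnePoint ℂ := fun i => ((i.val : ℂ) : OnePoint ℂ)
  have hr : Function.Injective r := fun i j hij =>
    Fin.ext (Nat.cast_injective (OnePoint.coe_injective hij))
  let mset : (Fin (cubicChains n).length → ℕ) → Multiset (OnePoint ℂ) := fun a =>
    ∑ i, Multiset.replicate (a i) (r i)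
  have hcard : ∀ a, (mset a).card = ∑ i, a i := fun a => by simp [mset]
  have hcount : ∀ a t, (mset a).count t = ∑ i, if t = r i then a i else 0 := fun a t => by
    simp [mset, Multiset.count_sum', Multiset.count_replicate, eq_comm]
  have hcountr : ∀ a i, (mset a).count (r i) = a i := fun a i => by
    simp [hcount, hr.eq_iff]
  have hcount0 : ∀ a t, t ∉ Set.range r → (mset a).count t = 0 := fun a t ht => by
    rw [hcount]
    refine Finset.sum_eq_zero fun i _ => if_neg fun h => ht ⟨i, h.symm⟩
  obtain ⟨hs1, hs2, hs3⟩ := cubicChains_sum n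
  obtain ⟨T, hT1, hT2⟩ := exists_cubicData_of_multiset (mset fun i => ((cubicChains n)[i]).2)
    (mset fun i => ((cubicChains n)[i]).1 - ((cubicChains n)[i]).2)
    (by rw [Multiset.card_add, hcard, hcard]; exact hs1) (by rw [hcard]; exact hs2)
    (by
      rw [← Multiset.count_eq_zero, Multiset.count_add, hcount0, hcount0] <;>
      · rintro ⟨i, hi⟩
        exact OnePoint.coe_ne_infty _ hi)
  obtain ⟨P, hP⟩ := T.exists_isNormalFrame_toMap
  refine ⟨T.toMap, rfl, WeightedDigraph.setoid.iseqv.trans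
    (hP.proximityGraph_isomorphic hT1 (k := fun t => (mset fun i => ((cubicChains n)[i]).2).count t)
      fun t i _ => ?_)
    (chainGraph_isomorphic_cubicGraph n hr (fun t ht => ?_) fun i => ?_)⟩
  · rw [← lt_min_iff, hT2, Nat.cast_lt]
  · rw [Multiset.count_add, hcount0 _ t ht, hcount0 _ t ht]
  · rw [Multiset.count_add, hcountr, hcountr, Nat.add_sub_cancel' (hs3 i)]

/-! ### The 21 graphs are not isomorphic -/

/-- The numbers of arrows, of arrows to a vertex of weight two, of paths of length two, of such
paths to a vertex of weight two, and of transitive triangles. -/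
noncomputable def WeightedDigraph.counts (G : WeightedDigraph) : List ℕ :=
  [Nat.card {x : G.Vertex × G.Vertex // G.graph.Adj x.1 x.2},
    Nat.card {x : G.Vertex × G.Vertex // G.graph.Adj x.1 x.2 ∧ G.weight x.2 = 2},
    Nat.card {x : G.Vertex × G.Vertex × G.Vertex // G.graph.Adj x.1 x.2.1 ∧
      G.graph.Adj x.2.1 x.2.2},
    Nat.card {x : G.Vertex × G.Vertex × G.Vertex // G.graph.Adj x.1 x.2.1 ∧
      G.graph.Adj x.2.1 x.2.2 ∧ G.weight x.2.2 = 2},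
    Nat.card {x : G.Vertex × G.Vertex × G.Vertex // G.graph.Adj x.1 x.2.1 ∧
      G.graph.Adj x.2.1 x.2.2 ∧ G.graph.Adj x.1 x.2.2}]

theorem WeightedDigraph.Isomorphic.counts_eq {G H : WeightedDigraph} (h : G.Isomorphic H) :
    G.counts = H.counts := by
  obtain ⟨e, ha, hw⟩ := h
  let e2 := e.prodCongr e
  let e3 := e.prodCongr e2
  have h2 : ∀ {p : G.Vertex × G.Vertex → Prop} {q : H.Vertex × H.Vertex → Prop},
      (∀ x, p x ↔ q (e2 x)) → Nat.card {x // p x} = Nat.card {x // q x} := fun hpq =>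
    Nat.card_congr (e2.subtypeEquiv hpq)
  have h3 : ∀ {p : G.Vertex × G.Vertex × G.Vertex → Prop}
      {q : H.Vertex × H.Vertex × H.Vertex → Prop},
      (∀ x, p x ↔ q (e3 x)) → Nat.card {x // p x} = Nat.card {x // q x} := fun hpq =>
    Nat.card_congr (e3.subtypeEquiv hpq)
  unfold WeightedDigraph.counts
  congr 1
  · exact h2 fun x => by simp [e2, ← ha]
  congr 1
  · exact h2 fun x => by simp [e2, ← ha, ← hw]
  congr 1
  · exact h3 fun x => by simp [e3, e2, ← ha]
  congr 1
  · exact h3 fun x => by simp [e3, e2, ← ha, ← hw]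
  congr 1
  · exact h3 fun x => by simp [e3, e2, ← ha]

/-- The values of `WeightedDigraph.counts` for the graphs of the list. -/
def cubicCounts : Fin 21 → List ℕ :=
  ![[5, 2, 4, 2, 1], [4, 2, 1, 1, 1], [4, 2, 3, 2, 1], [4, 2, 2, 2, 0], [4, 2, 2, 1, 0],
    [4, 1, 3, 1, 0], [3, 2, 1, 1, 1], [3, 2, 1, 1, 0], [3, 2, 0, 0, 0], [3, 1, 2, 1, 0],
    [3, 1, 1, 1, 0], [3, 1, 1, 0, 0], [3, 0, 2, 0, 0], [2, 2, 0, 0, 0], [2, 1, 1, 1, 0],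
    [2, 1, 0, 0, 0], [2, 0, 0, 0, 0], [2, 0, 1, 0, 0], [1, 1, 0, 0, 0], [1, 0, 0, 0, 0],
    [0, 0, 0, 0, 0]]

theorem cubicGraph_counts (n : Fin 21) : (cubicGraph n).counts = cubicCounts n := by
  have h : [Fintype.card {x : Fin 5 × Fin 5 // x ∈ cubicArrows n},
      Fintype.card {x : Fin 5 × Fin 5 // x ∈ cubicArrows n ∧ (if x.2 = 0 then 2 else 1) = 2},
      Fintype.card {x : Fin 5 × Fin 5 × Fin 5 // (x.1, x.2.1) ∈ cubicArrows n ∧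
        (x.2.1, x.2.2) ∈ cubicArrows n},
      Fintype.card {x : Fin 5 × Fin 5 × Fin 5 // (x.1, x.2.1) ∈ cubicArrows n ∧
        (x.2.1, x.2.2) ∈ cubicArrows n ∧ (if x.2.2 = 0 then 2 else 1) = 2},
      Fintype.card {x : Fin 5 × Fin 5 × Fin 5 // (x.1, x.2.1) ∈ cubicArrows n ∧
        (x.2.1, x.2.2) ∈ cubicArrows n ∧ (x.1, x.2.2) ∈ cubicArrows n}] = cubicCounts n := by
    revert n
    decide +kernel
  simp only [← Nat.card_eq_fintype_card] at h
  exact h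

theorem cubicGraph_injective {n n' : Fin 21} (h : (cubicGraph n).Isomorphic (cubicGraph n')) :
    n = n' := by
  have h1 := h.counts_eq
  rw [cubicGraph_counts, cubicGraph_counts] at h1
  have h2 : ∀ n n', cubicCounts n = cubicCounts n' → n = n' := by decide +kernel
  exact h2 n n' h1

theorem card_cubicGraph (n : Fin 21) : Nat.card (cubicGraph n).Vertex = 5 ∧
    Nat.card {v : (cubicGraph n).Vertex // (cubicGraph n).weight v = 2} = 1 ∧
    Nat.card {v : (cubicGraph n).Vertex // (cubicGraph n).weight v = 1} = 4 := by
  have h1 : Fintype.card {v : Fin 5 // (if v = 0 then 2 else 1) = 2} = 1 := by decide +kernel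
  have h2 : Fintype.card {v : Fin 5 // (if v = 0 then 2 else 1) = 1} = 4 := by decide +kernel
  rw [← Nat.card_eq_fintype_card] at h1 h2
  exact ⟨Nat.card_fin 5, h1, h2⟩

end Cremona

theorem theorem6 :
    -- there are exactly 21 isomorphism classes
    Cremona.cubicGraphClasses.ncard = 21 ∧
    -- the weighted proximity graph of each cubic map is in the list, at exactly one place
    (∀ φ : Cremona.PlaneCremonaMap, φ.degree = 3 →
      ∃! n : Fin 21, φ.proximityGraph.Isomorphic (Cremona.cubicGraph n)) ∧
    -- each graph of the list is the weighted proximity graph of a cubic map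
    (∀ n : Fin 21, ∃ φ : Cremona.PlaneCremonaMap, φ.degree = 3 ∧
      φ.proximityGraph.Isomorphic (Cremona.cubicGraph n)) ∧
    -- one vertex has weight 2, four have weight 1, and there are no others
    (∀ φ : Cremona.PlaneCremonaMap, φ.degree = 3 →
      Nat.card φ.proximityGraph.Vertex = 5 ∧
      Nat.card {v : φ.proximityGraph.Vertex // φ.proximityGraph.weight v = 2} = 1 ∧
      Nat.card {v : φ.proximityGraph.Vertex // φ.proximityGraph.weight v = 1} = 4) := by
  have hequiv := Cremona.WeightedDigraph.setoid.iseqv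
  have hinj : Function.Injective fun n : Fin 21 =>
      (⟦Cremona.cubicGraph n⟧ : Quotient Cremona.WeightedDigraph.setoid) := fun n n' h =>
    Cremona.cubicGraph_injective (Quotient.exact h)
  have hrange : Cremona.cubicGraphClasses = Set.range fun n : Fin 21 =>
      (⟦Cremona.cubicGraph n⟧ : Quotient Cremona.WeightedDigraph.setoid) := by
    ext c
    constructor
    · rintro ⟨φ, hφ, rfl⟩
      obtain ⟨n, hn⟩ := Cremona.exists_isomorphic_of_degree_eq_three φ hφ
      exact ⟨n, Quotient.sound (hequiv.symm hn)⟩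
    · rintro ⟨n, rfl⟩
      obtain ⟨φ, hφ, hn⟩ := Cremona.exists_map_isomorphic_cubicGraph n
      exact ⟨φ, hφ, Quotient.sound (hequiv.symm hn)⟩
  refine ⟨?_, fun φ hφ => ?_, Cremona.exists_map_isomorphic_cubicGraph, fun φ hφ => ?_⟩
  · rw [hrange, Set.ncard_range_of_injective hinj, Nat.card_fin]
  · obtain ⟨n, hn⟩ := Cremona.exists_isomorphic_of_degree_eq_three φ hφ
    exact ⟨n, hn, fun n' hn' =>
      Cremona.cubicGraph_injective (hequiv.trans (hequiv.symm hn') hn)⟩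
  · obtain ⟨n, e, -, hw⟩ := Cremona.exists_isomorphic_of_degree_eq_three φ hφ
    obtain ⟨h1, h2, h3⟩ := Cremona.card_cubicGraph n
    refine ⟨(Nat.card_congr e).trans h1, Eq.trans (Nat.card_congr (e.subtypeEquiv fun v => ?_)) h2,
      Eq.trans (Nat.card_congr (e.subtypeEquiv fun v => ?_)) h3⟩ <;> rw [hw]
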